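/- **Setting.** Let $k$ be a field, $G$ an abelian group, and $I$ a finite totally ordered set of vertices. Let $V=\bigoplus_{i\in I}kx_i$ be a quantum linear space (type $A_1\times\dots\times A_1$): the coaction is $x_i\mapsto g_i\otimes x_i$ and the action is $hx_i=\chi_i(h)x_i$, with $g_i\in G$ and characters $\chi_i:G\to k^\times$ such that $N_i=\operatorname{ord}\chi_i(g_i)$ is finite and $>2$, $\chi_i^{N_i}=\varepsilon$, and $\chi_i(g_j)\chi_j(g_i)=1$ for $i\ne j$. Vertices $i\neq j$ are *linkable* if $\chi_i\chi_j=\varepsilon$. Put $z_i=x_i^{N_i}$ and $z_{ji}=x_jx_i-\chi_i(g_j)x_ix_j$ for $i<j$. Let $R$ be the braided Hopf algebra with primitive generators $x_i$ and relations: $z_{ji}=0$ for $i<j$ not linkable; $x_iz_j=z_jx_i$ for all linkable $i,j$; $z_{ji}$ commutes with $z_i$ and $z_j$ for linkable $i<j$. Let $K\subset R$ be the Hopf subalgebra generated by all $z_i$ and by the $z_{ji}$ with $i<j$ linkable, and let $\pi:R\to B$ be the quotient by the ideal generated by these elements ($B$ is the Nichols algebra of $V$). Let $J$ be the ideal of $R$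 generated by the elements $x_lz_{ji}-z_{ji}x_l$ ($l\in I$, $i<j$ linkable), and let $u:R\to K$ be the $K$-bimodule retraction with $u(J)=0$ and $u(x^ay)=\varepsilon(x^a)y$ for $y\in K$ and ordered monomials $x^a$, $0\le a_i<N_i$. Let $*$ denote convolution, with respect to the braided comultiplications on tensor powers. Let $\mathrm{Reg}_G(X,k)$ be the group of $G$-invariant, convolution invertible functionals, and $\mathrm{Alg}_G(K,k)$ the group of $G$-invariant algebra maps. For $X=R$ or $X=B$ with multiplication $m$, put $\partial^0v=\varepsilon\otimes v$, $\partial^1v=v\circ m$, $\partial^2v=v\otimes\varepsilon$ and $\partial v=\partial^0v*\partial^2v*\partial^1v^{-1}$ for $v\in \mathrm{Reg}_G(X,k)$. Let $Z^2_G(B,k)$ be the set of $\sigma\in\mathrm{Reg}_G(B\otimes B,k)$ with $$(\varepsilon\otimes\sigma)*\sigma(1\otimes m)=(\sigma\otimes\varepsilon)*\sigma(m\otimes1),\qquad \sigma(1_B\otimes b)=\varepsilon(b)=\sigma(b\otimes 1_B)\quad(b\in B),$$ and let $\mathcal H^2_G(B,k)$ be its quotient by the relation $\sigma\sim\partial^0\chi*\partial^2\chi*\sigma*\partial^1\chi^{-1}$,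 $\chi\in\mathrm{Reg}_G(B,k)$. The *connecting map* $\delta:\mathrm{Alg}_G(K,k)\to\mathcal H^2_G(B,k)$ sends $f$ to the class of the unique $\sigma\in Z^2_G(B,k)$ with $\sigma\circ(\pi\otimes\pi)=\partial v$, where $v\in\mathrm{Reg}_G(R,k)$ is the convolution inverse of $f^{-1}\circ u$ and $f^{-1}$ is the inverse of $f$ in $\mathrm{Alg}_G(K,k)$. This map is well defined; moreover $v|_K=f$, and one has $\delta f=[\sigma]$ whenever $\sigma\in Z^2_G(B,k)$ and $\sigma\circ(\pi\otimes\pi)=\partial v$ for any $v\in\mathrm{Reg}_G(R,k)$ with $v|_K=f$. For $S\subseteq I$ let $R_S,K_S,B_S$ be the objects of the subdiagram $S$, $i_S$ the inclusions into $R,K,B$, and $p_S$ the projections from $R,K,B$ (algebra maps with $p_S(x_i)=x_i$ for $i\in S$ and $p_S(x_i)=0$ for $i\notin S$). Put $e_S=i_Sp_S$. For a second subset $T$ put $\rho=(p_S\otimes p_T)\Delta$, on $K$ and on $B$. **Proposition 3.6.** Suppose that $I=S\sqcup T$ and that no vertex of $S$ is linkable to a vertex of $T$. Then the retraction $u$ exists,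 as do those of the subdiagrams $S$ and $T$, which are $p_Sui_S$ and $p_Tui_T$. With $u_S:=ue_S$ and $u_T:=ue_T$ one has $u_S=e_Su$, $u_T=e_Tu$ and $$u=u_S*u_T:R\to K.$$ The square $$\begin{array}{ccc}\mathrm{Alg}_G(K_S,k)\times\mathrm{Alg}_G(K_T,k)&\xrightarrow{\ \delta\times\delta\ }&\mathcal H^2_G(B_S,k)\times\mathcal H^2_G(B_T,k)\\ \rho^1\downarrow&&\downarrow\rho^2\\ \mathrm{Alg}_G(K,k)&\xrightarrow{\ \delta\ }&\mathcal H^2_G(B,k)\end{array}$$ commutes, where $\rho^1(f,f')=(f\otimes f')\rho$, and $\rho^2$ is the well-defined map induced on classes by $\rho^2(\sigma,\sigma')=(\sigma\otimes\sigma')(1\otimes c\otimes1)(\rho\otimes\rho)$, with $c:B_T\otimes B_S\to B_S\otimes B_T$ the braiding. Moreover, $\rho^1$ is an isomorphism of groups and $\rho^2$ is injective. -/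

import Mathlib

open scoped TensorProduct

noncomputable section

/-- The combinatorial datum of a quantum linear space (type `A₁ × ⋯ × A₁`) over the group algebra
of an abelian group `G`: the crossed module `V = ⨁ k xᵢ` with coaction `xᵢ ↦ gᵢ ⊗ xᵢ` and action
`h xᵢ = χᵢ(h) xᵢ`. -/
structure QLS (k G ι : Type*) [Field k] [CommGroup G] where
  /-- the group elements `gᵢ` -/
  g : ι → G
  /-- the characters `χᵢ` -/
  χ : ι → G →* kˣ
  /-- the order `Nᵢ` of `χᵢ(gᵢ)` is finite and greater than `2` -/
  two_lt_order : ∀ i, 2 < orderOf (χ i (g i))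
  chi_pow : ∀ i, χ i ^ orderOf (χ i (g i)) = 1
  cartan : ∀ i j, i ≠ j → χ i (g j) * χ j (g i) = 1

namespace QLS

/-- `pre` labels the braided Hopf algebra `R`, `nichols` labels the Nichols algebra `B`. -/
inductive Layer
  | pre
  | nichols

/-! ### Generalities: convolution and braided tensor products -/

section General

variable {k G : Type*} [Field k]

/-- The convolution product `m (f ⊗ f') Δ`. -/
def conv {C A : Type*} [AddCommGroup C] [Module k C] [Ring A] [Algebra k A]
    (Δ : C →ₗ[k] C ⊗[k] C) (f f' : C →ₗ[k] A) : C →ₗ[k] A :=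
  LinearMap.mul' k A ∘ₗ TensorProduct.map f f' ∘ₗ Δ

/-- The functional `f ⊗ f'`. -/
def tens {C D : Type*} [AddCommGroup C] [Module k C] [AddCommGroup D] [Module k D]
    (f : C →ₗ[k] k) (f' : D →ₗ[k] k) : C ⊗[k] D →ₗ[k] k :=
  LinearMap.mul' k k ∘ₗ TensorProduct.map f f'

/-- A linear representation of `G` on `Y`, seen as the `kG`-module structure `kG ⊗ Y → Y`. -/
def actMap {Y : Type*} [AddCommGroup Y] [Module k Y] (a : G → Y →ₗ[k] Y) :
    MonoidAlgebra k G ⊗[k] Y →ₗ[k] Y :=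
  TensorProduct.lift ((Finsupp.lift (Y →ₗ[k] Y) k G a) ∘ₗ
    (MonoidAlgebra.coeffLinearEquiv k).toLinearMap)

/-- The braiding `c (x ⊗ y) = x₋₁ y ⊗ x₀`, for a coaction `x ↦ x₋₁ ⊗ x₀` of `kG` on `X` and an
action of `G` on `Y`. -/
def braid {X Y : Type*} [AddCommGroup X] [Module k X] [AddCommGroup Y] [Module k Y]
    (ρ : X →ₗ[k] MonoidAlgebra k G ⊗[k] X) (a : G → Y →ₗ[k] Y) : X ⊗[k] Y →ₗ[k] Y ⊗[k] X :=
  (actMap a).rTensor X ∘ₗ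
    (TensorProduct.assoc k (MonoidAlgebra k G) Y X).symm.toLinearMap ∘ₗ
    (TensorProduct.comm k X Y).toLinearMap.lTensor (MonoidAlgebra k G) ∘ₗ
    (TensorProduct.assoc k (MonoidAlgebra k G) X Y).toLinearMap ∘ₗ ρ.rTensor Y

/-- The map `1 ⊗ c ⊗ 1 : (A ⊗ C) ⊗ (B ⊗ D) → (A ⊗ B) ⊗ (C ⊗ D)` for `c : C ⊗ B → B ⊗ C`. -/
def mid {A B C D : Type*} [AddCommGroup A] [Module k A] [AddCommGroup B] [Module k B]
    [AddCommGroup C] [Module k C] [AddCommGroup D] [Module k D]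
    (c : C ⊗[k] B →ₗ[k] B ⊗[k] C) :
    (A ⊗[k] C) ⊗[k] (B ⊗[k] D) →ₗ[k] (A ⊗[k] B) ⊗[k] (C ⊗[k] D) :=
  (TensorProduct.assoc k A B (C ⊗[k] D)).symm.toLinearMap ∘ₗ
    ((TensorProduct.assoc k B C D).toLinearMap ∘ₗ c.rTensor D ∘ₗ
      (TensorProduct.assoc k C B D).symm.toLinearMap).lTensor A ∘ₗ
    (TensorProduct.assoc k A C (B ⊗[k] D)).toLinearMap

theorem braid_apply {X Y : Type*} [AddCommGroup X] [Module k X] [AddCommGroup Y] [Module k Y]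
    (ρ : X →ₗ[k] MonoidAlgebra k G ⊗[k] X) (a : G → Y →ₗ[k] Y) (x : X) (y : Y) (h : G)
    (hx : ρ x = MonoidAlgebra.single h 1 ⊗ₜ x) : braid ρ a (x ⊗ₜ y) = a h y ⊗ₜ x := by
  simp [braid, hx, actMap, MonoidAlgebra.coeff_single]

theorem mid_apply {A B C D : Type*} [AddCommGroup A] [Module k A] [AddCommGroup B] [Module k B]
    [AddCommGroup C] [Module k C] [AddCommGroup D] [Module k D]
    (c : C ⊗[k] B →ₗ[k] B ⊗[k] C) (x : A) (y : C) (z : B) (w : D) (z' : B) (y' : C)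
    (h : c (y ⊗ₜ z) = z' ⊗ₜ y') :
    mid c ((x ⊗ₜ y) ⊗ₜ (z ⊗ₜ w)) = (x ⊗ₜ[k] z') ⊗ₜ[k] (y' ⊗ₜ[k] w) := by
  simp [mid, h]

end General

/-! ### A `q`-binomial formula -/

/-- The `q`-binomial coefficients. -/
def qbin {k : Type*} [Field k] (q : k) : ℕ → ℕ → k
  | _, 0 => 1
  | 0, _ + 1 => 0
  | n + 1, i + 1 => qbin q n i * q ^ (n - i) + qbin q n (i + 1)

theorem qbin_gt {k : Type*} [Field k] (q : k) : ∀ n i, n < i → qbin q n i = 0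
  | 0, i + 1, _ => rfl
  | n + 1, i + 1, h => by
    rw [qbin, qbin_gt q n i (by omega), qbin_gt q n (i + 1) (by omega)]; simp

theorem qbin_zero {k : Type*} [Field k] (q : k) (n : ℕ) : qbin q n 0 = 1 := by
  cases n <;> rfl

theorem qbin_self {k : Type*} [Field k] (q : k) : ∀ n, qbin q n n = 1
  | 0 => rfl
  | n + 1 => by rw [qbin, qbin_self q n, qbin_gt q n (n + 1) (by omega)]; simp

theorem qbin_rec {k : Type*} [Field k] (q : k) :
    ∀ n i, i ≤ n → (q ^ (i + 1) - 1) * qbin q n (i + 1) = (q ^ (n - i) - 1) * qbin q n i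
  | 0, 0, _ => by simp [qbin]
  | n + 1, 0, _ => by
    have h := qbin_rec q n 0 (by omega)
    simp only [qbin, qbin_zero, Nat.sub_zero] at *
    linear_combination h
  | n + 1, i + 1, h => by
    have h1 := qbin_rec q n i (by omega)
    rcases Nat.lt_or_ge i n with hi | hi
    · have h2 := qbin_rec q n (i + 1) (by omega)
      obtain ⟨d, rfl⟩ : ∃ d, n = i + 1 + d := ⟨n - (i + 1), by omega⟩
      simp only [qbin, show i + 1 + d + 1 - (i + 1) = d + 1 by omega,
        show i + 1 + d - i = d + 1 by omega, show i + 1 + d - (i + 1) = d by omega] at *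
      linear_combination h2 + q ^ (d + 1) * h1
    · obtain rfl : i = n := by omega
      simp [qbin, qbin_gt]

theorem add_pow_q {k A : Type*} [Field k] [Ring A] [Algebra k A] (q : k) (a c : A)
    (h : c * a = q • (a * c)) (n : ℕ) :
    (a + c) ^ n = ∑ i ∈ Finset.range (n + 1), qbin q n i • (a ^ i * c ^ (n - i)) := by
  have hc : ∀ m : ℕ, c ^ m * a = q ^ m • (a * c ^ m) := by
    intro m
    induction m with
    | zero => simp
    | succ m ih =>
      rw [pow_succ', mul_assoc, ih, mul_smul_comm, ← mul_assoc, h, smul_mul_assoc, smul_smul,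
        mul_assoc, ← pow_succ]
  induction n with
  | zero => simp [qbin]
  | succ n ih =>
    rw [pow_succ, ih, mul_add, Finset.sum_mul, Finset.sum_mul, Finset.sum_range_succ' _ (n + 1)]
    have e1 : ∀ i, (qbin q n i • (a ^ i * c ^ (n - i))) * a
        = (qbin q n i * q ^ (n - i)) • (a ^ (i + 1) * c ^ (n - i)) := by
      intro i
      rw [smul_mul_assoc, mul_assoc, hc, mul_smul_comm, smul_smul, ← mul_assoc, ← pow_succ]
    simp only [e1, qbin, add_smul, Finset.sum_add_distrib, Nat.add_sub_add_right, add_assoc]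
    congr 1
    rw [Finset.sum_range_succ (fun x => qbin q n (x + 1) • (a ^ (x + 1) * c ^ (n - x))),
      qbin_gt q n (n + 1) (by omega), Finset.sum_range_succ' _ n]
    simp only [zero_smul, add_zero, qbin_zero, pow_zero, one_mul, one_smul, Nat.sub_zero, pow_succ,
      smul_mul_assoc]
    congr 1
    refine Finset.sum_congr rfl fun i hi => ?_
    rw [Finset.mem_range] at hi
    rw [mul_assoc (a ^ i * a), ← pow_succ, ← pow_succ, show n - (i + 1) + 1 = n - i by omega]

theorem add_pow_order {k A : Type*} [Field k] [Ring A] [Algebra k A] (q : kˣ) (a c : A)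
    (h : c * a = (q : k) • (a * c)) (hq : 0 < orderOf q) :
    (a + c) ^ orderOf q = a ^ orderOf q + c ^ orderOf q := by
  have hz : ∀ i, i + 1 < orderOf q → qbin (q : k) (orderOf q) (i + 1) = 0 := by
    intro i hi
    have hne : ∀ j, j + 1 < orderOf q → (q : k) ^ (j + 1) - 1 ≠ 0 := by
      intro j hj h0
      have : q ^ (j + 1) = 1 := by ext; push_cast; linear_combination h0
      exact absurd (Nat.le_of_dvd (by omega) (orderOf_dvd_of_pow_eq_one this)) (by omega)
    induction i with
    | zero =>
      have h1 := qbin_rec (q : k) (orderOf q) 0 (by omega)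
      have h2 : (q : k) ^ orderOf q = 1 := by
        rw [← Units.val_pow_eq_pow_val, pow_orderOf_eq_one, Units.val_one]
      rw [Nat.sub_zero, h2, sub_self, zero_mul] at h1
      exact (mul_eq_zero.1 h1).resolve_left (hne 0 hi)
    | succ i ih =>
      have h1 := qbin_rec (q : k) (orderOf q) (i + 1) (by omega)
      rw [ih (by omega), mul_zero] at h1
      exact (mul_eq_zero.1 h1).resolve_left (hne _ hi)
  obtain ⟨n, hn⟩ : ∃ n, orderOf q = n + 1 := ⟨orderOf q - 1, by omega⟩
  rw [add_pow_q (q : k) a c h, Finset.sum_range_succ, qbin_self, hn, Finset.sum_range_succ',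
    Finset.sum_eq_zero]
  · simp [qbin_zero, add_comm]
  · intro i hi
    rw [Finset.mem_range] at hi
    rw [← hn, hz i (by omega), zero_smul]

/-! ### The braided Hopf algebras `R` and `B` -/

set_option linter.unusedSectionVars false

variable {k G ι : Type*} [Field k] [CommGroup G] [LinearOrder ι]

/-- The order `Nᵢ` of `qᵢᵢ = χᵢ(gᵢ)`. -/
def N (D : QLS k G ι) (i : ι) : ℕ := orderOf (D.χ i (D.g i))

/-- Two vertices are linkable if `χᵢ χⱼ = ε`. -/
def Linkable (D : QLS k G ι) (i j : ι) : Prop := i ≠ j ∧ D.χ i * D.χ j = 1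

/-- `zᵢ = xᵢ ^ Nᵢ`, for elements `x` of any algebra. -/
def root {A : Type*} [Ring A] [Algebra k A] (D : QLS k G ι) (x : ι → A) (i : ι) : A :=
  x i ^ D.N i

/-- The braided commutator `zⱼᵢ = [xⱼ, xᵢ] = xⱼ xᵢ - χᵢ(gⱼ) xᵢ xⱼ`, for elements `x` of any
algebra. -/
def link {A : Type*} [Ring A] [Algebra k A] (D : QLS k G ι) (x : ι → A) (j i : ι) : A :=
  x j * x i - (D.χ i (D.g j) : k) • (x i * x j)

/-- The defining relations. The group acts trivially on `zᵢ` and, for linkable `i, j`, on `zⱼᵢ`, so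
that the braided commutators `[xᵢ, zⱼ]`, `[zᵢ, zⱼᵢ]`, `[zⱼ, zⱼᵢ]` are ordinary commutators. For the
Nichols algebra all the `zᵢ` and all the `zⱼᵢ` are killed. -/
inductive Rel (D : QLS k G ι) : Layer → FreeAlgebra k ι → FreeAlgebra k ι → Prop
  | comm (L : Layer) (i j : ι) : i < j → ¬ D.Linkable i j → Rel D L (D.link (FreeAlgebra.ι k) j i) 0
  | x_root (L : Layer) (i j : ι) : D.Linkable i j →
      Rel D L (FreeAlgebra.ι k i * D.root (FreeAlgebra.ι k) j)
        (D.root (FreeAlgebra.ι k) j * FreeAlgebra.ι k i)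
  | root_link_left (L : Layer) (i j : ι) : i < j → D.Linkable i j →
      Rel D L (D.root (FreeAlgebra.ι k) i * D.link (FreeAlgebra.ι k) j i)
        (D.link (FreeAlgebra.ι k) j i * D.root (FreeAlgebra.ι k) i)
  | root_link_right (L : Layer) (i j : ι) : i < j → D.Linkable i j →
      Rel D L (D.root (FreeAlgebra.ι k) j * D.link (FreeAlgebra.ι k) j i)
        (D.link (FreeAlgebra.ι k) j i * D.root (FreeAlgebra.ι k) j)
  | root_zero (i : ι) : Rel D .nichols (D.root (FreeAlgebra.ι k) i) 0
  | link_zero (i j : ι) : i < j → D.Linkable i j →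
      Rel D .nichols (D.link (FreeAlgebra.ι k) j i) 0

/-- The braided Hopf algebra `R` (for `L = pre`) or `B` (for `L = nichols`), by generators and
relations. -/
def Alg (D : QLS k G ι) (L : Layer) : Type _ := RingQuot (D.Rel L)

instance (D : QLS k G ι) (L : Layer) : Ring (D.Alg L) :=
  inferInstanceAs (Ring (RingQuot (D.Rel L)))

instance (D : QLS k G ι) (L : Layer) : Algebra k (D.Alg L) :=
  inferInstanceAs (Algebra k (RingQuot (D.Rel L)))

/-- The canonical projection from the free algebra. -/
def proj (D : QLS k G ι) (L : Layer) : FreeAlgebra k ι →ₐ[k] D.Alg L :=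
  RingQuot.mkAlgHom k (D.Rel L)

theorem proj_rel (D : QLS k G ι) (L : Layer) {a b : FreeAlgebra k ι} (h : D.Rel L a b) :
    D.proj L a = D.proj L b :=
  RingQuot.mkAlgHom_rel k h

/-- The braided Hopf algebra `R`. -/
abbrev R (D : QLS k G ι) : Type _ := D.Alg .pre

/-- The Nichols algebra `B`. -/
abbrev B (D : QLS k G ι) : Type _ := D.Alg .nichols

/-- The generators `xᵢ`. -/
def x (D : QLS k G ι) (L : Layer) (i : ι) : D.Alg L :=
  D.proj L (FreeAlgebra.ι k i)

/-- The family `y` satisfies the defining relations. -/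
structure Sat (D : QLS k G ι) (L : Layer) {A : Type*} [Ring A] [Algebra k A] (y : ι → A) :
    Prop where
  comm : ∀ i j, i < j → ¬ D.Linkable i j → D.link y j i = 0
  x_root : ∀ i j, D.Linkable i j → Commute (y i) (D.root y j)
  root_link_left : ∀ i j, i < j → D.Linkable i j → Commute (D.root y i) (D.link y j i)
  root_link_right : ∀ i j, i < j → D.Linkable i j → Commute (D.root y j) (D.link y j i)
  root_zero : L = .nichols → ∀ i, D.root y i = 0
  link_zero : L = .nichols → ∀ i j, i < j → D.Linkable i j → D.link y j i = 0

theorem map_root {A A' : Type*} [Ring A] [Algebra k A] [Ring A'] [Algebra k A'] (D : QLS k G ι)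
    (f : A →ₐ[k] A') (y : ι → A) (i : ι) : f (D.root y i) = D.root (fun i => f (y i)) i := by
  simp [root]

theorem map_link {A A' : Type*} [Ring A] [Algebra k A] [Ring A'] [Algebra k A'] (D : QLS k G ι)
    (f : A →ₐ[k] A') (y : ι → A) (j i : ι) :
    f (D.link y j i) = D.link (fun i => f (y i)) j i := by
  simp [link]

/-- The algebra map defined on the generators. -/
def lift (D : QLS k G ι) (L : Layer) {A : Type*} [Ring A] [Algebra k A] (y : ι → A)
    (h : D.Sat L y) : D.Alg L →ₐ[k] A :=
  RingQuot.liftAlgHom k ⟨FreeAlgebra.lift k y, by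
    intro a b hab
    cases hab with
    | comm _ i j h1 h2 => simpa [map_link] using h.comm i j h1 h2
    | x_root _ i j h1 => simpa [map_root] using (h.x_root i j h1).eq
    | root_link_left _ i j h1 h2 =>
      simpa [map_root, map_link] using (h.root_link_left i j h1 h2).eq
    | root_link_right _ i j h1 h2 =>
      simpa [map_root, map_link] using (h.root_link_right i j h1 h2).eq
    | root_zero i => simpa [map_root] using h.root_zero rfl i
    | link_zero i j h1 h2 => simpa [map_link] using h.link_zero rfl i j h1 h2⟩

@[simp]
theorem lift_x (D : QLS k G ι) (L : Layer) {A : Type*} [Ring A] [Algebra k A] (y : ι → A)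
    (h : D.Sat L y) (i : ι) : D.lift L y h (D.x L i) = y i := by
  exact (RingQuot.liftAlgHom_mkAlgHom_apply k (FreeAlgebra.lift k y) _ _).trans (by simp)

theorem hom_ext {D : QLS k G ι} {L : Layer} {A : Type*} [Ring A] [Algebra k A]
    {f f' : D.Alg L →ₐ[k] A} (h : ∀ i, f (D.x L i) = f' (D.x L i)) : f = f' :=
  RingQuot.ringQuot_ext' (s := D.Rel L) k f f'
    (FreeAlgebra.hom_ext (funext h) : f.comp (D.proj L) = f'.comp (D.proj L))

theorem sat_x (D : QLS k G ι) (L : Layer) : D.Sat L (D.x L) where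
  comm i j h1 h2 := by
    have := D.proj_rel _ (Rel.comm (D := D) L i j h1 h2)
    rw [map_link, map_zero] at this; exact this
  x_root i j h1 := by
    have := D.proj_rel _ (Rel.x_root (D := D) L i j h1)
    rw [map_mul, map_mul, map_root] at this; exact this
  root_link_left i j h1 h2 := by
    have := D.proj_rel _ (Rel.root_link_left (D := D) L i j h1 h2)
    rw [map_mul, map_mul, map_root, map_link] at this; exact this
  root_link_right i j h1 h2 := by
    have := D.proj_rel _ (Rel.root_link_right (D := D) L i j h1 h2)
    rw [map_mul, map_mul, map_root, map_link] at this; exact this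
  root_zero hL i := by
    subst hL
    have := D.proj_rel _ (Rel.root_zero (D := D) i)
    rw [map_root, map_zero] at this; exact this
  link_zero hL i j h1 h2 := by
    subst hL
    have := D.proj_rel _ (Rel.link_zero (D := D) i j h1 h2)
    rw [map_link, map_zero] at this; exact this

theorem N_pos (D : QLS k G ι) (i : ι) : 0 < D.N i := by
  have := D.two_lt_order i
  unfold N; omega

/-! ### Action, coaction, counit, comultiplication -/

/-- A homogeneous family with the same relations. -/
theorem Sat.scale {D : QLS k G ι} {L : Layer} {A C : Type*} [Ring A] [Algebra k A] [CommRing C]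
    [Algebra k C] {y : ι → A} (h : D.Sat L y) (c : ι → C) :
    D.Sat L (fun i => (c i ⊗ₜ[k] y i : C ⊗[k] A)) := by
  have hr : ∀ i, D.root (fun i => (c i ⊗ₜ[k] y i : C ⊗[k] A)) i
      = (c i ^ D.N i) ⊗ₜ[k] D.root y i := fun i => by simp [root]
  have hl : ∀ j i, D.link (fun i => (c i ⊗ₜ[k] y i : C ⊗[k] A)) j i
      = (c j * c i) ⊗ₜ[k] D.link y j i := fun j i => by
    simp [link, TensorProduct.tmul_sub, mul_comm (c i)]
  have hcomm : ∀ (a b : C) (u v : A), Commute u v → Commute (a ⊗ₜ[k] u) (b ⊗ₜ[k] v) := by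
    intro a b u v huv
    simp [Commute, SemiconjBy, mul_comm a, huv.eq]
  constructor
  · intro i j h1 h2; rw [hl, h.comm i j h1 h2, TensorProduct.tmul_zero]
  · intro i j h1; rw [hr]; exact hcomm _ _ _ _ (h.x_root i j h1)
  · intro i j h1 h2; rw [hr, hl]; exact hcomm _ _ _ _ (h.root_link_left i j h1 h2)
  · intro i j h1 h2; rw [hr, hl]; exact hcomm _ _ _ _ (h.root_link_right i j h1 h2)
  · intro hL i; rw [hr, h.root_zero hL i, TensorProduct.tmul_zero]
  · intro hL i j h1 h2; rw [hl, h.link_zero hL i j h1 h2, TensorProduct.tmul_zero]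

/-- The `kG`-coaction, the algebra map with `xᵢ ↦ gᵢ ⊗ xᵢ`. -/
def coact (D : QLS k G ι) (L : Layer) : D.Alg L →ₐ[k] MonoidAlgebra k G ⊗[k] D.Alg L :=
  D.lift L (fun i => MonoidAlgebra.single (D.g i) 1 ⊗ₜ D.x L i) ((D.sat_x L).scale _)

theorem Sat.smul {D : QLS k G ι} {L : Layer} {A : Type*} [Ring A] [Algebra k A]
    {y : ι → A} (h : D.Sat L y) (c : ι → k) : D.Sat L (fun i => c i • y i) := by
  have hr : ∀ i, D.root (fun i => c i • y i) i = (c i ^ D.N i) • D.root y i :=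
    fun i => by simp [root, smul_pow]
  have hl : ∀ j i, D.link (fun i => c i • y i) j i = (c j * c i) • D.link y j i := fun j i => by
    simp [link, smul_sub, smul_smul]; ring_nf
  constructor
  · intro i j h1 h2; rw [hl, h.comm i j h1 h2, smul_zero]
  · intro i j h1; rw [hr]; exact ((h.x_root i j h1).smul_left _).smul_right _
  · intro i j h1 h2; rw [hr, hl]; exact ((h.root_link_left i j h1 h2).smul_left _).smul_right _
  · intro i j h1 h2; rw [hr, hl]; exact ((h.root_link_right i j h1 h2).smul_left _).smul_right _
  · intro hL i; rw [hr, h.root_zero hL i, smul_zero]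
  · intro hL i j h1 h2; rw [hl, h.link_zero hL i j h1 h2, smul_zero]

/-- The `G`-action, by the algebra maps with `xᵢ ↦ χᵢ(h) xᵢ`. -/
def act (D : QLS k G ι) (L : Layer) (h : G) : D.Alg L →ₐ[k] D.Alg L :=
  D.lift L (fun i => (D.χ i h : k) • D.x L i) ((D.sat_x L).smul _)

@[simp]
theorem act_x (D : QLS k G ι) (L : Layer) (h : G) (i : ι) :
    D.act L h (D.x L i) = (D.χ i h : k) • D.x L i := by simp [act]

theorem act_mul (D : QLS k G ι) (L : Layer) (h h' : G) :
    D.act L (h * h') = (D.act L h).comp (D.act L h') :=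
  hom_ext fun i => by simp [smul_smul, mul_comm]

theorem sat_zero (D : QLS k G ι) (L : Layer) : D.Sat L (fun _ => (0 : k)) := by
  have hr : ∀ i, D.root (fun _ => (0 : k)) i = 0 := fun i => by simp [root, (D.N_pos i).ne']
  have hl : ∀ j i, D.link (fun _ => (0 : k)) j i = 0 := fun j i => by simp [link]
  constructor <;> simp [hr, hl]

/-- The counit. -/
def counit (D : QLS k G ι) (L : Layer) : D.Alg L →ₐ[k] k := D.lift L _ (D.sat_zero L)

/-- The left multiplication by `a ⊗ 1` in the braided tensor product. -/
def opL (D : QLS k G ι) (L : Layer) (a : D.Alg L) : Module.End k (D.Alg L ⊗[k] D.Alg L) :=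
  TensorProduct.map (LinearMap.mulLeft k a) LinearMap.id

/-- The left multiplication by `1 ⊗ a` in the braided tensor product, for `a` of degree `h`:
`(1 ⊗ a)(b ⊗ b') = h b ⊗ a b'`. -/
def opR (D : QLS k G ι) (L : Layer) (h : G) (a : D.Alg L) :
    Module.End k (D.Alg L ⊗[k] D.Alg L) :=
  TensorProduct.map (D.act L h).toLinearMap (LinearMap.mulLeft k a)

theorem opL_mul (D : QLS k G ι) (L : Layer) (a b : D.Alg L) :
    D.opL L (a * b) = D.opL L a * D.opL L b := by
  ext; simp [opL]

theorem opL_lin (D : QLS k G ι) (L : Layer) (a b : D.Alg L) (c : k) :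
    D.opL L (a - c • b) = D.opL L a - c • D.opL L b := by
  ext; simp [opL, sub_mul, TensorProduct.sub_tmul, TensorProduct.smul_tmul']

theorem opR_mul (D : QLS k G ι) (L : Layer) (h h' : G) (a b : D.Alg L) :
    D.opR L (h * h') (a * b) = D.opR L h a * D.opR L h' b := by
  ext; simp [opR, act_mul]

theorem opR_lin (D : QLS k G ι) (L : Layer) (h : G) (a b : D.Alg L) (c : k) :
    D.opR L h (a - c • b) = D.opR L h a - c • D.opR L h b := by
  ext; simp [opR, sub_mul, TensorProduct.tmul_sub, TensorProduct.tmul_smul]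

theorem opR_opL (D : QLS k G ι) (L : Layer) (h : G) (a b : D.Alg L) :
    D.opR L h a * D.opL L b = D.opL L (D.act L h b) * D.opR L h a := by
  ext; simp [opR, opL]

theorem opL_zero (D : QLS k G ι) (L : Layer) : D.opL L 0 = 0 := by ext; simp [opL]

theorem opR_zero (D : QLS k G ι) (L : Layer) (h : G) : D.opR L h 0 = 0 := by ext; simp [opR]

theorem opL_pow (D : QLS k G ι) (L : Layer) (a : D.Alg L) (n : ℕ) :
    D.opL L (a ^ n) = D.opL L a ^ n := by
  induction n with
  | zero => ext; simp [opL]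
  | succ n ih => rw [pow_succ, opL_mul, ih, pow_succ]

theorem opR_pow (D : QLS k G ι) (L : Layer) (h : G) (a : D.Alg L) (n : ℕ) :
    D.opR L (h ^ (n + 1)) (a ^ (n + 1)) = D.opR L h a ^ (n + 1) := by
  induction n with
  | zero => simp
  | succ n ih => rw [pow_succ, pow_succ a, opR_mul, ih, pow_succ _ (n + 1)]

/-- The left multiplication by `xᵢ ⊗ 1 + 1 ⊗ xᵢ` in the braided tensor product. -/
def opX (D : QLS k G ι) (L : Layer) (i : ι) : Module.End k (D.Alg L ⊗[k] D.Alg L) :=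
  D.opL L (D.x L i) + D.opR L (D.g i) (D.x L i)

theorem act_root (D : QLS k G ι) (L : Layer) (h : G) (i : ι) :
    D.act L h (D.root (D.x L) i) = D.root (D.x L) i := by
  have h1 : D.χ i h ^ D.N i = 1 := by
    have := congrArg (fun f : G →* kˣ => f h) (D.chi_pow i)
    simpa [N] using this
  have h2 : (D.χ i h : k) ^ D.N i = 1 := by
    rw [← Units.val_pow_eq_pow_val, h1, Units.val_one]
  simp [root, smul_pow, h2]

theorem act_link (D : QLS k G ι) (L : Layer) (h : G) (i j : ι) (hij : D.Linkable i j) :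
    D.act L h (D.link (D.x L) j i) = D.link (D.x L) j i := by
  have h1 : D.χ i h * D.χ j h = 1 := by
    simpa using congrArg (fun f : G →* kˣ => f h) hij.2
  have h2 : (D.χ i h : k) * (D.χ j h : k) = 1 := by
    rw [← Units.val_mul, h1, Units.val_one]
  have h3 : (D.χ j h : k) * (D.χ i h : k) = 1 := by rw [mul_comm, h2]
  simp [link, smul_smul, h2, h3]

theorem root_op (D : QLS k G ι) (L : Layer) (i : ι) :
    D.root (D.opX L) i = D.opL L (D.root (D.x L) i)
      + D.opR L (D.g i ^ D.N i) (D.root (D.x L) i) := by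
  unfold root opX N
  rw [add_pow_order (D.χ i (D.g i)), ← opL_pow]
  · obtain ⟨n, hn⟩ : ∃ n, orderOf (D.χ i (D.g i)) = n + 1 :=
      ⟨orderOf (D.χ i (D.g i)) - 1, by have := D.N_pos i; unfold N at this; omega⟩
    rw [hn, opR_pow]
  · rw [opR_opL, act_x]
    ext; simp [opL, opR, TensorProduct.smul_tmul']
  · exact D.N_pos i

theorem opL_smul (D : QLS k G ι) (L : Layer) (a : D.Alg L) (c : k) :
    D.opL L (c • a) = c • D.opL L a := by
  ext; simp [opL, TensorProduct.smul_tmul']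

theorem link_op (D : QLS k G ι) (L : Layer) (i j : ι) (hij : i ≠ j) :
    D.link (D.opX L) j i = D.opL L (D.link (D.x L) j i)
      + D.opR L (D.g j * D.g i) (D.link (D.x L) j i) := by
  have h1 : (D.χ i (D.g j) : k) * (D.χ j (D.g i) : k) = 1 := by
    rw [← Units.val_mul, D.cartan i j hij, Units.val_one]
  unfold link opX
  rw [opL_lin, opR_lin, opL_mul, opL_mul, opR_mul, mul_comm (D.g j), opR_mul]
  simp only [add_mul, mul_add, opR_opL, act_x, opL_smul, smul_add, smul_mul_assoc, smul_smul, h1,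
    one_smul]
  abel

theorem commute_op (D : QLS k G ι) (L : Layer) (a b : D.Alg L) (h h' : G)
    (hab : Commute a b) (h1 : D.act L h b = b) (h2 : D.act L h' a = a) :
    Commute (D.opL L a + D.opR L h a) (D.opL L b + D.opR L h' b) := by
  have e1 : D.opR L h a * D.opL L b = D.opL L b * D.opR L h a := by rw [opR_opL, h1]
  have e2 : D.opR L h' b * D.opL L a = D.opL L a * D.opR L h' b := by rw [opR_opL, h2]
  unfold Commute SemiconjBy
  simp only [add_mul, mul_add, e1, e2, ← opL_mul, ← opR_mul, hab.eq, mul_comm h h']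
  abel

theorem sat_opX (D : QLS k G ι) (L : Layer) : D.Sat L (D.opX L) := by
  have h := D.sat_x L
  constructor
  · intro i j h1 h2
    rw [link_op _ _ _ _ h1.ne, h.comm i j h1 h2, opL_zero, opR_zero, add_zero]
  · intro i j h1
    rw [root_op]
    refine commute_op _ _ _ _ _ _ (h.x_root i j h1) (act_root _ _ _ _) ?_
    have e1 : D.χ i (D.g j) ^ D.N j = 1 := by
      have e2 := D.cartan i j h1.1
      have e3 : D.χ j (D.g i) ^ D.N j = 1 := by
        simpa [N] using congrArg (fun f : G →* kˣ => f (D.g i)) (D.chi_pow j)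
      have := congrArg (· ^ D.N j) e2
      simpa [mul_pow, e3] using this
    rw [act_x, map_pow, e1, Units.val_one, one_smul]
  · intro i j h1 h2
    rw [root_op, link_op _ _ _ _ h1.ne]
    exact commute_op _ _ _ _ _ _ (h.root_link_left i j h1 h2) (act_link _ _ _ _ _ h2)
      (act_root _ _ _ _)
  · intro i j h1 h2
    rw [root_op, link_op _ _ _ _ h1.ne]
    exact commute_op _ _ _ _ _ _ (h.root_link_right i j h1 h2) (act_link _ _ _ _ _ h2)
      (act_root _ _ _ _)
  · intro hL i; rw [root_op, h.root_zero hL i, opL_zero, opR_zero, add_zero]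
  · intro hL i j h1 h2
    rw [link_op _ _ _ _ h1.ne, h.link_zero hL i j h1 h2, opL_zero, opR_zero, add_zero]

/-- The left multiplication by `Δ a` in the braided tensor product, as an algebra map in `a`. -/
def comulOp (D : QLS k G ι) (L : Layer) : D.Alg L →ₐ[k] Module.End k (D.Alg L ⊗[k] D.Alg L) :=
  D.lift L (D.opX L) (D.sat_opX L)

/-- The braided comultiplication: the algebra map into the braided tensor product for which the
`xᵢ` are primitive. -/
def comul (D : QLS k G ι) (L : Layer) : D.Alg L →ₗ[k] D.Alg L ⊗[k] D.Alg L :=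
  LinearMap.applyₗ (1 ⊗ₜ 1) ∘ₗ (D.comulOp L).toLinearMap

/-- The projection `π : R → B`. -/
def pi (D : QLS k G ι) : D.R →ₐ[k] D.B :=
  D.lift .pre (D.x .nichols) {
    comm := (D.sat_x .nichols).comm
    x_root := (D.sat_x .nichols).x_root
    root_link_left := (D.sat_x .nichols).root_link_left
    root_link_right := (D.sat_x .nichols).root_link_right
    root_zero := fun h => nomatch h
    link_zero := fun h => nomatch h }

/-! ### Subdiagrams -/

/-- The subdiagram on the vertex set `S`. -/
def restrict (D : QLS k G ι) (S : Finset ι) : QLS k G S where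
  g i := D.g i
  χ i := D.χ i
  two_lt_order i := D.two_lt_order i
  chi_pow i := D.chi_pow i
  cartan i j h := D.cartan i j (fun e => h (Subtype.ext e))

theorem linkable_restrict (D : QLS k G ι) (S : Finset ι) (i j : S) :
    (D.restrict S).Linkable i j ↔ D.Linkable i j := by
  exact and_congr_left' (not_congr Subtype.ext_iff)

theorem sat_incl (D : QLS k G ι) (L : Layer) (S : Finset ι) :
    (D.restrict S).Sat L (fun i => D.x L i) := by
  have h := D.sat_x L
  constructor
  · intro i j h1 h2; exact h.comm i j h1 (by rwa [linkable_restrict] at h2)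
  · intro i j h1; exact h.x_root i j (by rwa [linkable_restrict] at h1)
  · intro i j h1 h2; exact h.root_link_left i j h1 (by rwa [linkable_restrict] at h2)
  · intro i j h1 h2; exact h.root_link_right i j h1 (by rwa [linkable_restrict] at h2)
  · intro hL i; exact h.root_zero hL i
  · intro hL i j h1 h2; exact h.link_zero hL i j h1 (by rwa [linkable_restrict] at h2)

/-- The injection `i_S : R_S → R` (or `B_S → B`). -/
def incl (D : QLS k G ι) (L : Layer) (S : Finset ι) : (D.restrict S).Alg L →ₐ[k] D.Alg L :=
  (D.restrict S).lift L (fun i => D.x L i) (D.sat_incl L S)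

/-- The images of the generators under the projection to the subdiagram. -/
def xres (D : QLS k G ι) (L : Layer) (S : Finset ι) (i : ι) : (D.restrict S).Alg L :=
  if h : i ∈ S then (D.restrict S).x L ⟨i, h⟩ else 0

theorem root_xres (D : QLS k G ι) (L : Layer) (S : Finset ι) (i : ι) :
    D.root (D.xres L S) i =
      if h : i ∈ S then (D.restrict S).root ((D.restrict S).x L) ⟨i, h⟩ else 0 := by
  unfold root xres
  split_ifs
  · rfl
  · exact zero_pow (D.N_pos i).ne'

theorem link_xres (D : QLS k G ι) (L : Layer) (S : Finset ι) (j i : ι) :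
    D.link (D.xres L S) j i =
      if h : i ∈ S ∧ j ∈ S then (D.restrict S).link ((D.restrict S).x L) ⟨j, h.2⟩ ⟨i, h.1⟩
      else 0 := by
  unfold link xres
  by_cases hi : i ∈ S <;> by_cases hj : j ∈ S <;> simp [hi, hj]
  rfl

theorem sat_xres (D : QLS k G ι) (L : Layer) (S : Finset ι) : D.Sat L (D.xres L S) := by
  have h := (D.restrict S).sat_x L
  have hl := D.linkable_restrict S
  constructor
  · intro i j h1 h2
    rw [link_xres]; split_ifs with hS
    · exact h.comm _ _ h1 (by rwa [hl])
    · rfl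
  · intro i j h1
    rw [root_xres, xres]; split_ifs
    · exact h.x_root _ _ (by rwa [hl])
    · exact Commute.zero_right _
    · exact Commute.zero_left _
    · exact Commute.zero_left _
  · intro i j h1 h2
    rw [link_xres, root_xres]; split_ifs with a b
    · exact h.root_link_left ⟨i, _⟩ ⟨j, _⟩ h1 (by rwa [hl])
    · exact Commute.zero_right _
    · exact Commute.zero_left _
    · exact Commute.zero_left _
  · intro i j h1 h2
    rw [link_xres, root_xres]; split_ifs with a b
    · exact h.root_link_right ⟨i, _⟩ ⟨j, _⟩ h1 (by rwa [hl])
    · exact Commute.zero_right _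
    · exact Commute.zero_left _
    · exact Commute.zero_left _
  · intro hL i
    rw [root_xres]; split_ifs
    · exact h.root_zero hL _
    · rfl
  · intro hL i j h1 h2
    rw [link_xres]; split_ifs with hS
    · exact h.link_zero hL ⟨i, _⟩ ⟨j, _⟩ h1 (by rwa [hl])
    · rfl

/-- The projection `p_S : R → R_S` (or `B → B_S`): `xᵢ ↦ xᵢ` for `i ∈ S` and `xᵢ ↦ 0` otherwise. -/
def res (D : QLS k G ι) (L : Layer) (S : Finset ι) : D.Alg L →ₐ[k] (D.restrict S).Alg L :=
  D.lift L (D.xres L S) (D.sat_xres L S)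

/-- The map `ρ = (p_S ⊗ p_T) Δ`. -/
def rho (D : QLS k G ι) (L : Layer) (S T : Finset ι) :
    D.Alg L →ₗ[k] (D.restrict S).Alg L ⊗[k] (D.restrict T).Alg L :=
  TensorProduct.map (D.res L S).toLinearMap (D.res L T).toLinearMap ∘ₗ D.comul L

/-! ### The Hopf subalgebra `K` of `R` -/

/-- The generators `zᵢ` and `zⱼᵢ` (for `i < j` linkable) of `K`. -/
def gens (D : QLS k G ι) : Set D.R :=
  {z | (∃ i, z = D.root (D.x .pre) i) ∨
    ∃ i j, i < j ∧ D.Linkable i j ∧ z = D.link (D.x .pre) j i}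

/-- The subalgebra `K` of `R`. -/
def K (D : QLS k G ι) : Subalgebra k D.R := Algebra.adjoin k D.gens

theorem act_K (D : QLS k G ι) (h : G) (y : D.R) (hy : y ∈ D.K) : D.act .pre h y = y := by
  induction hy using Algebra.adjoin_induction with
  | mem z hz =>
    rcases hz with ⟨i, rfl⟩ | ⟨i, j, _, hl, rfl⟩
    · exact act_root _ _ _ _
    · exact act_link _ _ _ _ _ hl
  | algebraMap r => simp
  | add a b _ _ ha hb => rw [map_add, ha, hb]
  | mul a b _ _ ha hb => rw [map_mul, ha, hb]

/-- The `G`-action on `K`. -/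
def actK (D : QLS k G ι) (h : G) : D.K →ₐ[k] D.K :=
  ((D.act .pre h).comp D.K.val).codRestrict D.K (fun y => by
    have := D.act_K h y y.2
    simp [this])

theorem actK_eq (D : QLS k G ι) (h : G) (y : D.K) : D.actK h y = y :=
  Subtype.ext (D.act_K h y y.2)

/-- The inclusion of `K ⊗ K` in `R ⊗ R`. -/
def valval (D : QLS k G ι) : D.K ⊗[k] D.K →ₗ[k] D.R ⊗[k] D.R :=
  TensorProduct.map D.K.val.toLinearMap D.K.val.toLinearMap

theorem valval_inj (D : QLS k G ι) : Function.Injective D.valval :=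
  TensorProduct.map_injective_of_flat_flat _ _ Subtype.val_injective
    Subtype.val_injective

theorem exists_comulK (D : QLS k G ι) (y : D.R) (hy : y ∈ D.K) :
    ∃ t : D.K ⊗[k] D.K, ∀ w, D.comulOp .pre y (D.valval w) = D.valval (t * w) := by
  induction hy using Algebra.adjoin_induction with
  | mem z hz =>
    have key : ∀ h : G, D.comulOp .pre z = D.opL .pre z + D.opR .pre h z →
        ∃ t : D.K ⊗[k] D.K, ∀ w, D.comulOp .pre z (D.valval w) = D.valval (t * w) := by
      intro h hh
      refine ⟨⟨z, Algebra.subset_adjoin hz⟩ ⊗ₜ 1 + 1 ⊗ₜ ⟨z, Algebra.subset_adjoin hz⟩,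
        fun w => ?_⟩
      rw [hh]
      induction w using TensorProduct.induction_on with
      | zero => simp
      | add a b ha hb => rw [map_add, map_add, ha, hb, mul_add, map_add]
      | tmul a b => simp [valval, opL, opR, add_mul, D.act_K h a a.2]
    rcases hz with ⟨i, rfl⟩ | ⟨i, j, h1, _, rfl⟩
    · refine key (D.g i ^ D.N i) ?_
      rw [map_root, ← root_op]
      simp [comulOp]
    · refine key (D.g j * D.g i) ?_
      rw [map_link, ← link_op _ _ _ _ h1.ne]
      simp [comulOp]
  | algebraMap r => exact ⟨algebraMap k _ r, fun w => by
      rw [← Algebra.smul_def]; simp⟩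
  | add a b _ _ ha hb =>
    obtain ⟨s, hs⟩ := ha
    obtain ⟨t, ht⟩ := hb
    exact ⟨s + t, fun w => by simp [hs, ht, add_mul]⟩
  | mul a b _ _ ha hb =>
    obtain ⟨s, hs⟩ := ha
    obtain ⟨t, ht⟩ := hb
    exact ⟨s * t, fun w => by simp [hs, ht, mul_assoc]⟩

/-- The element `Δ y` of `K ⊗ K`, for `y ∈ K`. -/
def comulKFun (D : QLS k G ι) (y : D.K) : D.K ⊗[k] D.K := (D.exists_comulK y y.2).choose

theorem comulKFun_spec (D : QLS k G ι) (y : D.K) (w : D.K ⊗[k] D.K) :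
    D.valval (D.comulKFun y * w) = D.comulOp .pre y (D.valval w) :=
  ((D.exists_comulK y y.2).choose_spec w).symm

theorem comulKFun_spec_one (D : QLS k G ι) (y : D.K) :
    D.valval (D.comulKFun y) = D.comulOp .pre y (D.valval 1) := by
  rw [← comulKFun_spec, mul_one]

/-- The restriction of the comultiplication of `R` to `K`, see `valval_comulK`. Since `G` acts
trivially on `K`, it is an algebra map to the ordinary tensor product. -/
def comulK (D : QLS k G ι) : D.K →ₐ[k] D.K ⊗[k] D.K :=
  AlgHom.ofLinearMap
    { toFun := D.comulKFun
      map_add' := fun a b => D.valval_inj <| by simp [comulKFun_spec_one]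
      map_smul' := fun c a => D.valval_inj <| by simp [comulKFun_spec_one] }
    (D.valval_inj <| by simp [comulKFun_spec_one])
    (fun a b => D.valval_inj <| by simp [comulKFun_spec_one, comulKFun_spec])

theorem valval_comulK (D : QLS k G ι) (y : D.K) : D.valval (D.comulK y) = D.comul .pre y := by
  refine (D.comulKFun_spec_one y).trans ?_
  simp [comul, valval, Algebra.TensorProduct.one_def]

theorem incl_K (D : QLS k G ι) (S : Finset ι) (y : (D.restrict S).R)
    (hy : y ∈ (D.restrict S).K) : D.incl .pre S y ∈ D.K := by
  induction hy using Algebra.adjoin_induction with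
  | mem z hz =>
    apply Algebra.subset_adjoin
    rcases hz with ⟨i, rfl⟩ | ⟨i, j, h1, hl, rfl⟩
    · refine Or.inl ⟨i, ?_⟩
      rw [map_root]; simp [incl]; rfl
    · refine Or.inr ⟨i, j, h1, (D.linkable_restrict S i j).1 hl, ?_⟩
      rw [map_link]; simp [incl]; rfl
  | algebraMap r => simp
  | add a b _ _ ha hb => rw [map_add]; exact add_mem ha hb
  | mul a b _ _ ha hb => rw [map_mul]; exact mul_mem ha hb

theorem res_K (D : QLS k G ι) (S : Finset ι) (y : D.R) (hy : y ∈ D.K) :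
    D.res .pre S y ∈ (D.restrict S).K := by
  induction hy using Algebra.adjoin_induction with
  | mem z hz =>
    rcases hz with ⟨i, rfl⟩ | ⟨i, j, h1, hl, rfl⟩
    · rw [map_root]
      simp only [res, lift_x]
      rw [root_xres]
      split_ifs
      · exact Algebra.subset_adjoin (Or.inl ⟨_, rfl⟩)
      · exact zero_mem _
    · rw [map_link]
      simp only [res, lift_x]
      rw [link_xres]
      split_ifs with h
      · exact Algebra.subset_adjoin (Or.inr ⟨⟨i, h.1⟩, ⟨j, h.2⟩, h1,
          (D.linkable_restrict S _ _).2 hl, rfl⟩)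
      · exact zero_mem _
  | algebraMap r => simp
  | add a b _ _ ha hb => rw [map_add]; exact add_mem ha hb
  | mul a b _ _ ha hb => rw [map_mul]; exact mul_mem ha hb

/-- The injection `i_S : K_S → K`. -/
def inclK (D : QLS k G ι) (S : Finset ι) : (D.restrict S).K →ₐ[k] D.K :=
  ((D.incl .pre S).comp (D.restrict S).K.val).codRestrict D.K (fun y => D.incl_K S y y.2)

/-- The projection `p_S : K → K_S`. -/
def resK (D : QLS k G ι) (S : Finset ι) : D.K →ₐ[k] (D.restrict S).K :=
  ((D.res .pre S).comp D.K.val).codRestrict (D.restrict S).K (fun y => D.res_K S y y.2)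

/-- The projection `e_S = i_S p_S` on `R`. -/
def eR (D : QLS k G ι) (S : Finset ι) : D.R →ₗ[k] D.R :=
  (D.incl .pre S).toLinearMap ∘ₗ (D.res .pre S).toLinearMap

/-- The projection `e_S = i_S p_S` on `K`. -/
def eK (D : QLS k G ι) (S : Finset ι) : D.K →ₗ[k] D.K :=
  (D.inclK S).toLinearMap ∘ₗ (D.resK S).toLinearMap

/-- The map `ρ = (p_S ⊗ p_T) Δ` on `K`. -/
def rhoK (D : QLS k G ι) (S T : Finset ι) :
    D.K →ₗ[k] (D.restrict S).K ⊗[k] (D.restrict T).K :=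
  TensorProduct.map (D.resK S).toLinearMap (D.resK T).toLinearMap ∘ₗ D.comulK.toLinearMap

/-- The set `Alg_G(K, k)` of `G`-invariant algebra maps. -/
def AlgG (D : QLS k G ι) : Type _ := {f : D.K →ₐ[k] k // ∀ h y, f (D.actK h y) = f y}

/-- The convolution product on `Alg_G(K, k)`. -/
instance (D : QLS k G ι) : Mul D.AlgG where
  mul f f' := ⟨(Algebra.TensorProduct.lift f.1 f'.1 (fun _ _ => mul_comm _ _)).comp D.comulK,
    fun h y => by rw [actK_eq]⟩

theorem AlgG.mul_def (D : QLS k G ι) (f f' : D.AlgG) :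
    (f * f').1.toLinearMap = conv D.comulK.toLinearMap f.1.toLinearMap f'.1.toLinearMap := by
  ext y
  change Algebra.TensorProduct.lift f.1 f'.1 (fun _ _ => mul_comm _ _) (D.comulK y) = _
  simp only [conv, LinearMap.comp_apply, AlgHom.toLinearMap_apply]
  induction D.comulK y using TensorProduct.induction_on with
  | zero => simp
  | add a b ha hb => rw [map_add, map_add, map_add, ha, hb]
  | tmul a b => exact (Algebra.TensorProduct.lift_tmul _ _ _ _ _).trans (by simp)

/-- The counit of `K` is the unit of `Alg_G(K, k)`. -/
instance (D : QLS k G ι) : One D.AlgG where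
  one := ⟨(D.counit .pre).comp D.K.val, fun h y => by rw [actK_eq]⟩

/-! ### The retraction -/

/-- The ordered monomial `x^a`. -/
def mono [Fintype ι] (D : QLS k G ι) (a : ι → ℕ) : D.R :=
  ((Finset.univ.sort (· ≤ ·)).map (fun i => D.x .pre i ^ a i)).prod

/-- The ideal `J` of `R` generated by the `[xₗ, zⱼᵢ]` for linkable `i < j`. -/
def J (D : QLS k G ι) : TwoSidedIdeal D.R :=
  TwoSidedIdeal.span {w | ∃ i j l, i < j ∧ D.Linkable i j ∧
    w = D.x .pre l * D.link (D.x .pre) j i - D.link (D.x .pre) j i * D.x .pre l}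

/-- `u : R → K` is the `K`-bimodule retraction `u (x^a y + J) = ε(x^a) y`, for `y ∈ K` and for the
ordered monomials `x^a` with `0 ≤ aᵢ < Nᵢ`. -/
structure IsRetraction [Fintype ι] (D : QLS k G ι) (u : D.R →ₗ[k] D.K) : Prop where
  ideal : ∀ w ∈ D.J, u w = 0
  mono_mul : ∀ a : ι → ℕ, (∀ i, a i < D.N i) → ∀ y : D.K,
    u (D.mono a * y) = D.counit .pre (D.mono a) • y
  left_linear : ∀ (y : D.K) (r : D.R), u (y * r) = y * u r
  right_linear : ∀ (y : D.K) (r : D.R), u (r * y) = u r * y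

/-! ### Non-abelian cohomology -/

/-- The comultiplication of the braided tensor square. -/
def comul2 (D : QLS k G ι) (L : Layer) :
    D.Alg L ⊗[k] D.Alg L →ₗ[k] (D.Alg L ⊗[k] D.Alg L) ⊗[k] (D.Alg L ⊗[k] D.Alg L) :=
  mid (braid (D.coact L).toLinearMap (fun h => (D.act L h).toLinearMap)) ∘ₗ
    TensorProduct.map (D.comul L) (D.comul L)

/-- The diagonal action of `G` on the tensor square. -/
def act2 (D : QLS k G ι) (L : Layer) (h : G) :
    D.Alg L ⊗[k] D.Alg L →ₗ[k] D.Alg L ⊗[k] D.Alg L :=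
  TensorProduct.map (D.act L h).toLinearMap (D.act L h).toLinearMap

/-- The comultiplication of the braided tensor cube `X ⊗ (X ⊗ X)`. -/
def comul3 (D : QLS k G ι) (L : Layer) :
    D.Alg L ⊗[k] (D.Alg L ⊗[k] D.Alg L) →ₗ[k]
      (D.Alg L ⊗[k] (D.Alg L ⊗[k] D.Alg L)) ⊗[k] (D.Alg L ⊗[k] (D.Alg L ⊗[k] D.Alg L)) :=
  mid (braid (D.coact L).toLinearMap (D.act2 L)) ∘ₗ TensorProduct.map (D.comul L) (D.comul2 L)

/-- The functional `ε`. -/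
def eps (D : QLS k G ι) (L : Layer) : D.Alg L →ₗ[k] k := (D.counit L).toLinearMap

/-- The functional `ε ⊗ ε`. -/
def eps2 (D : QLS k G ι) (L : Layer) : D.Alg L ⊗[k] D.Alg L →ₗ[k] k :=
  tens (D.eps L) (D.eps L)

/-- The multiplication map `X ⊗ X → X`. -/
def m (D : QLS k G ι) (L : Layer) : D.Alg L ⊗[k] D.Alg L →ₗ[k] D.Alg L := LinearMap.mul' k _

/-- `f` is an element of `Reg_G(X, k)` with convolution inverse `f'`. -/
structure Inv1 (D : QLS k G ι) (L : Layer) (f f' : D.Alg L →ₗ[k] k) : Prop where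
  inv : ∀ h, f ∘ₗ (D.act L h).toLinearMap = f
  inv' : ∀ h, f' ∘ₗ (D.act L h).toLinearMap = f'
  mul : conv (D.comul L) f f' = D.eps L
  mul' : conv (D.comul L) f' f = D.eps L

/-- `σ` is an element of `Reg_G(X ⊗ X, k)` with convolution inverse `σ'`. -/
structure Inv2 (D : QLS k G ι) (L : Layer) (σ σ' : D.Alg L ⊗[k] D.Alg L →ₗ[k] k) : Prop where
  inv : ∀ h, σ ∘ₗ D.act2 L h = σ
  inv' : ∀ h, σ' ∘ₗ D.act2 L h = σ'
  mul : conv (D.comul2 L) σ σ' = D.eps2 L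
  mul' : conv (D.comul2 L) σ' σ = D.eps2 L

/-- The condition for a `2`-cocycle: `σ ∈ Reg_G(X ⊗ X, k)`, `∂⁰σ * ∂²σ = ∂³σ * ∂¹σ` and
`σ(ι ⊗ 1) = ε = σ(1 ⊗ ι)`. -/
structure IsCocycle (D : QLS k G ι) (L : Layer) (σ : D.Alg L ⊗[k] D.Alg L →ₗ[k] k) : Prop where
  regular : ∃ σ', D.Inv2 L σ σ'
  cocycle :
    conv (D.comul3 L) (tens (D.eps L) σ) (σ ∘ₗ (D.m L).lTensor (D.Alg L)) =
    conv (D.comul3 L)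
      (tens σ (D.eps L) ∘ₗ
        (TensorProduct.assoc k (D.Alg L) (D.Alg L) (D.Alg L)).symm.toLinearMap)
      (σ ∘ₗ (D.m L).rTensor (D.Alg L) ∘ₗ
        (TensorProduct.assoc k (D.Alg L) (D.Alg L) (D.Alg L)).symm.toLinearMap)
  norm_left : ∀ a, σ (1 ⊗ₜ a) = D.eps L a
  norm_right : ∀ a, σ (a ⊗ₜ 1) = D.eps L a

/-- The functional `∂⁰χ * ∂²χ * σ * ∂¹χ'`. -/
def twist (D : QLS k G ι) (L : Layer) (χ χ' : D.Alg L →ₗ[k] k)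
    (σ : D.Alg L ⊗[k] D.Alg L →ₗ[k] k) : D.Alg L ⊗[k] D.Alg L →ₗ[k] k :=
  conv (D.comul2 L)
    (conv (D.comul2 L)
      (conv (D.comul2 L) (tens (D.eps L) χ) (tens χ (D.eps L))) σ)
    (χ' ∘ₗ D.m L)

/-- The coboundary `∂χ = ∂⁰χ * ∂²χ * ∂¹χ'`, where `χ'` is the convolution inverse of `χ`. -/
def bdry (D : QLS k G ι) (L : Layer) (χ χ' : D.Alg L →ₗ[k] k) :
    D.Alg L ⊗[k] D.Alg L →ₗ[k] k :=
  conv (D.comul2 L)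
    (conv (D.comul2 L) (tens (D.eps L) χ) (tens χ (D.eps L))) (χ' ∘ₗ D.m L)

/-- The set `Z²_G(B, k)` of `2`-cocycles. -/
def Z2 (D : QLS k G ι) : Type _ := {σ : D.B ⊗[k] D.B →ₗ[k] k // D.IsCocycle .nichols σ}

/-- The relation `σ' = ∂⁰χ * ∂²χ * σ * ∂¹χ⁻¹` for some `χ ∈ Reg_G(B, k)`. -/
def Cohomologous (D : QLS k G ι) (σ σ' : D.Z2) : Prop :=
  ∃ χ χ', D.Inv1 .nichols χ χ' ∧ σ'.1 = D.twist .nichols χ χ' σ.1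

/-- The non-abelian cohomology `𝓗²_G(B, k)`. -/
def H2 (D : QLS k G ι) : Type _ := Quot D.Cohomologous

/-- The cohomology class of a cocycle. -/
def cls (D : QLS k G ι) (σ : D.Z2) : D.H2 := Quot.mk _ σ

/-- The functional `(π ⊗ π)^* σ` on `R ⊗ R`. -/
def pull (D : QLS k G ι) (σ : D.Z2) : D.R ⊗[k] D.R →ₗ[k] k :=
  σ.1 ∘ₗ TensorProduct.map D.pi.toLinearMap D.pi.toLinearMap

/-- `δ : Alg_G(K, k) → 𝓗²_G(B, k)` is the connecting map: `δ f` is the class of the cocycle `σ`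
with `(π ⊗ π)^* σ = ∂ v`, where `v` is the convolution inverse of `f⁻¹ u = f s u` (this `v` is `f u`
when `u` is a coalgebra map). The class is the same for all other extensions `v ∈ Reg_G(R, k)` of
`f` for which `∂ v` factors through a cocycle on `B ⊗ B`. -/
structure IsConnecting (D : QLS k G ι) (u : D.R →ₗ[k] D.K) (δ : D.AlgG → D.H2) : Prop where
  formula : ∀ f : D.AlgG, ∃ (f' : D.AlgG) (v : D.R →ₗ[k] k) (σ : D.Z2),
    f * f' = 1 ∧ f' * f = 1 ∧ D.Inv1 .pre v (f'.1.toLinearMap ∘ₗ u) ∧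
    v ∘ₗ D.K.val.toLinearMap = f.1.toLinearMap ∧
    D.pull σ = D.bdry .pre v (f'.1.toLinearMap ∘ₗ u) ∧ δ f = D.cls σ
  independent : ∀ (f : D.AlgG) (v v' : D.R →ₗ[k] k) (σ : D.Z2), D.Inv1 .pre v v' →
    v ∘ₗ D.K.val.toLinearMap = f.1.toLinearMap → D.pull σ = D.bdry .pre v v' → δ f = D.cls σ

/-- The functional `ρ²(σ, σ') = (σ ⊗ σ')(1 ⊗ c ⊗ 1)(ρ ⊗ ρ)` on `B ⊗ B`. -/
def rho2 (D : QLS k G ι) (S T : Finset ι)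
    (σ : (D.restrict S).B ⊗[k] (D.restrict S).B →ₗ[k] k)
    (σ' : (D.restrict T).B ⊗[k] (D.restrict T).B →ₗ[k] k) : D.B ⊗[k] D.B →ₗ[k] k :=
  tens σ σ' ∘ₗ
    mid (braid ((D.restrict T).coact .nichols).toLinearMap
      (fun h => ((D.restrict S).act .nichols h).toLinearMap)) ∘ₗ
    TensorProduct.map (D.rho .nichols S T) (D.rho .nichols S T)

end QLS

end

open scoped TensorProduct

noncomputable section

namespace QLS

/-! ### Words in the generators, the action and the coproduct on generators -/

section Basics

variable {k G ι : Type*} [Field k] [CommGroup G] [LinearOrder ι] {D : QLS k G ι} {L : Layer}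

/-! The functionals on a coalgebra form a monoid under convolution, and a coalgebra map induces a
homomorphism of these monoids. The faces `∂ⁱ` and the pullbacks along `π`, `p_S`, `i_S` are all of
this kind (`CMap.hom`, `IsMorph.cmap_map`). In this language `ρ²(σ, σ')` is the convolution product
of the pullbacks of `σ` and `σ'` (`rho2_eq`). As `S` and `T` are disjoint, a functional pulled back
from `S` commutes with one pulled back from `T` up to a scalar, and exactly if both are
`G`-invariant (`semiComm_TC`, `p2_commute`). Hence products of cocycles are cocycles, twists by
coboundaries pass to products, and `∂(v_S * v_T) = ∂v_S * ∂v_T` (`cocycle_mul`, `twist_mul_left`,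
`bdry_mul`). The map `ρ²` is injective because restriction along `i_S` and `i_T` recovers the two
factors. The square commutes because `v_S * v_T` extends `ρ¹(f, f')` and the class `δ` does not
depend on the extension. The map `ρ¹` is an isomorphism because the generators of `K` are primitive
and, without links between `S` and `T`, each of them comes from `K_S` or from `K_T`.

The connecting map itself has to be constructed. For `w = f⁻¹ u` every generator `z` of `K` can be
replaced by a scalar, wherever it stands in a product (`KChar`). If `v` is the inverse of `w`, then
`∂v` factors through `π ⊗ π`: convolution with `w` gives a surjection onto `B` from the quotient of
`R` by the relations `z = w(z)`, and a dimension count makes it injective (`KChar.sc_eq_zero`,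
`hopfian`). Conversely, if `∂v` factors through `B ⊗ B`, then `v⁻¹` has this scalar property
(`kchar_of_bdry`), and two extensions of the same `f` differ by a functional on `B`
(`exists_twist`).

All dimension statements and the retraction come from one model: `R` acts on the functions on `∏
ℤ/Nᵢ` with values in a commutative algebra `A`. The generator `x_l` multiplies truncated ordered
monomials, corrected by a multiple of the skew derivation for the vertex below `l` linkable to `l`,
which is unique because `Nᵢ > 2`. All `z_l` and `z_{lp}` then act by prescribed scalars in `A`. For
`A = k` and zero scalars this shows that the reduced monomials are independent in `B`; for `A = k`
it produces algebra maps `K → k` with arbitrary values on the generators; for `A = K`, with each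
generator acting as itself, the coefficient of `1` is the retraction `u`. In the model the exponents
in `S` and `T` do not interact, so `u(ab) = u(a) u(b)` for `a ∈ R_S`, `b ∈ R_T`. Since `R = R_S
R_T`, this is the identity `u = u_S * u_T`.

Identities between convolutions are proved throughout by induction on words, for all functionals
simultaneously: a leading letter `xᵢ` is absorbed by one of the factors of the convolution. -/

theorem proj_surjective (D : QLS k G ι) (L : Layer) : Function.Surjective (D.proj L) :=
  RingQuot.mkAlgHom_surjective k (D.Rel L)

/-- Induction over the words in the generators. -/
theorem word_induction {p : D.Alg L → Prop} (one : p 1) (add : ∀ a b, p a → p b → p (a + b))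
    (smul : ∀ (c : k) a, p a → p (c • a)) (x_mul : ∀ i a, p a → p (D.x L i * a)) (r : D.Alg L) :
    p r := by
  obtain ⟨a, rfl⟩ := D.proj_surjective L r
  suffices h : ∀ a : FreeAlgebra k ι, ∀ r, p r → p (D.proj L a * r) by simpa using h a 1 one
  intro a
  induction a using FreeAlgebra.induction with
  | grade0 c => intro r hr; rw [AlgHom.commutes, ← Algebra.smul_def]; exact smul c r hr
  | grade1 i => exact fun r hr => x_mul i r hr
  | mul a b ha hb => intro r hr; rw [map_mul, mul_assoc]; exact ha _ (hb _ hr)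
  | add a b ha hb => intro r hr; rw [map_add, add_mul]; exact add _ _ (ha _ hr) (hb _ hr)

/-- The left multiplication by `a`. -/
abbrev lm {A : Type*} [Ring A] [Algebra k A] (a : A) : A →ₗ[k] A := LinearMap.mulLeft k a

/-- The group element `h` as a linear endomorphism. -/
abbrev actl (D : QLS k G ι) (L : Layer) (h : G) : D.Alg L →ₗ[k] D.Alg L := (D.act L h).toLinearMap

theorem act_one_hom (D : QLS k G ι) (L : Layer) : D.act L 1 = AlgHom.id k _ :=
  hom_ext fun i => by simp

theorem actl_one (D : QLS k G ι) (L : Layer) : D.actl L 1 = LinearMap.id := by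
  ext a; simp [act_one_hom]

theorem actl_mul (D : QLS k G ι) (L : Layer) (h h' : G) :
    D.actl L (h * h') = D.actl L h ∘ₗ D.actl L h' := by
  ext a; simp [act_mul]

theorem actl_comm (D : QLS k G ι) (L : Layer) (h h' : G) :
    D.actl L h ∘ₗ D.actl L h' = D.actl L h' ∘ₗ D.actl L h := by
  rw [← actl_mul, mul_comm, actl_mul]

theorem actl_lm (h : G) (a : D.Alg L) :
    D.actl L h ∘ₗ lm a = lm (D.act L h a) ∘ₗ D.actl L h := by
  ext r; simp

theorem actl_lm_x (h : G) (i : ι) :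
    D.actl L h ∘ₗ lm (D.x L i) = (D.χ i h : k) • (lm (D.x L i) ∘ₗ D.actl L h) := by
  rw [actl_lm, act_x]; ext; simp

theorem comp_act_lm_x {A : Type*} [AddCommGroup A] [Module k A] (f : D.Alg L →ₗ[k] A) (h : G)
    (i : ι) : (f ∘ₗ D.actl L h) ∘ₗ lm (D.x L i)
      = (D.χ i h : k) • ((f ∘ₗ lm (D.x L i)) ∘ₗ D.actl L h) := by
  rw [LinearMap.comp_assoc, actl_lm_x, LinearMap.comp_smul, LinearMap.comp_assoc]

theorem comp_act_comm {A : Type*} [AddCommGroup A] [Module k A] (f : D.Alg L →ₗ[k] A) (h h' : G) :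
    (f ∘ₗ D.actl L h) ∘ₗ D.actl L h' = (f ∘ₗ D.actl L h') ∘ₗ D.actl L h := by
  rw [LinearMap.comp_assoc, actl_comm, LinearMap.comp_assoc]

@[simp]
theorem counit_x (i : ι) : D.counit L (D.x L i) = 0 := by simp [counit]

@[simp]
theorem counit_act (h : G) (r : D.Alg L) : D.counit L (D.act L h r) = D.counit L r := by
  have : (D.counit L).comp (D.act L h) = D.counit L := hom_ext fun i => by simp
  exact congrArg (fun f : D.Alg L →ₐ[k] k => f r) this

@[simp]
theorem eps_apply (r : D.Alg L) : D.eps L r = D.counit L r := rfl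

theorem comul_one : D.comul L 1 = 1 ⊗ₜ 1 := by simp [comul]

theorem comul_mul (a b : D.Alg L) : D.comul L (a * b) = D.comulOp L a (D.comul L b) := by
  simp [comul]

@[simp]
theorem comulOp_x (i : ι) : D.comulOp L (D.x L i) = D.opX L i := by simp [comulOp]

theorem comulOp_root (i : ι) : D.comulOp L (D.root (D.x L) i) =
    D.opL L (D.root (D.x L) i) + D.opR L (D.g i ^ D.N i) (D.root (D.x L) i) := by
  rw [map_root, ← root_op]; simp

theorem comulOp_link (i j : ι) (hij : i ≠ j) : D.comulOp L (D.link (D.x L) j i) =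
    D.opL L (D.link (D.x L) j i) + D.opR L (D.g j * D.g i) (D.link (D.x L) j i) := by
  rw [map_link, ← link_op _ _ _ _ hij]; simp

end Basics

/-! ### Convolution on `R` and `B` -/

section Pairing

variable {k G ι : Type*} [Field k] [CommGroup G] [LinearOrder ι] {D : QLS k G ι} {L : Layer}
variable {A B M : Type*} [AddCommGroup A] [Module k A] [AddCommGroup B] [Module k B]
  [AddCommGroup M] [Module k M]

/-- The convolution of two maps, with respect to a bilinear pairing of their targets. -/
def bconv {C : Type*} [AddCommGroup C] [Module k C] (Δ : C →ₗ[k] C ⊗[k] C)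
    (β : A →ₗ[k] B →ₗ[k] M) (f : C →ₗ[k] A) (f' : C →ₗ[k] B) : C →ₗ[k] M :=
  TensorProduct.lift β ∘ₗ TensorProduct.map f f' ∘ₗ Δ

theorem bconv_add_left {C : Type*} [AddCommGroup C] [Module k C] (Δ : C →ₗ[k] C ⊗[k] C)
    (β : A →ₗ[k] B →ₗ[k] M) (f g : C →ₗ[k] A) (f' : C →ₗ[k] B) :
    bconv Δ β (f + g) f' = bconv Δ β f f' + bconv Δ β g f' := by
  simp only [bconv, TensorProduct.map_add_left, LinearMap.add_comp, LinearMap.comp_add]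

theorem bconv_smul_left {C : Type*} [AddCommGroup C] [Module k C] (Δ : C →ₗ[k] C ⊗[k] C)
    (β : A →ₗ[k] B →ₗ[k] M) (c : k) (f : C →ₗ[k] A) (f' : C →ₗ[k] B) :
    bconv Δ β (c • f) f' = c • bconv Δ β f f' := by
  simp only [bconv, TensorProduct.map_smul_left, LinearMap.smul_comp, LinearMap.comp_smul]

theorem bconv_smul_right {C : Type*} [AddCommGroup C] [Module k C] (Δ : C →ₗ[k] C ⊗[k] C)
    (β : A →ₗ[k] B →ₗ[k] M) (c : k) (f : C →ₗ[k] A) (f' : C →ₗ[k] B) :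
    bconv Δ β f (c • f') = c • bconv Δ β f f' := by
  simp only [bconv, TensorProduct.map_smul_right, LinearMap.smul_comp, LinearMap.comp_smul]

@[simp]
theorem bconv_zero_left {C : Type*} [AddCommGroup C] [Module k C] (Δ : C →ₗ[k] C ⊗[k] C)
    (β : A →ₗ[k] B →ₗ[k] M) (f' : C →ₗ[k] B) : bconv Δ β 0 f' = 0 := by
  simp [bconv, TensorProduct.map_zero_left]

@[simp]
theorem bconv_zero_right {C : Type*} [AddCommGroup C] [Module k C] (Δ : C →ₗ[k] C ⊗[k] C)
    (β : A →ₗ[k] B →ₗ[k] M) (f : C →ₗ[k] A) : bconv Δ β f 0 = 0 := by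
  simp [bconv, TensorProduct.map_zero_right]

variable (β : A →ₗ[k] B →ₗ[k] M) (f : D.Alg L →ₗ[k] A) (f' : D.Alg L →ₗ[k] B)

@[simp]
theorem bconv_one : bconv (D.comul L) β f f' 1 = β (f 1) (f' 1) := by
  simp [bconv, comul_one]

/-- In `Δ(a) Δ(r)` the summand `1 ⊗ a` passes the first tensor factor of `Δ(r)`, which produces the
action of the degree `h`. The hypothesis holds for the `xᵢ` and also for the generators of `K`. -/
theorem bconv_mul_of_comulOp {a : D.Alg L} {h : G}
    (ha : D.comulOp L a = D.opL L a + D.opR L h a) (r : D.Alg L) :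
    bconv (D.comul L) β f f' (a * r) = bconv (D.comul L) β (f ∘ₗ lm a) f' r
      + bconv (D.comul L) β (f ∘ₗ D.actl L h) (f' ∘ₗ lm a) r := by
  simp only [bconv, LinearMap.comp_apply, comul_mul, ha, LinearMap.add_apply, map_add]
  congr 1 <;>
  · induction D.comul L r using TensorProduct.induction_on with
    | zero => simp
    | add s t hs ht => simp only [map_add, hs, ht]
    | tmul s t => simp [opL, opR]

/-- Together with the value at `1` this recursion determines the convolution, and it replaces every
computation with iterated coproducts. Both summands are convolutions of other maps at the shorter
word `r`, so inductions have to quantify over the maps. -/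
theorem bconv_x_mul (i : ι) (r : D.Alg L) :
    bconv (D.comul L) β f f' (D.x L i * r) = bconv (D.comul L) β (f ∘ₗ lm (D.x L i)) f' r
      + bconv (D.comul L) β (f ∘ₗ D.actl L (D.g i)) (f' ∘ₗ lm (D.x L i)) r :=
  bconv_mul_of_comulOp β f f' (by rw [comulOp_x, opX]) r

theorem bconv_x_mul' (i : ι) :
    bconv (D.comul L) β f f' ∘ₗ lm (D.x L i) = bconv (D.comul L) β (f ∘ₗ lm (D.x L i)) f'
      + bconv (D.comul L) β (f ∘ₗ D.actl L (D.g i)) (f' ∘ₗ lm (D.x L i)) :=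
  LinearMap.ext fun r => bconv_x_mul β f f' i r

/-- The coproduct is equivariant: `h` commutes with `gᵢ`, and both terms of the recursion acquire
the same factor `χᵢ(h)`. -/
theorem bconv_act (h : G) :
    bconv (D.comul L) β (f ∘ₗ D.actl L h) (f' ∘ₗ D.actl L h)
      = bconv (D.comul L) β f f' ∘ₗ D.actl L h := by
  ext r
  revert f f'
  induction r using word_induction with
  | one => intro f f'; simp
  | add a b ha hb => intro f f'; simp only [map_add, ha, hb]
  | smul c a ha => intro f f'; simp only [map_smul, ha]
  | x_mul i r ih =>
    intro f f'
    have e1 : (bconv (D.comul L) β f f' ∘ₗ D.actl L h) (D.x L i * r)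
      = (D.χ i h : k) • (bconv (D.comul L) β f f' ∘ₗ lm (D.x L i)) (D.actl L h r) := by simp
    rw [e1, bconv_x_mul', bconv_x_mul, comp_act_lm_x, comp_act_lm_x, comp_act_comm,
      bconv_smul_left, bconv_smul_right, LinearMap.smul_apply, LinearMap.smul_apply, ih, ih,
      ← smul_add]
    rfl

/-- Associativity of the convolution. -/
theorem bconv_assoc {A₁ A₂ A₃ A₁₂ A₂₃ : Type*} [AddCommGroup A₁] [Module k A₁]
    [AddCommGroup A₂] [Module k A₂] [AddCommGroup A₃] [Module k A₃] [AddCommGroup A₁₂]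
    [Module k A₁₂] [AddCommGroup A₂₃] [Module k A₂₃]
    (β : A₁ →ₗ[k] A₂ →ₗ[k] A₁₂) (γ : A₁₂ →ₗ[k] A₃ →ₗ[k] M) (β' : A₂ →ₗ[k] A₃ →ₗ[k] A₂₃)
    (γ' : A₁ →ₗ[k] A₂₃ →ₗ[k] M) (hβ : ∀ a b c, γ (β a b) c = γ' a (β' b c))
    (f₁ : D.Alg L →ₗ[k] A₁) (f₂ : D.Alg L →ₗ[k] A₂) (f₃ : D.Alg L →ₗ[k] A₃) :
    bconv (D.comul L) γ (bconv (D.comul L) β f₁ f₂) f₃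
      = bconv (D.comul L) γ' f₁ (bconv (D.comul L) β' f₂ f₃) := by
  ext r
  revert f₁ f₂ f₃
  induction r using word_induction with
  | one => intro f₁ f₂ f₃; simp [hβ]
  | add a b ha hb => intro f₁ f₂ f₃; simp only [map_add, ha, hb]
  | smul c a ha => intro f₁ f₂ f₃; simp only [map_smul, ha]
  | x_mul i r ih =>
    intro f₁ f₂ f₃
    -- Both sides split into three terms, according to which of the three maps absorbs `xᵢ`. The
    -- action of `gᵢ` on the inner convolution is distributed over its factors by `bconv_act`.
    rw [bconv_x_mul, bconv_x_mul, bconv_x_mul', bconv_x_mul', ← bconv_act, bconv_add_left,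
      LinearMap.add_apply, ih, ih, ih, add_assoc]
    congr 1
    simp only [bconv, TensorProduct.map_add_right, LinearMap.add_comp, LinearMap.comp_add,
      LinearMap.add_apply]

theorem bconv_eps_left (β : k →ₗ[k] B →ₗ[k] M)
    (f' : D.Alg L →ₗ[k] B) : bconv (D.comul L) β (D.eps L) f' = β 1 ∘ₗ f' := by
  ext r
  revert f'
  induction r using word_induction with
  | one => intro f'; simp
  | add a b ha hb => intro f'; simp only [map_add, ha, hb]
  | smul c a ha => intro f'; simp only [map_smul, ha]
  | x_mul i r ih =>
    intro f'
    have e1 : D.eps L ∘ₗ lm (D.x L i) = 0 := by ext; simp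
    have e2 : D.eps L ∘ₗ D.actl L (D.g i) = D.eps L := by ext; simp
    rw [bconv_x_mul, e1, e2, bconv_zero_left, ih]; simp

theorem bconv_eps_right (β : A →ₗ[k] k →ₗ[k] M) (f : D.Alg L →ₗ[k] A) :
    bconv (D.comul L) β f (D.eps L) = β.flip 1 ∘ₗ f := by
  ext r
  revert f
  induction r using word_induction with
  | one => intro f; simp
  | add a b ha hb => intro f; simp only [map_add, ha, hb]
  | smul c a ha => intro f; simp only [map_smul, ha]
  | x_mul i r ih =>
    intro f
    have e1 : D.eps L ∘ₗ lm (D.x L i) = 0 := by ext; simp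
    rw [bconv_x_mul, e1, bconv_zero_right, ih]; simp

end Pairing

/-! ### Braided tensor products as coalgebras -/

section Tensor

variable {k G ι : Type*} [Field k] [CommGroup G] [LinearOrder ι] {D : QLS k G ι} {L : Layer}
variable {Y : Type*} [AddCommGroup Y] [Module k Y]

/-- The comultiplication of the braided tensor product of `R` (or `B`) with a coalgebra `Y`. -/
def comulT (D : QLS k G ι) (L : Layer) (ΔY : Y →ₗ[k] Y ⊗[k] Y) (aY : G → Y →ₗ[k] Y) :
    D.Alg L ⊗[k] Y →ₗ[k] (D.Alg L ⊗[k] Y) ⊗[k] (D.Alg L ⊗[k] Y) :=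
  mid (braid (D.coact L).toLinearMap aY) ∘ₗ TensorProduct.map (D.comul L) ΔY

/-- The diagonal action. -/
def actT (D : QLS k G ι) (L : Layer) (aY : G → Y →ₗ[k] Y) (h : G) :
    D.Alg L ⊗[k] Y →ₗ[k] D.Alg L ⊗[k] Y :=
  TensorProduct.map (D.actl L h) (aY h)

/-- The left multiplication of the first factor by `xᵢ`. -/
abbrev lmT (D : QLS k G ι) (L : Layer) (Y : Type*) [AddCommGroup Y] [Module k Y] (i : ι) :
    D.Alg L ⊗[k] Y →ₗ[k] D.Alg L ⊗[k] Y := (lm (D.x L i)).rTensor Y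

/-- `Y` is a coassociative and counital coalgebra with an action of `G` by coalgebra maps. -/
structure IsGCoalg (ΔY : Y →ₗ[k] Y ⊗[k] Y) (aY : G → Y →ₗ[k] Y) (εY : Y →ₗ[k] k) : Prop where
  act_one : aY 1 = LinearMap.id
  act_mul : ∀ g h, aY (g * h) = aY g ∘ₗ aY h
  eps_act : ∀ h, εY ∘ₗ aY h = εY
  conv_act : ∀ (f f' : Y →ₗ[k] k) (h : G),
    conv ΔY (f ∘ₗ aY h) (f' ∘ₗ aY h) = conv ΔY f f' ∘ₗ aY h
  assoc : ∀ f₁ f₂ f₃ : Y →ₗ[k] k, conv ΔY (conv ΔY f₁ f₂) f₃ = conv ΔY f₁ (conv ΔY f₂ f₃)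
  eps_left : ∀ f, conv ΔY εY f = f
  eps_right : ∀ f, conv ΔY f εY = f

theorem isGCoalg (D : QLS k G ι) (L : Layer) : IsGCoalg (D.comul L) (D.actl L) (D.eps L) where
  act_one := D.actl_one L
  act_mul := D.actl_mul L
  eps_act h := by ext; simp
  conv_act f f' h := bconv_act _ f f' h
  assoc f₁ f₂ f₃ := bconv_assoc _ _ _ _ (fun a b c => by simp [mul_assoc]) f₁ f₂ f₃
  eps_left f := (bconv_eps_left _ _).trans (by ext; simp)
  eps_right f := (bconv_eps_right _ _).trans (by ext; simp)

theorem actMap_single_mul (aY : G → Y →ₗ[k] Y) (hmul : ∀ g h, aY (g * h) = aY g ∘ₗ aY h)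
    (g : G) (p : MonoidAlgebra k G) (y : Y) :
    actMap aY ((MonoidAlgebra.single g 1 * p) ⊗ₜ y) = aY g (actMap aY (p ⊗ₜ y)) := by
  induction p using MonoidAlgebra.induction_linear with
  | zero => simp
  | add a b ha hb => simp only [mul_add, TensorProduct.add_tmul, map_add, ha, hb]
  | single h c =>
    rw [MonoidAlgebra.single_mul_single]
    simp [actMap, MonoidAlgebra.coeff_single, hmul]

theorem braid_one (aY : G → Y →ₗ[k] Y) (hone : aY 1 = LinearMap.id) (y : Y) :
    braid (D.coact L).toLinearMap aY (1 ⊗ₜ y) = y ⊗ₜ 1 := by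
  rw [braid_apply _ _ _ _ 1, hone]
  · rfl
  · simp [Algebra.TensorProduct.one_def, MonoidAlgebra.one_def]

/-- The coaction is multiplicative, so passing `xᵢ b` over `y` means passing `b` first and then
`xᵢ`, which acts by `gᵢ`. -/
theorem braid_x_mul (aY : G → Y →ₗ[k] Y) (hmul : ∀ g h, aY (g * h) = aY g ∘ₗ aY h)
    (i : ι) (b : D.Alg L) (y : Y) :
    braid (D.coact L).toLinearMap aY ((D.x L i * b) ⊗ₜ y)
      = TensorProduct.map (aY (D.g i)) (lm (D.x L i))
        (braid (D.coact L).toLinearMap aY (b ⊗ₜ y)) := by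
  have hx : D.coact L (D.x L i) = MonoidAlgebra.single (D.g i) 1 ⊗ₜ D.x L i := by simp [coact]
  have key : ∀ t : MonoidAlgebra k G ⊗[k] D.Alg L,
      (actMap aY).rTensor (D.Alg L) ((TensorProduct.assoc k _ Y _).symm
        ((TensorProduct.comm k (D.Alg L) Y).toLinearMap.lTensor (MonoidAlgebra k G)
          (TensorProduct.assoc k _ _ Y (((MonoidAlgebra.single (D.g i) 1 ⊗ₜ D.x L i) * t) ⊗ₜ y))))
      = TensorProduct.map (aY (D.g i)) (lm (D.x L i))
        ((actMap aY).rTensor (D.Alg L) ((TensorProduct.assoc k _ Y _).symm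
        ((TensorProduct.comm k (D.Alg L) Y).toLinearMap.lTensor (MonoidAlgebra k G)
          (TensorProduct.assoc k _ _ Y (t ⊗ₜ y))))) := by
    intro t
    induction t using TensorProduct.induction_on with
    | zero => simp
    | add s t hs ht => simp only [mul_add, TensorProduct.add_tmul, map_add, hs, ht]
    | tmul p b => simp [actMap_single_mul aY hmul]
  simpa [braid, hx] using key (D.coact L b)

/-- The linear map `z' ⊗ y' ↦ (x ⊗ z') ⊗ (y' ⊗ w)`. -/
def sandwich {A B C E : Type*} [AddCommGroup A] [Module k A] [AddCommGroup B] [Module k B]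
    [AddCommGroup C] [Module k C] [AddCommGroup E] [Module k E] (x : A) (w : E) :
    B ⊗[k] C →ₗ[k] (A ⊗[k] B) ⊗[k] (C ⊗[k] E) :=
  TensorProduct.map (TensorProduct.mk k A B x) ((TensorProduct.mk k C E).flip w)

/-- The image of `y ⊗ z` under the braiding need not be a pure tensor, so it is kept as an argument.
-/
theorem mid_tmul {A B C E : Type*} [AddCommGroup A] [Module k A] [AddCommGroup B] [Module k B]
    [AddCommGroup C] [Module k C] [AddCommGroup E] [Module k E]
    (c : C ⊗[k] B →ₗ[k] B ⊗[k] C) (x : A) (y : C) (z : B) (w : E) :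
    mid c ((x ⊗ₜ y) ⊗ₜ (z ⊗ₜ w)) = sandwich x w (c (y ⊗ₜ z)) := by
  simp only [mid, LinearMap.comp_apply, LinearEquiv.coe_coe, TensorProduct.assoc_tmul,
    LinearMap.lTensor_tmul, TensorProduct.assoc_symm_tmul, LinearMap.rTensor_tmul]
  induction c (y ⊗ₜ z) using TensorProduct.induction_on with
  | zero => simp
  | add s t hs ht => simp only [TensorProduct.add_tmul, TensorProduct.tmul_add, map_add, hs, ht]
  | tmul s t => simp [sandwich]

variable {ΔY : Y →ₗ[k] Y ⊗[k] Y} {aY : G → Y →ₗ[k] Y} {εY : Y →ₗ[k] k}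

theorem comulT_one (hone : aY 1 = LinearMap.id) (y : Y) :
    comulT D L ΔY aY (1 ⊗ₜ y)
      = TensorProduct.map (TensorProduct.mk k (D.Alg L) Y 1) (TensorProduct.mk k (D.Alg L) Y 1)
        (ΔY y) := by
  simp only [comulT, LinearMap.comp_apply, TensorProduct.map_tmul, comul_one]
  induction ΔY y using TensorProduct.induction_on with
  | zero => simp
  | add s t hs ht => simp only [TensorProduct.tmul_add, map_add, hs, ht]
  | tmul s t => rw [mid_tmul, braid_one aY hone]; simp [sandwich]

/-- The element `xᵢ ⊗ 1` is again primitive in the braided tensor product: on its way to the second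
copy it passes the whole first copy and acts there diagonally by `gᵢ`. This yields for `X ⊗ Y` the
same recursion as for `X`. -/
theorem comulT_x_mul (hmul : ∀ g h, aY (g * h) = aY g ∘ₗ aY h) (i : ι) (r : D.Alg L) (y : Y) :
    comulT D L ΔY aY ((D.x L i * r) ⊗ₜ y)
      = TensorProduct.map (lmT D L Y i) LinearMap.id (comulT D L ΔY aY (r ⊗ₜ y))
      + TensorProduct.map (actT D L aY (D.g i)) (lmT D L Y i) (comulT D L ΔY aY (r ⊗ₜ y)) := by
  simp only [comulT, LinearMap.comp_apply, TensorProduct.map_tmul, comul_mul, comulOp_x]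
  induction D.comul L r using TensorProduct.induction_on with
  | zero => simp
  | add s t hs ht =>
    simp only [TensorProduct.add_tmul, map_add, hs, ht]; abel
  | tmul s t =>
    induction ΔY y using TensorProduct.induction_on with
    | zero => simp
    | add s t hs ht =>
      simp only [TensorProduct.tmul_add, map_add, hs, ht]; abel
    | tmul z w =>
      simp only [opX, opL, opR, LinearMap.add_apply, TensorProduct.map_tmul,
        TensorProduct.add_tmul, map_add, mid_tmul, LinearMap.id_apply, AlgHom.toLinearMap_apply,
        LinearMap.mulLeft_apply, braid_x_mul aY hmul]
      induction braid (D.coact L).toLinearMap aY (t ⊗ₜ z) using TensorProduct.induction_on with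
      | zero => simp
      | add s t hs ht =>
        simp only [map_add] at hs ht ⊢
        rw [add_add_add_comm, hs, ht]; abel
      | tmul s t => simp [sandwich, actT]

variable {A : Type*} [Ring A] [Algebra k A]

theorem convT_one (hone : aY 1 = LinearMap.id) (F F' : D.Alg L ⊗[k] Y →ₗ[k] A) :
    conv (comulT D L ΔY aY) F F' ∘ₗ TensorProduct.mk k (D.Alg L) Y 1
      = conv ΔY (F ∘ₗ TensorProduct.mk k (D.Alg L) Y 1)
        (F' ∘ₗ TensorProduct.mk k (D.Alg L) Y 1) := by
  ext y
  simp only [conv, LinearMap.comp_apply, TensorProduct.mk_apply, comulT_one hone,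
    TensorProduct.map_map]

theorem convT_x_mul (hmul : ∀ g h, aY (g * h) = aY g ∘ₗ aY h) (F F' : D.Alg L ⊗[k] Y →ₗ[k] A)
    (i : ι) (r : D.Alg L) (y : Y) :
    conv (comulT D L ΔY aY) F F' ((D.x L i * r) ⊗ₜ y)
      = conv (comulT D L ΔY aY) (F ∘ₗ lmT D L Y i) F' (r ⊗ₜ y)
      + conv (comulT D L ΔY aY) (F ∘ₗ actT D L aY (D.g i)) (F' ∘ₗ lmT D L Y i) (r ⊗ₜ y) := by
  simp only [conv, LinearMap.comp_apply, comulT_x_mul hmul, map_add, TensorProduct.map_map]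
  simp only [LinearMap.comp_id]

theorem convT_x_mul' (hmul : ∀ g h, aY (g * h) = aY g ∘ₗ aY h)
    (F F' : D.Alg L ⊗[k] Y →ₗ[k] A) (i : ι) :
    conv (comulT D L ΔY aY) F F' ∘ₗ lmT D L Y i
      = conv (comulT D L ΔY aY) (F ∘ₗ lmT D L Y i) F'
      + conv (comulT D L ΔY aY) (F ∘ₗ actT D L aY (D.g i)) (F' ∘ₗ lmT D L Y i) :=
  TensorProduct.ext' fun r y => by
    simpa [TensorProduct.smul_tmul'] using convT_x_mul hmul F F' i r y

theorem actT_lmT (h : G) (i : ι) : actT D L aY h ∘ₗ lmT D L Y i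
    = (D.χ i h : k) • (lmT D L Y i ∘ₗ actT D L aY h) :=
  TensorProduct.ext' fun r y => by simp [actT, TensorProduct.smul_tmul']

theorem comp_actT_lmT {A : Type*} [AddCommGroup A] [Module k A] (F : D.Alg L ⊗[k] Y →ₗ[k] A)
    (h : G) (i : ι) : (F ∘ₗ actT D L aY h) ∘ₗ lmT D L Y i
      = (D.χ i h : k) • ((F ∘ₗ lmT D L Y i) ∘ₗ actT D L aY h) := by
  rw [LinearMap.comp_assoc, actT_lmT, LinearMap.comp_smul, LinearMap.comp_assoc]

theorem comp_actT_comm {A : Type*} [AddCommGroup A] [Module k A]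
    (hmul : ∀ g h, aY (g * h) = aY g ∘ₗ aY h) (F : D.Alg L ⊗[k] Y →ₗ[k] A) (h h' : G) :
    (F ∘ₗ actT D L aY h) ∘ₗ actT D L aY h' = (F ∘ₗ actT D L aY h') ∘ₗ actT D L aY h := by
  refine TensorProduct.ext' fun r y => congrArg F ?_
  have e1 := LinearMap.congr_fun (D.actl_comm L h h') r
  have e2 : aY h (aY h' y) = aY h' (aY h y) := by
    rw [← LinearMap.comp_apply, ← hmul, mul_comm, hmul, LinearMap.comp_apply]
  exact congrArg₂ (· ⊗ₜ[k] ·) e1 e2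

theorem comp_actT_one {A : Type*} [AddCommGroup A] [Module k A] (F : D.Alg L ⊗[k] Y →ₗ[k] A)
    (h : G) : (F ∘ₗ actT D L aY h) ∘ₗ TensorProduct.mk k (D.Alg L) Y 1
      = (F ∘ₗ TensorProduct.mk k (D.Alg L) Y 1) ∘ₗ aY h := by
  ext; simp [actT]

theorem conv_smul_left {C : Type*} [AddCommGroup C] [Module k C] (Δ : C →ₗ[k] C ⊗[k] C)
    (c : k) (f f' : C →ₗ[k] A) : conv Δ (c • f) f' = c • conv Δ f f' :=
  bconv_smul_left _ _ _ _ _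

theorem conv_smul_right {C : Type*} [AddCommGroup C] [Module k C] (Δ : C →ₗ[k] C ⊗[k] C)
    (c : k) (f f' : C →ₗ[k] A) : conv Δ f (c • f') = c • conv Δ f f' :=
  bconv_smul_right _ _ _ _ _

theorem conv_add_left {C : Type*} [AddCommGroup C] [Module k C] (Δ : C →ₗ[k] C ⊗[k] C)
    (f g f' : C →ₗ[k] A) : conv Δ (f + g) f' = conv Δ f f' + conv Δ g f' :=
  bconv_add_left _ _ _ _ _

theorem conv_add_right {C : Type*} [AddCommGroup C] [Module k C] (Δ : C →ₗ[k] C ⊗[k] C)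
    (f g g' : C →ₗ[k] A) : conv Δ f (g + g') = conv Δ f g + conv Δ f g' := by
  simp only [conv, TensorProduct.map_add_right, LinearMap.add_comp, LinearMap.comp_add]

@[simp]
theorem conv_zero_left {C : Type*} [AddCommGroup C] [Module k C] (Δ : C →ₗ[k] C ⊗[k] C)
    (f' : C →ₗ[k] A) : conv Δ 0 f' = 0 := bconv_zero_left _ _ _

@[simp]
theorem conv_zero_right {C : Type*} [AddCommGroup C] [Module k C] (Δ : C →ₗ[k] C ⊗[k] C)
    (f : C →ₗ[k] A) : conv Δ f 0 = 0 := bconv_zero_right _ _ _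

theorem tens_eps_lmT (f : Y →ₗ[k] k) (i : ι) : tens (D.eps L) f ∘ₗ lmT D L Y i = 0 :=
  TensorProduct.ext' fun r y => by simp [tens]

theorem tens_eps_one (f : Y →ₗ[k] k) :
    tens (D.eps L) f ∘ₗ TensorProduct.mk k (D.Alg L) Y 1 = f := by
  ext; simp [tens]

theorem tens_actT (f : D.Alg L →ₗ[k] k) (f' : Y →ₗ[k] k) (h : G) :
    tens f f' ∘ₗ actT D L aY h = tens (f ∘ₗ D.actl L h) (f' ∘ₗ aY h) :=
  TensorProduct.ext' fun r y => by simp [tens, actT]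

theorem tens_eps_actT (f : Y →ₗ[k] k) (h : G) :
    tens (D.eps L) f ∘ₗ actT D L aY h = tens (D.eps L) (f ∘ₗ aY h) := by
  rw [tens_actT, (isGCoalg D L).eps_act]

theorem conv_actT (H : IsGCoalg ΔY aY εY) (F F' : D.Alg L ⊗[k] Y →ₗ[k] k) (h : G) :
    conv (comulT D L ΔY aY) (F ∘ₗ actT D L aY h) (F' ∘ₗ actT D L aY h)
      = conv (comulT D L ΔY aY) F F' ∘ₗ actT D L aY h := by
  refine TensorProduct.ext' fun r y => ?_
  revert F F'
  induction r using word_induction with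
  | one =>
    intro F F'
    have e := convT_one (D := D) (L := L) (A := k) (ΔY := ΔY) H.act_one
    have e1 := LinearMap.congr_fun (e (F ∘ₗ actT D L aY h) (F' ∘ₗ actT D L aY h)) y
    have e2 := LinearMap.congr_fun (e F F') (aY h y)
    rw [comp_actT_one, comp_actT_one, H.conv_act] at e1
    refine e1.trans (e2.symm.trans ?_)
    simp [actT]
  | add a b ha hb => intro F F'; simp only [TensorProduct.add_tmul, map_add, ha, hb]
  | smul c a ha => intro F F'; simp only [← TensorProduct.smul_tmul', map_smul, ha]
  | x_mul i r ih =>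
    intro F F'
    have e1 : (conv (comulT D L ΔY aY) F F' ∘ₗ actT D L aY h) ((D.x L i * r) ⊗ₜ y)
      = (D.χ i h : k) • (conv (comulT D L ΔY aY) F F' ∘ₗ lmT D L Y i) (actT D L aY h (r ⊗ₜ y)) := by
      simp [actT, ← TensorProduct.smul_tmul']
    rw [e1, convT_x_mul' H.act_mul, convT_x_mul H.act_mul, comp_actT_lmT, comp_actT_lmT,
      comp_actT_comm H.act_mul, conv_smul_left, conv_smul_right, LinearMap.smul_apply,
      LinearMap.smul_apply, ih, ih, ← smul_add]
    rfl

/-- When the first factor is `1` every axiom reduces to that of `Y`, and the recursion shortens the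
word in the first factor. Iterating the construction gives the tensor square and the tensor cube. -/
theorem IsGCoalg.tensor (H : IsGCoalg ΔY aY εY) :
    IsGCoalg (comulT D L ΔY aY) (actT D L aY) (tens (D.eps L) εY) where
  act_one := by
    unfold actT; rw [actl_one, H.act_one, TensorProduct.map_id]
  act_mul g h := by
    unfold actT; rw [actl_mul, H.act_mul, TensorProduct.map_comp]
  eps_act h := by rw [tens_eps_actT, H.eps_act]
  conv_act := conv_actT H
  assoc f₁ f₂ f₃ := by
    have e := convT_one (D := D) (L := L) (A := k) (ΔY := ΔY) H.act_one
    refine TensorProduct.ext' fun r y => ?_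
    revert f₁ f₂ f₃
    induction r using word_induction with
    | one =>
      intro f₁ f₂ f₃
      have e1 := LinearMap.congr_fun (e (conv (comulT D L ΔY aY) f₁ f₂) f₃) y
      have e2 := LinearMap.congr_fun (e f₁ (conv (comulT D L ΔY aY) f₂ f₃)) y
      rw [e f₁ f₂, H.assoc] at e1
      rw [e f₂ f₃] at e2
      exact e1.trans e2.symm
    | add a b ha hb => intro f₁ f₂ f₃; simp only [TensorProduct.add_tmul, map_add, ha, hb]
    | smul c a ha => intro f₁ f₂ f₃; simp only [← TensorProduct.smul_tmul', map_smul, ha]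
    | x_mul i r ih =>
      intro f₁ f₂ f₃
      rw [convT_x_mul H.act_mul, convT_x_mul H.act_mul, convT_x_mul' H.act_mul,
        convT_x_mul' H.act_mul, ← conv_actT H, conv_add_left, conv_add_right,
        LinearMap.add_apply, LinearMap.add_apply, ih, ih, ih, add_assoc]
  eps_left f := by
    have e := convT_one (D := D) (L := L) (A := k) (ΔY := ΔY) H.act_one
    refine TensorProduct.ext' fun r y => ?_
    revert f
    induction r using word_induction with
    | one =>
      intro f
      have e1 := LinearMap.congr_fun (e (tens (D.eps L) εY) f) y
      rw [tens_eps_one, H.eps_left] at e1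
      exact e1
    | add a b ha hb => intro f; simp only [TensorProduct.add_tmul, map_add, ha, hb]
    | smul c a ha => intro f; simp only [← TensorProduct.smul_tmul', map_smul, ha]
    | x_mul i r ih =>
      intro f
      rw [convT_x_mul H.act_mul, tens_eps_lmT, conv_zero_left, tens_eps_actT, H.eps_act, ih]
      simp
  eps_right f := by
    have e := convT_one (D := D) (L := L) (A := k) (ΔY := ΔY) H.act_one
    refine TensorProduct.ext' fun r y => ?_
    revert f
    induction r using word_induction with
    | one =>
      intro f
      have e1 := LinearMap.congr_fun (e f (tens (D.eps L) εY)) y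
      rw [tens_eps_one, H.eps_right] at e1
      exact e1
    | add a b ha hb => intro f; simp only [TensorProduct.add_tmul, map_add, ha, hb]
    | smul c a ha => intro f; simp only [← TensorProduct.smul_tmul', map_smul, ha]
    | x_mul i r ih =>
      intro f
      rw [convT_x_mul H.act_mul, tens_eps_lmT, conv_zero_right, ih]
      simp

end Tensor

/-! ### Convolution monoids and coalgebra maps -/

section Coalgebras

variable {k G : Type*} [Field k] [CommGroup G]

/-- A coassociative and counital coalgebra with an action of `G` by coalgebra maps. -/
structure GCoalg (k G Y : Type*) [Field k] [CommGroup G] [AddCommGroup Y] [Module k Y] where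
  /-- the comultiplication -/
  Δ : Y →ₗ[k] Y ⊗[k] Y
  /-- the action -/
  act : G → Y →ₗ[k] Y
  /-- the counit -/
  ε : Y →ₗ[k] k
  isGCoalg : IsGCoalg Δ act ε

variable {Y Y' Y'' : Type*} [AddCommGroup Y] [Module k Y] [AddCommGroup Y'] [Module k Y']
  [AddCommGroup Y''] [Module k Y'']

/-- The functionals on a coalgebra. -/
def Fn (_ : GCoalg k G Y) : Type _ := Y →ₗ[k] k

variable {C : GCoalg k G Y} {C' : GCoalg k G Y'} {C'' : GCoalg k G Y''}

/-- The convolution product of functionals. -/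
instance : Monoid (Fn C) where
  mul f f' := conv C.Δ f f'
  one := C.ε
  mul_assoc f g h := C.isGCoalg.assoc f g h
  one_mul f := C.isGCoalg.eps_left f
  mul_one f := C.isGCoalg.eps_right f

/-- The composition of a functional with a linear map. -/
def Fn.comp (f : Fn C') (φ : Y →ₗ[k] Y') : Fn C := LinearMap.comp (show Y' →ₗ[k] k from f) φ

/-- The submonoid of `G`-invariant functionals. -/
def invFn (C : GCoalg k G Y) : Submonoid (Fn C) where
  carrier := {f | ∀ h, f.comp (C.act h) = f}
  mul_mem' {f f'} hf hf' h := by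
    have := C.isGCoalg.conv_act f f' h
    refine this.symm.trans ?_
    exact congrArg₂ (conv C.Δ) (hf h) (hf' h)
  one_mem' h := C.isGCoalg.eps_act h

/-- An equivariant coalgebra map. -/
structure CMap (C : GCoalg k G Y) (C' : GCoalg k G Y') (φ : Y →ₗ[k] Y') : Prop where
  act : ∀ h, φ ∘ₗ C.act h = C'.act h ∘ₗ φ
  conv : ∀ f f' : Y' →ₗ[k] k, conv C'.Δ f f' ∘ₗ φ = QLS.conv C.Δ (f ∘ₗ φ) (f' ∘ₗ φ)
  eps : C'.ε ∘ₗ φ = C.ε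

/-- The homomorphism of convolution monoids induced by a coalgebra map. -/
def CMap.hom {φ : Y →ₗ[k] Y'} (hφ : CMap C C' φ) : Fn C' →* Fn C where
  toFun f := f.comp φ
  map_one' := hφ.eps
  map_mul' f f' := hφ.conv f f'

theorem CMap.hom_injective {φ : Y →ₗ[k] Y'} (hφ : CMap C C' φ) (h : Function.Surjective φ) :
    Function.Injective hφ.hom := fun f f' e => by
  refine LinearMap.ext fun y => ?_
  obtain ⟨x, rfl⟩ := h y
  exact LinearMap.congr_fun e x

theorem CMap.hom_mem {φ : Y →ₗ[k] Y'} (hφ : CMap C C' φ) {f : Fn C'} (hf : f ∈ invFn C') :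
    hφ.hom f ∈ invFn C := fun h => by
  refine Eq.trans (b := Fn.comp (C := C) (Fn.comp (C := C') f (C'.act h)) φ) ?_ ?_
  · exact congrArg (LinearMap.comp (show Y' →ₗ[k] k from f)) (hφ.act h)
  · rw [hf h]; rfl

theorem CMap.mem_of_hom {φ : Y →ₗ[k] Y'} (hφ : CMap C C' φ) (h : Function.Surjective φ) {f : Fn C'}
    (hf : hφ.hom f ∈ invFn C) : f ∈ invFn C' := fun g => by
  apply hφ.hom_injective h
  exact (congrArg (LinearMap.comp (show Y' →ₗ[k] k from f)) (hφ.act g)).symm.trans (hf g)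

/-- The action as a monoid endomorphism of the functionals. -/
theorem CMap.ofAct (C : GCoalg k G Y) (h : G) : CMap C C (C.act h) where
  act g := by rw [← C.isGCoalg.act_mul, mul_comm, C.isGCoalg.act_mul]
  conv f f' := (C.isGCoalg.conv_act f f' h).symm
  eps := C.isGCoalg.eps_act h

/-- The translate of `f'` by a group element is again an inverse of the invariant `f`, and inverses
are unique. -/
theorem inv_mem {f f' : Fn C} (hf : f ∈ invFn C) (h : f * f' = 1) (h' : f' * f = 1) :
    f' ∈ invFn C := fun g => by
  have e : (CMap.ofAct C g).hom f' * f = 1 := by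
    have := congrArg (CMap.ofAct C g).hom h'
    rwa [map_mul, map_one, show (CMap.ofAct C g).hom f = f from hf g] at this
  change (CMap.ofAct C g).hom f' = f'
  rw [← mul_one ((CMap.ofAct C g).hom f'), ← h, ← mul_assoc, e, one_mul]

end Coalgebras

/-! ### Coalgebra maps between tensor powers -/

section Tensor

variable {k G ι ι' : Type*} [Field k] [CommGroup G] [LinearOrder ι] [LinearOrder ι']
variable {D : QLS k G ι} {L : Layer} {D' : QLS k G ι'} {L' : Layer}
variable {Y Y' : Type*} [AddCommGroup Y] [Module k Y] [AddCommGroup Y'] [Module k Y']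

/-- `R` or `B` as a coalgebra with `G`-action. -/
def XC (D : QLS k G ι) (L : Layer) : GCoalg k G (D.Alg L) := ⟨_, _, _, isGCoalg D L⟩

/-- The braided tensor product of `R` or `B` with a coalgebra. -/
def TC (D : QLS k G ι) (L : Layer) (C : GCoalg k G Y) : GCoalg k G (D.Alg L ⊗[k] Y) :=
  ⟨_, _, _, C.isGCoalg.tensor⟩

/-- The braided tensor square. -/
abbrev X2 (D : QLS k G ι) (L : Layer) := TC D L (XC D L)

/-- The braided tensor cube. -/
abbrev X3 (D : QLS k G ι) (L : Layer) := TC D L (X2 D L)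

variable (C : GCoalg k G Y) (C' : GCoalg k G Y')

theorem TC_one (F F' : D.Alg L ⊗[k] Y →ₗ[k] k) (y : Y) :
    conv (TC D L C).Δ F F' (1 ⊗ₜ y) = conv C.Δ (F ∘ₗ TensorProduct.mk k (D.Alg L) Y 1)
        (F' ∘ₗ TensorProduct.mk k (D.Alg L) Y 1) y :=
  LinearMap.congr_fun (convT_one C.isGCoalg.act_one F F') y

theorem TC_x_mul (F F' : D.Alg L ⊗[k] Y →ₗ[k] k) (i : ι) (r : D.Alg L) (y : Y) :
    conv (TC D L C).Δ F F' ((D.x L i * r) ⊗ₜ y)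
      = conv (TC D L C).Δ (F ∘ₗ lmT D L Y i) F' (r ⊗ₜ y)
      + conv (TC D L C).Δ (F ∘ₗ (TC D L C).act (D.g i)) (F' ∘ₗ lmT D L Y i) (r ⊗ₜ y) :=
  convT_x_mul C.isGCoalg.act_mul F F' i r y

/-- An algebra map that sends each generator to `0` or to a generator of the same kind. -/
def IsMorph (θ : D.Alg L →ₐ[k] D'.Alg L') : Prop :=
  ∀ i, θ (D.x L i) = 0 ∨ ∃ i', θ (D.x L i) = D'.x L' i' ∧ D'.g i' = D.g i ∧ D'.χ i' = D.χ i

theorem IsMorph.id (D : QLS k G ι) (L : Layer) : IsMorph (AlgHom.id k (D.Alg L)) :=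
  fun i => Or.inr ⟨i, rfl, rfl, rfl⟩

variable {θ : D.Alg L →ₐ[k] D'.Alg L'} (hθ : IsMorph θ)
include hθ

theorem IsMorph.comp_act (h : G) :
    θ.toLinearMap ∘ₗ D.actl L h = D'.actl L' h ∘ₗ θ.toLinearMap := by
  have : θ.comp (D.act L h) = (D'.act L' h).comp θ := hom_ext fun i => by
    rcases hθ i with h0 | ⟨i', h1, -, h2⟩
    · simp [h0]
    · simp [h1, h2]
  exact congrArg AlgHom.toLinearMap this

/-- A generator that is killed contributes nothing to either side; one that survives keeps its
degree and its character, so the two recursions agree. This treats `π`, `p_S` and `i_S` together. -/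
theorem IsMorph.bconv {A B M : Type*} [AddCommGroup A] [Module k A] [AddCommGroup B] [Module k B]
    [AddCommGroup M] [Module k M] (β : A →ₗ[k] B →ₗ[k] M) (f : D'.Alg L' →ₗ[k] A)
    (f' : D'.Alg L' →ₗ[k] B) :
    bconv (D'.comul L') β f f' ∘ₗ θ.toLinearMap
      = QLS.bconv (D.comul L) β (f ∘ₗ θ.toLinearMap) (f' ∘ₗ θ.toLinearMap) := by
  ext r
  revert f f'
  induction r using word_induction with
  | one => intro f f'; simp
  | add a b ha hb => intro f f'; simp only [map_add, ha, hb]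
  | smul c a ha => intro f f'; simp only [map_smul, ha]
  | x_mul i r ih =>
    intro f f'
    have hact : (f ∘ₗ θ.toLinearMap) ∘ₗ D.actl L (D.g i)
        = (f ∘ₗ D'.actl L' (D.g i)) ∘ₗ θ.toLinearMap := by
      rw [LinearMap.comp_assoc, hθ.comp_act]; rfl
    rw [bconv_x_mul, hact]
    rcases hθ i with h0 | ⟨i', h1, h2, -⟩
    · have e1 : (f ∘ₗ θ.toLinearMap) ∘ₗ lm (D.x L i) = 0 := by ext; simp [h0]
      have e2 : (f' ∘ₗ θ.toLinearMap) ∘ₗ lm (D.x L i) = 0 := by ext; simp [h0]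
      rw [e1, e2]
      simp [h0]
    · have e1 : (f ∘ₗ θ.toLinearMap) ∘ₗ lm (D.x L i) = (f ∘ₗ lm (D'.x L' i')) ∘ₗ θ.toLinearMap := by
        ext; simp [h1]
      have e2 : (f' ∘ₗ θ.toLinearMap) ∘ₗ lm (D.x L i)
          = (f' ∘ₗ lm (D'.x L' i')) ∘ₗ θ.toLinearMap := by
        ext; simp [h1]
      rw [e1, e2, ← ih, ← ih, ← h2]
      simp only [LinearMap.comp_apply, AlgHom.toLinearMap_apply, map_mul, h1, bconv_x_mul]

theorem IsMorph.counit : D'.eps L' ∘ₗ θ.toLinearMap = D.eps L := by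
  have : (D'.counit L').comp θ = D.counit L := hom_ext fun i => by
    rcases hθ i with h0 | ⟨i', h1, -⟩
    · simp [h0]
    · simp [h1]
  exact congrArg AlgHom.toLinearMap this

theorem IsMorph.cmap : CMap (XC D L) (XC D' L') θ.toLinearMap where
  act := hθ.comp_act
  conv f f' := hθ.bconv _ f f'
  eps := hθ.counit

variable {C C'}

theorem IsMorph.cmap_map {φ : Y →ₗ[k] Y'} (hφ : CMap C C' φ) :
    CMap (TC D L C) (TC D' L' C') (TensorProduct.map θ.toLinearMap φ) where
  act h := by
    change TensorProduct.map _ _ ∘ₗ TensorProduct.map _ _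
      = TensorProduct.map _ _ ∘ₗ TensorProduct.map _ _
    rw [← TensorProduct.map_comp, ← TensorProduct.map_comp, hθ.comp_act, hφ.act]
  eps := by
    refine TensorProduct.ext' fun r y => ?_
    have e1 := LinearMap.congr_fun hθ.counit r
    have e2 := LinearMap.congr_fun hφ.eps y
    simp only [LinearMap.comp_apply] at e1 e2
    simp only [TC, tens, LinearMap.comp_apply, TensorProduct.map_tmul, e1, e2]
  conv f f' := by
    refine TensorProduct.ext' fun r y => ?_
    have hact : ∀ (f : D'.Alg L' ⊗[k] Y' →ₗ[k] k) h,
        (f ∘ₗ TensorProduct.map θ.toLinearMap φ) ∘ₗ (TC D L C).act h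
        = (f ∘ₗ (TC D' L' C').act h) ∘ₗ TensorProduct.map θ.toLinearMap φ := by
      intro f h
      rw [LinearMap.comp_assoc, LinearMap.comp_assoc]
      congr 1
      change TensorProduct.map _ _ ∘ₗ TensorProduct.map _ _
        = TensorProduct.map _ _ ∘ₗ TensorProduct.map _ _
      rw [← TensorProduct.map_comp, ← TensorProduct.map_comp, hθ.comp_act, hφ.act]
    revert f f'
    induction r using word_induction with
    | one =>
      intro f f'
      have e : ∀ f : D'.Alg L' ⊗[k] Y' →ₗ[k] k,
          (f ∘ₗ TensorProduct.map θ.toLinearMap φ) ∘ₗ TensorProduct.mk k (D.Alg L) Y 1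
          = (f ∘ₗ TensorProduct.mk k (D'.Alg L') Y' 1) ∘ₗ φ := by
        intro f; ext; simp
      rw [TC_one, e, e, ← hφ.conv]
      simp only [LinearMap.comp_apply, TensorProduct.map_tmul, AlgHom.toLinearMap_apply, map_one,
        TC_one]
    | add a b ha hb => intro f f'; simp only [TensorProduct.add_tmul, map_add, ha, hb]
    | smul c a ha => intro f f'; simp only [← TensorProduct.smul_tmul', map_smul, ha]
    | x_mul i r ih =>
      intro f f'
      rw [TC_x_mul, hact]
      rcases hθ i with h0 | ⟨i', h1, h2, -⟩
      · have e : ∀ f : D'.Alg L' ⊗[k] Y' →ₗ[k] k,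
            (f ∘ₗ TensorProduct.map θ.toLinearMap φ) ∘ₗ lmT D L Y i = 0 :=
          fun f => TensorProduct.ext' fun r y => by simp [h0]
        rw [e, e]
        simp [h0]
      · have e : ∀ f : D'.Alg L' ⊗[k] Y' →ₗ[k] k,
            (f ∘ₗ TensorProduct.map θ.toLinearMap φ) ∘ₗ lmT D L Y i
            = (f ∘ₗ lmT D' L' Y' i') ∘ₗ TensorProduct.map θ.toLinearMap φ :=
          fun f => TensorProduct.ext' fun r y => by simp [h1]
        rw [e, e, ← ih, ← ih, ← h2]
        simp only [LinearMap.comp_apply, AlgHom.toLinearMap_apply, TensorProduct.map_tmul, map_mul,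
          h1, TC_x_mul]

omit hθ

/-- `ε ⊗ 1`. -/
def epsl (D : QLS k G ι) (L : Layer) (Y : Type*) [AddCommGroup Y] [Module k Y] :
    D.Alg L ⊗[k] Y →ₗ[k] Y := (TensorProduct.lid k Y).toLinearMap ∘ₗ (D.eps L).rTensor Y

/-- `1 ⊗ ε`. -/
def epsr (D : QLS k G ι) (L : Layer) (C : GCoalg k G Y) : D.Alg L ⊗[k] Y →ₗ[k] D.Alg L :=
  (TensorProduct.rid k (D.Alg L)).toLinearMap ∘ₗ (C.ε).lTensor (D.Alg L)

theorem comp_epsl (f : Y →ₗ[k] k) : f ∘ₗ epsl D L Y = tens (D.eps L) f :=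
  TensorProduct.ext' fun r y => by simp [epsl, tens]

theorem comp_epsr (f : D.Alg L →ₗ[k] k) : f ∘ₗ epsr D L C = tens f C.ε :=
  TensorProduct.ext' fun r y => by simp [epsr, tens, mul_comm]

/-- Since `ε(xᵢ) = 0`, both terms of the recursion vanish, and only words of length zero in the
first factor count. -/
theorem cmap_epsl (D : QLS k G ι) (L : Layer) (C : GCoalg k G Y) :
    CMap (TC D L C) C (epsl D L Y) where
  act h := TensorProduct.ext' fun r y => by simp [epsl, TC, actT]
  eps := comp_epsl _
  conv f f' := by
    simp only [comp_epsl]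
    refine TensorProduct.ext' fun r y => ?_
    induction r using word_induction with
    | one => rw [TC_one, tens_eps_one, tens_eps_one]; simp [tens]
    | add a b ha hb => simp only [TensorProduct.add_tmul, map_add, ha, hb]
    | smul c a ha => simp only [← TensorProduct.smul_tmul', map_smul, ha]
    | x_mul i r ih =>
      rw [TC_x_mul, tens_eps_lmT, tens_eps_lmT, conv_zero_left, conv_zero_right]
      simp [tens]

theorem tens_lmT (f : D.Alg L →ₗ[k] k) (f' : Y →ₗ[k] k) (i : ι) :
    tens f f' ∘ₗ lmT D L Y i = tens (f ∘ₗ lm (D.x L i)) f' :=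
  TensorProduct.ext' fun r y => by simp [tens]

theorem tens_one (f : D.Alg L →ₗ[k] k) (f' : Y →ₗ[k] k) :
    tens f f' ∘ₗ TensorProduct.mk k (D.Alg L) Y 1 = f 1 • f' := by
  ext; simp [tens]

theorem cmap_epsr (D : QLS k G ι) (L : Layer) (C : GCoalg k G Y) :
    CMap (TC D L C) (XC D L) (epsr D L C) where
  act h := TensorProduct.ext' fun r y => by
    have := LinearMap.congr_fun (C.isGCoalg.eps_act h) y
    simp only [LinearMap.comp_apply] at this
    simp [epsr, TC, actT, XC, this]
  eps := comp_epsr _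
  conv f f' := by
    simp only [comp_epsr]
    refine TensorProduct.ext' fun r y => ?_
    revert f f'
    induction r using word_induction with
    | one =>
      intro f f'
      have e1 : conv (XC D L).Δ f f' 1 = f 1 * f' 1 := bconv_one _ f f'
      rw [TC_one, tens_one, tens_one, conv_smul_left, conv_smul_right, C.isGCoalg.eps_left]
      simp [tens, e1, mul_assoc]
    | add a b ha hb => intro f f'; simp only [TensorProduct.add_tmul, map_add, ha, hb]
    | smul c a ha => intro f f'; simp only [← TensorProduct.smul_tmul', map_smul, ha]
    | x_mul i r ih =>
      intro f f'
      have e2 : tens f C.ε ∘ₗ (TC D L C).act (D.g i) = tens (f ∘ₗ D.actl L (D.g i)) C.ε := by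
        rw [← C.isGCoalg.eps_act (D.g i), ← tens_actT, C.isGCoalg.eps_act]; rfl
      rw [TC_x_mul, tens_lmT, tens_lmT, e2, ← ih, ← ih]
      have e1 := bconv_x_mul (LinearMap.mul k k) f f' i r
      simp only [tens, LinearMap.comp_apply, TensorProduct.map_tmul, LinearMap.mul'_apply]
      rw [← add_mul]
      exact congrArg (· * C.ε y) e1

/-- This is the bialgebra axiom. The letter `xᵢ` in `xᵢ r y` may be read as the first letter of the
first tensor factor or of the product, and both readings lead to the same recursion. -/
theorem cmap_m (D : QLS k G ι) (L : Layer) : CMap (X2 D L) (XC D L) (D.m L) where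
  act h := TensorProduct.ext' fun r y => by simp [m, TC, XC, actT]
  eps := TensorProduct.ext' fun r y => by simp [m, TC, XC, tens]
  conv f f' := by
    refine TensorProduct.ext' fun r y => ?_
    revert f f'
    induction r using word_induction with
    | one =>
      intro f f'
      have e : ∀ f : D.Alg L →ₗ[k] k, (f ∘ₗ D.m L) ∘ₗ TensorProduct.mk k (D.Alg L) (D.Alg L) 1 = f :=
        fun f => by ext; simp [m]
      rw [TC_one, e, e]; simp [m]
    | add a b ha hb => intro f f'; simp only [TensorProduct.add_tmul, map_add, ha, hb]
    | smul c a ha => intro f f'; simp only [← TensorProduct.smul_tmul', map_smul, ha]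
    | x_mul i r ih =>
      intro f f'
      have e1 : ∀ f : D.Alg L →ₗ[k] k, (f ∘ₗ D.m L) ∘ₗ lmT D L _ i = (f ∘ₗ lm (D.x L i)) ∘ₗ D.m L :=
        fun f => TensorProduct.ext' fun r y => by simp [m, mul_assoc]
      have e2 : ∀ f : D.Alg L →ₗ[k] k, (f ∘ₗ D.m L) ∘ₗ (X2 D L).act (D.g i)
          = (f ∘ₗ D.actl L (D.g i)) ∘ₗ D.m L :=
        fun f => TensorProduct.ext' fun r y => by simp [m, TC, XC, actT]
      rw [TC_x_mul, e1, e1, e2, ← ih, ← ih]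
      have := bconv_x_mul (LinearMap.mul k k) f f' i (r * y)
      simp only [LinearMap.comp_apply, m, LinearMap.mul'_apply, mul_assoc]
      exact this

/-- The map `m ⊗ 1 : X ⊗ (X ⊗ Y) → X ⊗ Y`. -/
def ml (D : QLS k G ι) (L : Layer) (Y : Type*) [AddCommGroup Y] [Module k Y] :
    D.Alg L ⊗[k] (D.Alg L ⊗[k] Y) →ₗ[k] D.Alg L ⊗[k] Y :=
  (D.m L).rTensor Y ∘ₗ (TensorProduct.assoc k (D.Alg L) (D.Alg L) Y).symm.toLinearMap

theorem ml_tmul (r s : D.Alg L) (y : Y) : ml D L Y (r ⊗ₜ (s ⊗ₜ y)) = (r * s) ⊗ₜ y := by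
  simp [ml, m]

theorem tensor3_ext {Z : Type*} [AddCommGroup Z] [Module k Z]
    {F F' : D.Alg L ⊗[k] (D.Alg L ⊗[k] Y) →ₗ[k] Z}
    (h : ∀ r s y, F (r ⊗ₜ (s ⊗ₜ y)) = F' (r ⊗ₜ (s ⊗ₜ y))) : F = F' :=
  TensorProduct.ext (LinearMap.ext fun r => TensorProduct.ext' fun s y => h r s y)

theorem cmap_ml (D : QLS k G ι) (L : Layer) (C : GCoalg k G Y) :
    CMap (TC D L (TC D L C)) (TC D L C) (ml D L Y) where
  act h := tensor3_ext fun r s y => by simp [ml_tmul, TC, actT]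
  eps := tensor3_ext fun r s y => by simp [ml_tmul, TC, tens, mul_assoc]
  conv f f' := by
    refine TensorProduct.ext' fun r y => ?_
    revert f f'
    induction r using word_induction with
    | one =>
      intro f f'
      have e : ml D L Y ∘ₗ TensorProduct.mk k (D.Alg L) (D.Alg L ⊗[k] Y) 1 = LinearMap.id :=
        TensorProduct.ext' fun r y => by simp [ml_tmul]
      rw [TC_one, LinearMap.comp_assoc, LinearMap.comp_assoc, e]
      exact congrArg (conv _ f f') (LinearMap.congr_fun e y)
    | add a b ha hb => intro f f'; simp only [TensorProduct.add_tmul, map_add, ha, hb]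
    | smul c a ha => intro f f'; simp only [← TensorProduct.smul_tmul', map_smul, ha]
    | x_mul i r ih =>
      intro f f'
      have e1 : ml D L Y ∘ₗ lmT D L _ i = lmT D L Y i ∘ₗ ml D L Y :=
        tensor3_ext fun r s y => by simp [ml_tmul, mul_assoc]
      have e2 : ml D L Y ∘ₗ (TC D L (TC D L C)).act (D.g i) = (TC D L C).act (D.g i) ∘ₗ ml D L Y :=
        tensor3_ext fun r s y => by simp [ml_tmul, TC, actT]
      rw [TC_x_mul, LinearMap.comp_assoc, LinearMap.comp_assoc, LinearMap.comp_assoc, e1, e2,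
        ← LinearMap.comp_assoc, ← LinearMap.comp_assoc, ← LinearMap.comp_assoc, ← ih, ← ih]
      have e3 := convT_x_mul' (D := D) (L := L) (ΔY := C.Δ) C.isGCoalg.act_mul f f' i
      have e4 := LinearMap.congr_fun e3 (ml D L Y (r ⊗ₜ y))
      refine Eq.trans ?_ e4
      exact congrArg (conv _ f f') (LinearMap.congr_fun e1 (r ⊗ₜ y))

/-- The functional `ε ⊗ f` absorbs no letter of the first factor and, being invariant, does not feel
the action. All these letters therefore go to `F` in either order of the product, and the claim
reduces to the slices of `F`. -/
theorem conv_tens_eps_comm {f : Y →ₗ[k] k} (hf : ∀ h, f ∘ₗ C.act h = f)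
    (F : D.Alg L ⊗[k] Y →ₗ[k] k)
    (hF : ∀ r : D.Alg L, conv C.Δ f (F ∘ₗ TensorProduct.mk k (D.Alg L) Y r)
      = conv C.Δ (F ∘ₗ TensorProduct.mk k (D.Alg L) Y r) f) :
    conv (TC D L C).Δ (tens (D.eps L) f) F = conv (TC D L C).Δ F (tens (D.eps L) f) := by
  refine TensorProduct.ext' fun r y => ?_
  revert F
  induction r using word_induction with
  | one =>
    intro F hF
    rw [TC_one, TC_one, tens_eps_one, hF]
  | add a b ha hb => intro F hF; simp only [TensorProduct.add_tmul, map_add, ha F hF, hb F hF]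
  | smul c a ha => intro F hF; simp only [← TensorProduct.smul_tmul', map_smul, ha F hF]
  | x_mul i r ih =>
    intro F hF
    have e : tens (D.eps L) f ∘ₗ (TC D L C).act (D.g i) = tens (D.eps L) f := by
      refine (tens_eps_actT _ _).trans (congrArg _ (hf _))
    rw [TC_x_mul, TC_x_mul, tens_eps_lmT, e, conv_zero_left, conv_zero_right,
      LinearMap.zero_apply, zero_add, add_zero]
    exact ih _ fun r => hF (D.x L i * r)

theorem d0_commute {f : Fn C} (hf : f ∈ invFn C) (F : Fn (TC D L C))
    (hF : ∀ r : D.Alg L, Commute f (F.comp (TensorProduct.mk k (D.Alg L) Y r))) :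
    Commute ((cmap_epsl D L C).hom f) F := by
  have := conv_tens_eps_comm (D := D) (L := L) (C := C) hf F hF
  rw [← comp_epsl] at this
  exact this

end Tensor

/-! ### Functionals with disjoint support commute -/

section Orthogonal

variable {k G ι ι₁ ι₂ : Type*} [Field k] [CommGroup G] [LinearOrder ι] [LinearOrder ι₁]
  [LinearOrder ι₂]
variable {D : QLS k G ι} {L : Layer} {D₁ : QLS k G ι₁} {D₂ : QLS k G ι₂}
variable {Y Y₁ Y₂ : Type*} [AddCommGroup Y] [Module k Y] [AddCommGroup Y₁] [Module k Y₁]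
  [AddCommGroup Y₂] [Module k Y₂]

/-- The functionals on `Y` that come from `Y₁` and `Y₂` commute up to a scalar, which depends on
the character of the second one and on the degree `γ` of the first one. -/
def SemiComm (D : QLS k G ι) {L : Layer} (θ₁ : D.Alg L →ₐ[k] D₁.Alg L) (C : GCoalg k G Y)
    (C₁ : GCoalg k G Y₁)
    (C₂ : GCoalg k G Y₂) (φ₁ : Y →ₗ[k] Y₁) (φ₂ : Y →ₗ[k] Y₂) : Prop :=
  ∀ (f : Y₁ →ₗ[k] k) (f' : Y₂ →ₗ[k] k) (α β : G →* kˣ) (γ : G),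
    (∀ h, f ∘ₗ C₁.act h = (α h : k) • f) → (∀ h, f' ∘ₗ C₂.act h = (β h : k) • f') →
    (∀ i, θ₁ (D.x L i) = 0 → α (D.g i) = D.χ i γ) →
    conv C.Δ (f ∘ₗ φ₁) (f' ∘ₗ φ₂) = (β γ : k) • conv C.Δ (f' ∘ₗ φ₂) (f ∘ₗ φ₁)

theorem semiinv_lm {f : D.Alg L →ₗ[k] k} {α : G →* kˣ} (hf : ∀ h, f ∘ₗ D.actl L h = (α h : k) • f)
    (i : ι) (h : G) : (f ∘ₗ lm (D.x L i)) ∘ₗ D.actl L h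
      = ((α * (D.χ i)⁻¹) h : k) • (f ∘ₗ lm (D.x L i)) := by
  have e := comp_act_lm_x f h i
  rw [hf h, LinearMap.smul_comp] at e
  rw [MonoidHom.mul_apply, mul_comm, MonoidHom.inv_apply, Units.val_mul, mul_smul, e, smul_smul,
    Units.inv_mul, one_smul]

theorem semiinv_lmT {C : GCoalg k G Y} {f : D.Alg L ⊗[k] Y →ₗ[k] k} {α : G →* kˣ}
    (hf : ∀ h, f ∘ₗ (TC D L C).act h = (α h : k) • f)
    (i : ι) (h : G) : (f ∘ₗ lmT D L Y i) ∘ₗ (TC D L C).act h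
      = ((α * (D.χ i)⁻¹) h : k) • (f ∘ₗ lmT D L Y i) := by
  have e : (f ∘ₗ (TC D L C).act h) ∘ₗ lmT D L Y i
      = (D.χ i h : k) • ((f ∘ₗ lmT D L Y i) ∘ₗ (TC D L C).act h) := comp_actT_lmT f h i
  rw [hf h, LinearMap.smul_comp] at e
  rw [MonoidHom.mul_apply, mul_comm, MonoidHom.inv_apply, Units.val_mul, mul_smul, e, smul_smul,
    Units.inv_mul, one_smul]

variable {θ₁ : D.Alg L →ₐ[k] D₁.Alg L} {θ₂ : D.Alg L →ₐ[k] D₂.Alg L} (h₁ : IsMorph θ₁)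
  (h₂ : IsMorph θ₂) (h₁₂ : ∀ i, θ₁ (D.x L i) = 0 ∨ θ₂ (D.x L i) = 0)
include h₁ h₂ h₁₂

omit h₁ h₂ h₁₂ in
-- This preserves the compatibility of `α` and `γ` when the first functional absorbs `xᵢ`: the new
-- factors cancel by `χᵢ(gⱼ) χⱼ(gᵢ) = 1`.
theorem degree_step {θ : D.Alg L →ₐ[k] D₁.Alg L} {α : G →* kˣ} {γ : G}
    (hα : ∀ i, θ (D.x L i) = 0 → α (D.g i) = D.χ i γ) (i : ι) (hi : θ (D.x L i) ≠ 0) (j : ι)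
    (hj : θ (D.x L j) = 0) : (α * (D.χ i)⁻¹) (D.g j) = D.χ j (γ * D.g i) := by
  have hij : i ≠ j := fun e => hi (e ▸ hj)
  rw [MonoidHom.mul_apply, hα j hj, map_mul, MonoidHom.inv_apply,
    inv_eq_of_mul_eq_one_right (D.cartan i j hij)]

/-- Each letter can be absorbed by at most one of the two functionals. If the second one absorbs
`xᵢ`, then `β` becomes `β χᵢ⁻¹` while the action on the first one gives `α(gᵢ) = χᵢ(γ)`, and these
factors cancel. If the first one absorbs it, then `γ` becomes `γ gᵢ`, and the extra `β(gᵢ)` is the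
factor produced by the action in the opposite order. Semi-invariant functionals are needed even for
the invariant case, because absorbing a letter destroys invariance. -/
theorem semiComm_X :
    SemiComm D θ₁ (XC D L) (XC D₁ L) (XC D₂ L) θ₁.toLinearMap θ₂.toLinearMap := by
  have hx : ∀ (f f' : D.Alg L →ₗ[k] k) i r, conv (XC D L).Δ f f' (D.x L i * r)
      = conv (XC D L).Δ (f ∘ₗ lm (D.x L i)) f' r
        + conv (XC D L).Δ (f ∘ₗ D.actl L (D.g i)) (f' ∘ₗ lm (D.x L i)) r := bconv_x_mul _
  intro f f' α β γ hf hf' hα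
  ext r
  revert f f' α β γ
  induction r using word_induction with
  | one =>
    intro f f' α β γ hf hf' hα
    have e := LinearMap.congr_fun (hf' γ) 1
    have e1 : ∀ f f' : D.Alg L →ₗ[k] k, conv (XC D L).Δ f f' 1 = f 1 * f' 1 := bconv_one _
    have e2 : f' 1 = β γ * f' 1 := by simpa [XC] using e
    rw [LinearMap.smul_apply, e1, e1]
    simp only [LinearMap.comp_apply, AlgHom.toLinearMap_apply, map_one, smul_eq_mul]
    rw [← mul_assoc, ← e2, mul_comm]
  | add a b ha hb =>
    intro f f' α β γ hf hf' hα
    rw [map_add, map_add, ha f f' α β γ hf hf' hα, hb f f' α β γ hf hf' hα]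
  | smul c a ha =>
    intro f f' α β γ hf hf' hα
    rw [map_smul, map_smul, ha f f' α β γ hf hf' hα]
  | x_mul i r ih =>
    intro f f' α β γ hf hf' hα
    have hact : (f ∘ₗ θ₁.toLinearMap) ∘ₗ D.actl L (D.g i) = (α (D.g i) : k) • (f ∘ₗ θ₁.toLinearMap) := by
      rw [LinearMap.comp_assoc, h₁.comp_act, ← LinearMap.comp_assoc, ← LinearMap.smul_comp]
      exact congrArg (· ∘ₗ _) (hf (D.g i))
    have hact' : (f' ∘ₗ θ₂.toLinearMap) ∘ₗ D.actl L (D.g i)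
        = (β (D.g i) : k) • (f' ∘ₗ θ₂.toLinearMap) := by
      rw [LinearMap.comp_assoc, h₂.comp_act, ← LinearMap.comp_assoc, ← LinearMap.smul_comp]
      exact congrArg (· ∘ₗ _) (hf' (D.g i))
    rw [LinearMap.smul_apply, hx, hx, hact, hact', conv_smul_left, conv_smul_left]
    by_cases hi : θ₁ (D.x L i) = 0
    · have e1 : (f ∘ₗ θ₁.toLinearMap) ∘ₗ lm (D.x L i) = 0 := by ext; simp [hi]
      rw [e1, conv_zero_left, conv_zero_right, smul_zero, LinearMap.zero_apply, zero_add, add_zero]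
      rcases h₂ i with h0 | ⟨i', hi', -, hχ⟩
      · have e2 : (f' ∘ₗ θ₂.toLinearMap) ∘ₗ lm (D.x L i) = 0 := by ext; simp [h0]
        rw [e2]; simp
      · have e2 : (f' ∘ₗ θ₂.toLinearMap) ∘ₗ lm (D.x L i)
            = (f' ∘ₗ lm (D₂.x L i')) ∘ₗ θ₂.toLinearMap := by ext; simp [hi']
        rw [e2, LinearMap.smul_apply, ih _ _ α _ γ hf (semiinv_lm hf' i') hα, LinearMap.smul_apply,
          smul_smul, hχ, MonoidHom.mul_apply, MonoidHom.inv_apply, ← Units.val_mul, hα i hi,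
          mul_comm (β γ), mul_inv_cancel_left]
    · have h0 := (h₁₂ i).resolve_left hi
      obtain ⟨i', hi', -, hχ⟩ := (h₁ i).resolve_left hi
      have e1 : (f' ∘ₗ θ₂.toLinearMap) ∘ₗ lm (D.x L i) = 0 := by ext; simp [h0]
      have e2 : (f ∘ₗ θ₁.toLinearMap) ∘ₗ lm (D.x L i)
            = (f ∘ₗ lm (D₁.x L i')) ∘ₗ θ₁.toLinearMap := by ext; simp [hi']
      rw [e1, conv_zero_left, conv_zero_right, smul_zero, LinearMap.zero_apply, zero_add, add_zero,
        e2, ih _ _ _ β (γ * D.g i) (semiinv_lm hf i') hf' ?_, LinearMap.smul_apply,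
        LinearMap.smul_apply, smul_smul, map_mul, Units.val_mul]
      rw [hχ]
      exact degree_step hα i hi

/-- The bookkeeping of scalars is that of `semiComm_X`; words of length zero are covered by the
hypothesis on `Y`. -/
theorem semiComm_TC {C : GCoalg k G Y} {C₁ : GCoalg k G Y₁} {C₂ : GCoalg k G Y₂} {φ₁ : Y →ₗ[k] Y₁}
    {φ₂ : Y →ₗ[k] Y₂} (H₁ : CMap C C₁ φ₁) (H₂ : CMap C C₂ φ₂) (H : SemiComm D θ₁ C C₁ C₂ φ₁ φ₂) :
    SemiComm D θ₁ (TC D L C) (TC D₁ L C₁) (TC D₂ L C₂) (TensorProduct.map θ₁.toLinearMap φ₁)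
      (TensorProduct.map θ₂.toLinearMap φ₂) := by
  have K₁ := h₁.cmap_map H₁
  have K₂ := h₂.cmap_map H₂
  intro f f' α β γ hf hf' hα
  refine TensorProduct.ext' fun r y => ?_
  revert f f' α β γ
  induction r using word_induction with
  | one =>
    intro f f' α β γ hf hf' hα
    have e1 : (f ∘ₗ TensorProduct.map θ₁.toLinearMap φ₁) ∘ₗ TensorProduct.mk k (D.Alg L) Y 1
        = (f ∘ₗ TensorProduct.mk k (D₁.Alg L) Y₁ 1) ∘ₗ φ₁ := by ext; simp
    have e2 : (f' ∘ₗ TensorProduct.map θ₂.toLinearMap φ₂) ∘ₗ TensorProduct.mk k (D.Alg L) Y 1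
        = (f' ∘ₗ TensorProduct.mk k (D₂.Alg L) Y₂ 1) ∘ₗ φ₂ := by ext; simp
    rw [LinearMap.smul_apply, TC_one, TC_one, e1, e2, H _ _ α β γ ?_ ?_ hα, LinearMap.smul_apply]
    · exact fun h => (comp_actT_one f h).symm.trans (by
        have := hf h
        exact (congrArg (fun F => F ∘ₗ TensorProduct.mk k (D₁.Alg L) Y₁ 1) this).trans
          (LinearMap.smul_comp _ _ _))
    · exact fun h => (comp_actT_one f' h).symm.trans (by
        have := hf' h
        exact (congrArg (fun F => F ∘ₗ TensorProduct.mk k (D₂.Alg L) Y₂ 1) this).trans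
          (LinearMap.smul_comp _ _ _))
  | add a b ha hb =>
    intro f f' α β γ hf hf' hα
    simp only [TensorProduct.add_tmul, map_add, ha f f' α β γ hf hf' hα, hb f f' α β γ hf hf' hα]
  | smul c a ha =>
    intro f f' α β γ hf hf' hα
    simp only [← TensorProduct.smul_tmul', map_smul, ha f f' α β γ hf hf' hα]
  | x_mul i r ih =>
    intro f f' α β γ hf hf' hα
    have hact : (f ∘ₗ TensorProduct.map θ₁.toLinearMap φ₁) ∘ₗ (TC D L C).act (D.g i)
        = (α (D.g i) : k) • (f ∘ₗ TensorProduct.map θ₁.toLinearMap φ₁) := by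
      rw [LinearMap.comp_assoc, K₁.act, ← LinearMap.comp_assoc, hf, LinearMap.smul_comp]
    have hact' : (f' ∘ₗ TensorProduct.map θ₂.toLinearMap φ₂) ∘ₗ (TC D L C).act (D.g i)
        = (β (D.g i) : k) • (f' ∘ₗ TensorProduct.map θ₂.toLinearMap φ₂) := by
      rw [LinearMap.comp_assoc, K₂.act, ← LinearMap.comp_assoc, hf', LinearMap.smul_comp]
    rw [LinearMap.smul_apply, TC_x_mul, TC_x_mul, hact, hact', conv_smul_left, conv_smul_left]
    by_cases hi : θ₁ (D.x L i) = 0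
    · have e1 : (f ∘ₗ TensorProduct.map θ₁.toLinearMap φ₁) ∘ₗ lmT D L Y i = 0 :=
        TensorProduct.ext' fun r y => by simp [hi]
      rw [e1, conv_zero_left, conv_zero_right, smul_zero, LinearMap.zero_apply, zero_add, add_zero]
      rcases h₂ i with h0 | ⟨i', hi', -, hχ⟩
      · have e2 : (f' ∘ₗ TensorProduct.map θ₂.toLinearMap φ₂) ∘ₗ lmT D L Y i = 0 :=
          TensorProduct.ext' fun r y => by simp [h0]
        rw [e2]; simp
      · have e2 : (f' ∘ₗ TensorProduct.map θ₂.toLinearMap φ₂) ∘ₗ lmT D L Y i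
            = (f' ∘ₗ lmT D₂ L Y₂ i') ∘ₗ TensorProduct.map θ₂.toLinearMap φ₂ :=
          TensorProduct.ext' fun r y => by simp [hi']
        rw [e2, LinearMap.smul_apply, ih _ _ α _ γ hf (semiinv_lmT hf' i') hα, LinearMap.smul_apply,
          smul_smul, hχ, MonoidHom.mul_apply, MonoidHom.inv_apply, ← Units.val_mul, hα i hi,
          mul_comm (β γ), mul_inv_cancel_left]
    · have h0 := (h₁₂ i).resolve_left hi
      obtain ⟨i', hi', -, hχ⟩ := (h₁ i).resolve_left hi
      have e1 : (f' ∘ₗ TensorProduct.map θ₂.toLinearMap φ₂) ∘ₗ lmT D L Y i = 0 :=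
        TensorProduct.ext' fun r y => by simp [h0]
      have e2 : (f ∘ₗ TensorProduct.map θ₁.toLinearMap φ₁) ∘ₗ lmT D L Y i
            = (f ∘ₗ lmT D₁ L Y₁ i') ∘ₗ TensorProduct.map θ₁.toLinearMap φ₁ :=
        TensorProduct.ext' fun r y => by simp [hi']
      rw [e1, conv_zero_left, conv_zero_right, smul_zero, LinearMap.zero_apply, zero_add, add_zero,
        e2, ih _ _ _ β (γ * D.g i) (semiinv_lmT hf i') hf' ?_, LinearMap.smul_apply,
        LinearMap.smul_apply, smul_smul, map_mul, Units.val_mul]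
      rw [hχ]
      exact degree_step hα i hi

omit h₁ h₂ h₁₂ in
theorem SemiComm.commute {C : GCoalg k G Y} {C₁ : GCoalg k G Y₁} {C₂ : GCoalg k G Y₂}
    {φ₁ : Y →ₗ[k] Y₁} {φ₂ : Y →ₗ[k] Y₂} (H : SemiComm D θ₁ C C₁ C₂ φ₁ φ₂) (H₁ : CMap C C₁ φ₁)
    (H₂ : CMap C C₂ φ₂) {f : Fn C₁} {f' : Fn C₂} (hf : f ∈ invFn C₁) (hf' : f' ∈ invFn C₂) :
    Commute (H₁.hom f) (H₂.hom f') := by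
  -- Invariance is semi-invariance for the trivial character; with `γ = 1` the scalar is `1`.
  have := H f f' 1 1 1 (fun h => (hf h).trans (one_smul k (show Y₁ →ₗ[k] k from f)).symm)
    (fun h => (hf' h).trans (one_smul k (show Y₂ →ₗ[k] k from f')).symm) (fun i _ => by simp)
  exact this.trans (one_smul _ _)

end Orthogonal

/-- A functional as a linear map. -/
abbrev Fn.ev {k G Y : Type*} [Field k] [CommGroup G] [AddCommGroup Y] [Module k Y]
    {C : GCoalg k G Y} (f : Fn C) : Y →ₗ[k] k := f

/-! ### The faces, the cosimplicial identities and cocycles -/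

section Cosimplicial

variable {k G ι : Type*} [Field k] [CommGroup G] [LinearOrder ι]
variable (D : QLS k G ι) (L : Layer)

/-- `∂⁰ : Hom(X, k) → Hom(X ⊗ X, k)`. -/
def d0 : Fn (XC D L) →* Fn (X2 D L) := (cmap_epsl D L (XC D L)).hom

/-- `∂¹ : Hom(X, k) → Hom(X ⊗ X, k)`. -/
def d1 : Fn (XC D L) →* Fn (X2 D L) := (cmap_m D L).hom

/-- `∂² : Hom(X, k) → Hom(X ⊗ X, k)`. -/
def d2 : Fn (XC D L) →* Fn (X2 D L) := (cmap_epsr D L (XC D L)).hom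

/-- `∂⁰ : Hom(X ⊗ X, k) → Hom(X ⊗ X ⊗ X, k)`. -/
def e0 : Fn (X2 D L) →* Fn (X3 D L) := (cmap_epsl D L (X2 D L)).hom

/-- `∂¹ : Hom(X ⊗ X, k) → Hom(X ⊗ X ⊗ X, k)`. -/
def e1 : Fn (X2 D L) →* Fn (X3 D L) := (cmap_ml D L (XC D L)).hom

/-- `∂² : Hom(X ⊗ X, k) → Hom(X ⊗ X ⊗ X, k)`. -/
def e2 : Fn (X2 D L) →* Fn (X3 D L) := ((IsMorph.id D L).cmap_map (cmap_m D L)).hom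

/-- `∂³ : Hom(X ⊗ X, k) → Hom(X ⊗ X ⊗ X, k)`. -/
def e3 : Fn (X2 D L) →* Fn (X3 D L) := ((IsMorph.id D L).cmap_map (cmap_epsr D L (XC D L))).hom

variable {D L}

theorem d0_eq (f : Fn (XC D L)) : d0 D L f = tens (D.eps L) f.ev := comp_epsl _

theorem d2_eq (f : Fn (XC D L)) : d2 D L f = tens f.ev (D.eps L) := comp_epsr _

theorem d0_apply (f : Fn (XC D L)) (r s : D.Alg L) :
    Fn.ev (d0 D L f) (r ⊗ₜ s)
      = D.counit L r * Fn.ev f s := by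
  rw [d0_eq]; simp [tens]

theorem d2_apply (f : Fn (XC D L)) (r s : D.Alg L) :
    Fn.ev (d2 D L f) (r ⊗ₜ s)
      = Fn.ev f r * D.counit L s := by
  rw [d2_eq]; simp [tens]

theorem d1_apply (f : Fn (XC D L)) (r s : D.Alg L) :
    Fn.ev (d1 D L f) (r ⊗ₜ s) = Fn.ev f (r * s) := by
  change Fn.ev f (D.m L (r ⊗ₜ s)) = _
  simp [m]

theorem e0_eq (σ : Fn (X2 D L)) : e0 D L σ = tens (D.eps L) σ.ev := comp_epsl _

theorem e1_eq (σ : Fn (X2 D L)) :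
    e1 D L σ = (LinearMap.comp σ.ev
      ((D.m L).rTensor (D.Alg L) ∘ₗ
        (TensorProduct.assoc k (D.Alg L) (D.Alg L) (D.Alg L)).symm.toLinearMap)) := rfl

theorem e2_eq (σ : Fn (X2 D L)) :
    e2 D L σ = (LinearMap.comp σ.ev
      ((D.m L).lTensor (D.Alg L))) := rfl

theorem e3_eq (σ : Fn (X2 D L)) :
    e3 D L σ = (LinearMap.comp (tens σ.ev (D.eps L))
        (TensorProduct.assoc k (D.Alg L) (D.Alg L) (D.Alg L)).symm.toLinearMap) := by
  refine tensor3_ext fun r s t => ?_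
  change Fn.ev σ
    (TensorProduct.map LinearMap.id (epsr D L (XC D L)) (r ⊗ₜ (s ⊗ₜ t))) = _
  simp [epsr, tens, XC, mul_comm]

theorem fn3_ext {F F' : Fn (X3 D L)}
    (h : ∀ r s t, Fn.ev F (r ⊗ₜ (s ⊗ₜ t))
      = Fn.ev F' (r ⊗ₜ (s ⊗ₜ t))) : F = F' :=
  tensor3_ext h

theorem e0_apply (σ : Fn (X2 D L)) (r s t : D.Alg L) :
    Fn.ev (e0 D L σ) (r ⊗ₜ (s ⊗ₜ t))
      = D.counit L r * Fn.ev σ (s ⊗ₜ t) := by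
  rw [e0_eq]; simp [tens]

theorem e1_apply (σ : Fn (X2 D L)) (r s t : D.Alg L) :
    Fn.ev (e1 D L σ) (r ⊗ₜ (s ⊗ₜ t))
      = Fn.ev σ ((r * s) ⊗ₜ t) := by
  rw [e1_eq]; simp [m]

theorem e2_apply (σ : Fn (X2 D L)) (r s t : D.Alg L) :
    Fn.ev (e2 D L σ) (r ⊗ₜ (s ⊗ₜ t))
      = Fn.ev σ (r ⊗ₜ (s * t)) := by
  rw [e2_eq]; simp [m]

theorem e3_apply (σ : Fn (X2 D L)) (r s t : D.Alg L) :
    Fn.ev (e3 D L σ) (r ⊗ₜ (s ⊗ₜ t))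
      = Fn.ev σ (r ⊗ₜ s) * D.counit L t := by
  rw [e3_eq]; simp [tens]

theorem e2_d0 (f : Fn (XC D L)) : e2 D L (d0 D L f) = e0 D L (d1 D L f) :=
  fn3_ext fun r s t => by rw [e2_apply, e0_apply, d0_apply, d1_apply]

theorem e3_d0 (f : Fn (XC D L)) : e3 D L (d0 D L f) = e0 D L (d2 D L f) :=
  fn3_ext fun r s t => by rw [e3_apply, e0_apply, d0_apply, d2_apply, mul_assoc]

theorem e3_d2 (f : Fn (XC D L)) : e3 D L (d2 D L f) = e2 D L (d2 D L f) :=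
  fn3_ext fun r s t => by rw [e3_apply, e2_apply, d2_apply, d2_apply, map_mul (D.counit L), mul_assoc]

theorem e3_d1 (f : Fn (XC D L)) : e3 D L (d1 D L f) = e1 D L (d2 D L f) :=
  fn3_ext fun r s t => by rw [e3_apply, e1_apply, d1_apply, d2_apply]

theorem e1_d0 (f : Fn (XC D L)) : e1 D L (d0 D L f) = e0 D L (d0 D L f) :=
  fn3_ext fun r s t => by rw [e1_apply, e0_apply, d0_apply, d0_apply, map_mul (D.counit L), mul_assoc]

theorem e1_d1 (f : Fn (XC D L)) : e1 D L (d1 D L f) = e2 D L (d1 D L f) :=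
  fn3_ext fun r s t => by rw [e1_apply, e2_apply, d1_apply, d1_apply, mul_assoc]

/-- The slices of `f' ⊗ ε` in the first variable are multiples of `ε`, the unit for convolution, so
they commute with `f`. -/
theorem d0_d2_commute {f : Fn (XC D L)} (hf : f ∈ invFn (XC D L)) (f' : Fn (XC D L)) :
    Commute (d0 D L f) (d2 D L f') := by
  refine d0_commute hf _ fun r => ?_
  have e : (d2 D L f').comp (C := XC D L) (TensorProduct.mk k (D.Alg L) (D.Alg L) r)
      = Fn.ev f' r • D.eps L := by
    refine LinearMap.ext fun s => ?_
    exact d2_apply f' r s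
  rw [e]
  have e3 := conv_smul_right (A := k) (XC D L).Δ (Fn.ev f' r) f (D.eps L)
  have e4 := conv_smul_left (A := k) (XC D L).Δ (Fn.ev f' r) (D.eps L) f
  refine e3.trans (Eq.trans (congrArg _ ?_) e4.symm)
  exact ((XC D L).isGCoalg.eps_right f).trans ((XC D L).isGCoalg.eps_left f).symm

theorem d0_mem {f : Fn (XC D L)} (hf : f ∈ invFn (XC D L)) : d0 D L f ∈ invFn (X2 D L) :=
  CMap.hom_mem _ hf

theorem d1_mem {f : Fn (XC D L)} (hf : f ∈ invFn (XC D L)) : d1 D L f ∈ invFn (X2 D L) :=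
  CMap.hom_mem _ hf

theorem d2_mem {f : Fn (XC D L)} (hf : f ∈ invFn (XC D L)) : d2 D L f ∈ invFn (X2 D L) :=
  CMap.hom_mem _ hf

/-- A functional on the last factor against one on the first two: the slices of `σ ⊗ ε` have the
form `∂²`, which reduces the claim to two factors. -/
theorem e0_d0_commute {f : Fn (XC D L)} (hf : f ∈ invFn (XC D L)) (σ : Fn (X2 D L)) :
    Commute (e0 D L (d0 D L f)) (e3 D L σ) := by
  refine d0_commute (d0_mem hf) _ fun r => ?_
  have e : (e3 D L σ).comp (C := X2 D L)
      (TensorProduct.mk k (D.Alg L) (D.Alg L ⊗[k] D.Alg L) r)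
      = d2 D L (σ.comp (C := XC D L) (TensorProduct.mk k (D.Alg L) (D.Alg L) r)) := by
    refine TensorProduct.ext' fun s t => ?_
    exact (e3_apply σ r s t).trans
      (d2_apply (σ.comp (C := XC D L) (TensorProduct.mk k (D.Alg L) (D.Alg L) r)) s t).symm
  rw [e]
  exact d0_d2_commute hf _

/-- The normalised `2`-cocycles, in terms of the convolution monoids. -/
structure Cocycle (σ : Fn (X2 D L)) : Prop where
  inv : σ ∈ invFn (X2 D L)
  unit : IsUnit σ
  cocycle : e0 D L σ * e2 D L σ = e3 D L σ * e1 D L σ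
  norm_left : ∀ a, Fn.ev σ (1 ⊗ₜ a) = D.counit L a
  norm_right : ∀ a, Fn.ev σ (a ⊗ₜ 1) = D.counit L a

theorem isCocycle_iff {σ : Fn (X2 D L)} : D.IsCocycle L σ ↔ Cocycle σ := by
  have hc : conv (D.comul3 L) (tens (D.eps L) σ.ev)
        (LinearMap.comp σ.ev ((D.m L).lTensor (D.Alg L)))
      = e0 D L σ * e2 D L σ := by rw [e0_eq]; rfl
  have hc' : conv (D.comul3 L)
      (tens σ.ev (D.eps L) ∘ₗ
        (TensorProduct.assoc k (D.Alg L) (D.Alg L) (D.Alg L)).symm.toLinearMap)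
      (LinearMap.comp σ.ev ((D.m L).rTensor (D.Alg L) ∘ₗ
        (TensorProduct.assoc k (D.Alg L) (D.Alg L) (D.Alg L)).symm.toLinearMap))
      = e3 D L σ * e1 D L σ := by rw [e3_eq]; rfl
  constructor
  · rintro ⟨⟨σ', h1, h2, h3, h4⟩, h5, h6, h7⟩
    exact ⟨h1, ⟨⟨σ, σ', h3, h4⟩, rfl⟩, hc.symm.trans (h5.trans hc'), h6, h7⟩
  · rintro ⟨h1, ⟨⟨τ, τ', h3, h4⟩, rfl⟩, h5, h6, h7⟩
    exact ⟨⟨τ', h1, inv_mem h1 h3 h4, h3, h4⟩, hc.trans (h5.trans hc'.symm), h6, h7⟩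

theorem inv1_iff {f f' : Fn (XC D L)} :
    D.Inv1 L f f' ↔ f ∈ invFn (XC D L) ∧ f' ∈ invFn (XC D L) ∧ f * f' = 1 ∧ f' * f = 1 :=
  ⟨fun h => ⟨h.1, h.2, h.3, h.4⟩, fun h => ⟨h.1, h.2.1, h.2.2.1, h.2.2.2⟩⟩

theorem bdry_eq (f f' : Fn (XC D L)) : D.bdry L f f' = d0 D L f * d2 D L f * d1 D L f' := by
  rw [d0_eq, d2_eq]; rfl

theorem twist_eq (f f' : Fn (XC D L)) (σ : Fn (X2 D L)) :
    D.twist L f f' σ = d0 D L f * d2 D L f * σ * d1 D L f' := by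
  rw [d0_eq, d2_eq]; rfl

/-- After the cosimplicial identities are applied, the inner factors with `w` and `v` cancel. The
only commutation left is that of `∂⁰∂⁰v = ε ⊗ ε ⊗ v` with a product of factors in the image of `∂³`,
and this holds because `v` is invariant. -/
theorem bdry_cocycle {v w : Fn (XC D L)} (hv : v ∈ invFn (XC D L)) (h' : w * v = 1) :
    e0 D L (D.bdry L v w) * e2 D L (D.bdry L v w)
      = e3 D L (D.bdry L v w) * e1 D L (D.bdry L v w) := by
  rw [bdry_eq]
  simp only [map_mul, e2_d0, e3_d0, e3_d2, e3_d1, e1_d0, e1_d1]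
  have c1 : e0 D L (d1 D L w) * e0 D L (d1 D L v) = 1 := by rw [← map_mul, ← map_mul, h']; simp
  have c2 : e1 D L (d2 D L w) * e1 D L (d2 D L v) = 1 := by rw [← map_mul, ← map_mul, h']; simp
  have c3 : Commute (e0 D L (d0 D L v)) (e0 D L (d2 D L v) * e2 D L (d2 D L v) * e1 D L (d2 D L w)) := by
    rw [← e3_d0, ← e3_d2, ← e3_d1, ← map_mul, ← map_mul]
    exact e0_d0_commute hv _
  calc _ = e0 D L (d0 D L v) * e0 D L (d2 D L v) * (e0 D L (d1 D L w) * e0 D L (d1 D L v))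
          * e2 D L (d2 D L v) * e2 D L (d1 D L w) := by simp only [mul_assoc]
    _ = (e0 D L (d0 D L v) * (e0 D L (d2 D L v) * e2 D L (d2 D L v) * e1 D L (d2 D L w)))
          * e1 D L (d2 D L v) * e2 D L (d1 D L w) := by
        rw [c1, mul_one]
        rw [show e0 D L (d0 D L v) * (e0 D L (d2 D L v) * e2 D L (d2 D L v) * e1 D L (d2 D L w))
          * e1 D L (d2 D L v) = e0 D L (d0 D L v) * e0 D L (d2 D L v) * e2 D L (d2 D L v)
            * (e1 D L (d2 D L w) * e1 D L (d2 D L v)) by simp only [mul_assoc], c2, mul_one]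
    _ = _ := by rw [c3.eq]; simp only [mul_assoc]

end Cosimplicial

/-! ### Pullbacks commute with the faces -/

section Pullback

variable {k G ι ι' : Type*} [Field k] [CommGroup G] [LinearOrder ι] [LinearOrder ι']
variable {D : QLS k G ι} {L : Layer} {D' : QLS k G ι'} {L' : Layer}
variable {θ : D.Alg L →ₐ[k] D'.Alg L'} (hθ : IsMorph θ)

/-- The pull-back of functionals. -/
def IsMorph.p1 : Fn (XC D' L') →* Fn (XC D L) := hθ.cmap.hom

/-- The pull-back of functionals on the tensor square. -/
def IsMorph.p2 : Fn (X2 D' L') →* Fn (X2 D L) := (hθ.cmap_map hθ.cmap).hom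

/-- The pull-back of functionals on the tensor cube. -/
def IsMorph.p3 : Fn (X3 D' L') →* Fn (X3 D L) := (hθ.cmap_map (hθ.cmap_map hθ.cmap)).hom

theorem IsMorph.p1_apply (f : Fn (XC D' L')) (r : D.Alg L) :
    Fn.ev (hθ.p1 f) r = Fn.ev f (θ r) := rfl

theorem IsMorph.p2_apply (f : Fn (X2 D' L')) (r s : D.Alg L) :
    Fn.ev (hθ.p2 f) (r ⊗ₜ s)
      = Fn.ev f (θ r ⊗ₜ θ s) := rfl

theorem IsMorph.p3_apply (f : Fn (X3 D' L')) (r s t : D.Alg L) :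
    Fn.ev (hθ.p3 f) (r ⊗ₜ (s ⊗ₜ t))
      = Fn.ev f (θ r ⊗ₜ (θ s ⊗ₜ θ t)) := rfl

include hθ in
theorem IsMorph.counit_apply (r : D.Alg L) : D'.counit L' (θ r) = D.counit L r :=
  LinearMap.congr_fun hθ.counit r

theorem fn2_ext {F F' : Fn (X2 D L)}
    (h : ∀ r s, Fn.ev F (r ⊗ₜ s)
      = Fn.ev F' (r ⊗ₜ s)) : F = F' :=
  TensorProduct.ext' h

theorem IsMorph.p2_d0 (f : Fn (XC D' L')) : hθ.p2 (d0 D' L' f) = d0 D L (hθ.p1 f) :=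
  fn2_ext fun r s => by rw [p2_apply, d0_apply, d0_apply, p1_apply, hθ.counit_apply]

theorem IsMorph.p2_d1 (f : Fn (XC D' L')) : hθ.p2 (d1 D' L' f) = d1 D L (hθ.p1 f) :=
  fn2_ext fun r s => by rw [p2_apply, d1_apply, d1_apply, p1_apply, map_mul θ]

theorem IsMorph.p2_d2 (f : Fn (XC D' L')) : hθ.p2 (d2 D' L' f) = d2 D L (hθ.p1 f) :=
  fn2_ext fun r s => by rw [p2_apply, d2_apply, d2_apply, p1_apply, hθ.counit_apply]

theorem IsMorph.p3_e0 (f : Fn (X2 D' L')) : hθ.p3 (e0 D' L' f) = e0 D L (hθ.p2 f) :=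
  fn3_ext fun r s t => by rw [p3_apply, e0_apply, e0_apply, p2_apply, hθ.counit_apply]

theorem IsMorph.p3_e1 (f : Fn (X2 D' L')) : hθ.p3 (e1 D' L' f) = e1 D L (hθ.p2 f) :=
  fn3_ext fun r s t => by rw [p3_apply, e1_apply, e1_apply, p2_apply, map_mul θ]

theorem IsMorph.p3_e2 (f : Fn (X2 D' L')) : hθ.p3 (e2 D' L' f) = e2 D L (hθ.p2 f) :=
  fn3_ext fun r s t => by rw [p3_apply, e2_apply, e2_apply, p2_apply, map_mul θ]

theorem IsMorph.p3_e3 (f : Fn (X2 D' L')) : hθ.p3 (e3 D' L' f) = e3 D L (hθ.p2 f) :=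
  fn3_ext fun r s t => by rw [p3_apply, e3_apply, e3_apply, p2_apply, hθ.counit_apply]

theorem IsMorph.p2_bdry (f f' : Fn (XC D' L')) :
    hθ.p2 (D'.bdry L' f f') = D.bdry L (hθ.p1 f) (hθ.p1 f') := by
  rw [bdry_eq, bdry_eq, map_mul, map_mul, p2_d0, p2_d1, p2_d2]

theorem IsMorph.p2_twist (f f' : Fn (XC D' L')) (σ : Fn (X2 D' L')) :
    hθ.p2 (D'.twist L' f f' σ) = D.twist L (hθ.p1 f) (hθ.p1 f') (hθ.p2 σ) := by
  rw [twist_eq, twist_eq, map_mul, map_mul, map_mul, p2_d0, p2_d1, p2_d2]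

theorem IsMorph.p2_cocycle {σ : Fn (X2 D' L')} (h : Cocycle σ) : Cocycle (hθ.p2 σ) where
  inv := CMap.hom_mem _ h.inv
  unit := h.unit.map _
  cocycle := by
    rw [← p3_e0, ← p3_e1, ← p3_e2, ← p3_e3, ← map_mul, ← map_mul, h.cocycle]
  norm_left a := by rw [p2_apply, map_one θ, h.norm_left, hθ.counit_apply]
  norm_right a := by rw [p2_apply, map_one θ, h.norm_right, hθ.counit_apply]

theorem IsMorph.p1_inv {f f' : Fn (XC D' L')} (h : D'.Inv1 L' f f') :
    D.Inv1 L (hθ.p1 f) (hθ.p1 f') := by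
  rw [inv1_iff] at h ⊢
  refine ⟨CMap.hom_mem _ h.1, CMap.hom_mem _ h.2.1, ?_, ?_⟩
  · rw [← map_mul, h.2.2.1, map_one]
  · rw [← map_mul, h.2.2.2, map_one]

theorem IsMorph.p1_injective (hs : Function.Surjective θ) : Function.Injective hθ.p1 :=
  CMap.hom_injective _ hs

theorem IsMorph.p2_injective (hs : Function.Surjective θ) : Function.Injective hθ.p2 :=
  CMap.hom_injective _ (TensorProduct.map_surjective hs hs)

theorem IsMorph.p3_injective (hs : Function.Surjective θ) : Function.Injective hθ.p3 :=
  CMap.hom_injective _ (TensorProduct.map_surjective hs (TensorProduct.map_surjective hs hs))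

end Pullback

/-! ### Convolution of functionals with linear maps -/

section Scalar

variable {k G ι : Type*} [Field k] [CommGroup G] [LinearOrder ι] {D : QLS k G ι} {L : Layer}
variable {M M' : Type*} [AddCommGroup M] [Module k M] [AddCommGroup M'] [Module k M']

/-- The convolution `r ↦ f(r₁) φ(r₂)` of a functional with a linear map. -/
def sc (f : D.Alg L →ₗ[k] k) (φ : D.Alg L →ₗ[k] M) : D.Alg L →ₗ[k] M :=
  bconv (D.comul L) (LinearMap.lsmul k M) f φ

theorem sc_one (f : D.Alg L →ₗ[k] k) (φ : D.Alg L →ₗ[k] M) : sc f φ 1 = f 1 • φ 1 := by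
  rw [sc, bconv_one]; rfl

theorem sc_x_mul (f : D.Alg L →ₗ[k] k) (φ : D.Alg L →ₗ[k] M) (i : ι) (r : D.Alg L) :
    sc f φ (D.x L i * r) = sc (f ∘ₗ lm (D.x L i)) φ r
      + sc (f ∘ₗ D.actl L (D.g i)) (φ ∘ₗ lm (D.x L i)) r :=
  bconv_x_mul _ _ _ _ _

theorem comp_sc (f : D.Alg L →ₗ[k] k) (φ : D.Alg L →ₗ[k] M) (ψ : M →ₗ[k] M') :
    ψ ∘ₗ sc f φ = sc f (ψ ∘ₗ φ) := by
  ext r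
  simp only [sc, bconv, LinearMap.comp_apply]
  induction D.comul L r using TensorProduct.induction_on with
  | zero => simp
  | add s t hs ht => simp only [map_add, hs, ht]
  | tmul s t => simp

theorem sc_eq_mul (f f' : Fn (XC D L)) : sc f.ev f'.ev = f * f' := by
  change bconv _ _ _ _ = bconv _ _ _ _
  congr 1

theorem sc_sc (f f' : Fn (XC D L)) (φ : D.Alg L →ₗ[k] M) : sc f.ev (sc f'.ev φ) = sc (f * f').ev φ :=
  (bconv_assoc (LinearMap.mul k k) (LinearMap.lsmul k M) (LinearMap.lsmul k M)
    (LinearMap.lsmul k M) (fun a b c => mul_smul a b c) _ _ _).symm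

theorem one_sc (φ : D.Alg L →ₗ[k] M) : sc (1 : Fn (XC D L)).ev φ = φ :=
  (bconv_eps_left _ _).trans (by ext; simp)

/-- The letters of `r` all go to `F`, and their degrees act trivially on the invariant `v`. Hence
only the second variable is convolved. This makes it possible to handle `∂v` one variable at a time.
-/
theorem d0_mul_apply {v : Fn (XC D L)} (hv : v ∈ invFn (XC D L)) (F : Fn (X2 D L))
    (r s : D.Alg L) :
    (d0 D L v * F).ev (r ⊗ₜ s) = sc v.ev (F.ev ∘ₗ TensorProduct.mk k (D.Alg L) (D.Alg L) r) s := by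
  have key : ∀ F : D.Alg L ⊗[k] D.Alg L →ₗ[k] k,
      conv (X2 D L).Δ (tens (D.eps L) v.ev) F (r ⊗ₜ s)
      = sc v.ev (F ∘ₗ TensorProduct.mk k (D.Alg L) (D.Alg L) r) s := by
    induction r using word_induction with
    | one => intro F; rw [TC_one, tens_eps_one]; rfl
    | add a b ha hb =>
      intro F
      rw [TensorProduct.add_tmul, map_add, ha, hb, map_add, LinearMap.comp_add]
      simp only [← LinearMap.add_apply]
      congr 1
      simp only [sc, bconv, TensorProduct.map_add_right, LinearMap.add_comp, LinearMap.comp_add]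
    | smul c a ha =>
      intro F
      rw [← TensorProduct.smul_tmul', map_smul, ha, map_smul, LinearMap.comp_smul, sc, sc,
        bconv_smul_right]; rfl
    | x_mul i r ih =>
      intro F
      have e : tens (D.eps L) v.ev ∘ₗ (X2 D L).act (D.g i) = tens (D.eps L) v.ev :=
        (tens_eps_actT _ _).trans (congrArg _ (hv _))
      rw [TC_x_mul, tens_eps_lmT, e, conv_zero_left, LinearMap.zero_apply, zero_add, ih]
      rfl
  rw [d0_eq]
  exact key F

theorem d2_mul_apply (v : Fn (XC D L)) (F : Fn (X2 D L)) (r s : D.Alg L) :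
    (d2 D L v * F).ev (r ⊗ₜ s)
      = sc v.ev (F.ev ∘ₗ (TensorProduct.mk k (D.Alg L) (D.Alg L)).flip s) r := by
  have key : ∀ (v : D.Alg L →ₗ[k] k) (F : D.Alg L ⊗[k] D.Alg L →ₗ[k] k),
      conv (X2 D L).Δ (tens v (D.eps L)) F (r ⊗ₜ s)
      = sc v (F ∘ₗ (TensorProduct.mk k (D.Alg L) (D.Alg L)).flip s) r := by
    induction r using word_induction with
    | one =>
      intro v F
      have e : conv (XC D L).Δ (D.eps L) (F ∘ₗ TensorProduct.mk k (D.Alg L) (D.Alg L) 1)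
        = F ∘ₗ TensorProduct.mk k (D.Alg L) (D.Alg L) 1 := (XC D L).isGCoalg.eps_left _
      rw [TC_one, tens_one, conv_smul_left, e, sc_one]
      rfl
    | add a b ha hb =>
      intro v F
      rw [TensorProduct.add_tmul, map_add, ha, hb, map_add]
    | smul c a ha =>
      intro v F
      rw [← TensorProduct.smul_tmul', map_smul, ha, map_smul]
    | x_mul i r ih =>
      intro v F
      have e2 : tens v (D.eps L) ∘ₗ (X2 D L).act (D.g i) = tens (v ∘ₗ D.actl L (D.g i)) (D.eps L) := by
        exact (tens_actT _ _ _).trans (congrArg _ ((isGCoalg D L).eps_act _))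
      rw [TC_x_mul, tens_lmT, e2, ih, ih, sc_x_mul]
      rfl
  rw [d2_eq]
  exact key v F

end Scalar

/-! ### Word length and convolution inverses -/

section Filtration

variable {k G ι : Type*} [Field k] [CommGroup G] [LinearOrder ι] {D : QLS k G ι} {L : Layer}

/-- The span of `1` and the generators. -/
def deg1 (D : QLS k G ι) (L : Layer) : Submodule k (D.Alg L) :=
  Submodule.span k (insert 1 (Set.range (D.x L)))

theorem one_mem_deg1 : (1 : D.Alg L) ∈ deg1 D L := Submodule.subset_span (Set.mem_insert _ _)

theorem x_mem_deg1 (i : ι) : D.x L i ∈ deg1 D L :=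
  Submodule.subset_span (Set.mem_insert_of_mem _ ⟨i, rfl⟩)

theorem deg1_pow_le (n : ℕ) : deg1 D L ^ n ≤ deg1 D L ^ (n + 1) := fun r hr => by
  rw [pow_succ', ← one_mul r]
  exact Submodule.mul_mem_mul one_mem_deg1 hr

theorem exists_mem_deg1_pow (r : D.Alg L) : ∃ n, r ∈ deg1 D L ^ n := by
  have mono : ∀ m n, m ≤ n → deg1 D L ^ m ≤ deg1 D L ^ n := fun m n h =>
    monotone_nat_of_le_succ (f := fun n => deg1 D L ^ n) deg1_pow_le h
  induction r using word_induction with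
  | one => exact ⟨0, Submodule.mem_one.2 ⟨1, map_one _⟩⟩
  | add a b ha hb =>
    obtain ⟨m, hm⟩ := ha
    obtain ⟨n, hn⟩ := hb
    exact ⟨max m n, add_mem (mono _ _ (le_max_left _ _) hm) (mono _ _ (le_max_right _ _) hn)⟩
  | smul c a ha => obtain ⟨m, hm⟩ := ha; exact ⟨m, Submodule.smul_mem _ _ hm⟩
  | x_mul i a ha =>
    obtain ⟨m, hm⟩ := ha
    refine ⟨m + 1, ?_⟩
    rw [pow_succ']
    exact Submodule.mul_mem_mul (x_mem_deg1 i) hm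

/-- The words of length less than `n`. -/
def wordsLT (D : QLS k G ι) (L : Layer) : ℕ → Submodule k (D.Alg L)
  | 0 => ⊥
  | n + 1 => deg1 D L ^ n

/-- The map `r ↦ p(r₁) r₂` does not increase the length of words; its part of full length is `p(1)
r`, which is absent if `p(1) = 0`. -/
theorem sc_id_mem (n : ℕ) (p : D.Alg L →ₗ[k] k) (r : D.Alg L) (hr : r ∈ deg1 D L ^ n) :
    sc p LinearMap.id r ∈ deg1 D L ^ n ∧ (p 1 = 0 → sc p LinearMap.id r ∈ wordsLT D L n) := by
  induction n generalizing p r with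
  | zero =>
    rw [pow_zero, Submodule.mem_one] at hr
    obtain ⟨c, rfl⟩ := hr
    rw [Algebra.algebraMap_eq_smul_one, map_smul, sc_one]
    refine ⟨Submodule.smul_mem _ _ (Submodule.smul_mem _ _ ?_), fun h => ?_⟩
    · exact Submodule.mem_one.2 ⟨1, map_one _⟩
    · simp [h]
  | succ n ih =>
    rw [pow_succ'] at hr
    induction hr using Submodule.mul_induction_on' with
    | add a _ b _ ha hb =>
      rw [map_add]
      exact ⟨add_mem ha.1 hb.1, fun h => add_mem (ha.2 h) (hb.2 h)⟩
    | mem_mul_mem a ha r hr =>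
      induction ha using Submodule.span_induction with
      | zero => simp
      | add a b _ _ ha hb =>
        rw [add_mul, map_add]
        exact ⟨add_mem ha.1 hb.1, fun h => add_mem (ha.2 h) (hb.2 h)⟩
      | smul c a _ ha =>
        rw [smul_mul_assoc, map_smul]
        exact ⟨Submodule.smul_mem _ _ ha.1, fun h => Submodule.smul_mem _ _ (ha.2 h)⟩
      | mem a ha =>
        rcases ha with rfl | ⟨i, rfl⟩
        · rw [one_mul]
          exact ⟨deg1_pow_le n (ih p r hr).1, fun _ => (ih p r hr).1⟩
        · have e : ∀ q : D.Alg L →ₗ[k] k, sc q (LinearMap.id ∘ₗ lm (D.x L i)) r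
              = D.x L i * sc q LinearMap.id r := fun q =>
            (LinearMap.congr_fun (comp_sc q LinearMap.id (lm (D.x L i))) r).symm
          rw [sc_x_mul, e]
          refine ⟨add_mem (deg1_pow_le n (ih _ r hr).1) ?_, fun h => add_mem (ih _ r hr).1 ?_⟩
          · rw [pow_succ']
            exact Submodule.mul_mem_mul (x_mem_deg1 i) (ih _ r hr).1
          -- The functional `p ∘ gᵢ` still vanishes at `1`, so here the remaining word is shorter
          -- and the factor `xᵢ` can be afforded.
          · have h2 := (ih (p ∘ₗ D.actl L (D.g i)) r hr).2 (by
              change p (D.act L (D.g i) 1) = 0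
              rw [map_one, h])
            cases n with
            | zero => rw [wordsLT, Submodule.mem_bot] at h2; rw [h2]; simp
            | succ n =>
              rw [wordsLT] at h2 ⊢
              rw [pow_succ']
              exact Submodule.mul_mem_mul (x_mem_deg1 i) h2

/-- The functional `ε - w` vanishes at `1`, so convolution with it shortens words and is a locally
nilpotent operator `P`. The operator `W = 1 - P` of convolution with `w` is then bijective by the
geometric series, and `ε ∘ W⁻¹` is the inverse sought. -/
theorem exists_right_inv (w : Fn (XC D L)) (hw : w.ev 1 = 1) : ∃ v : Fn (XC D L), w * v = 1 := by
  let p : D.Alg L →ₗ[k] k := D.eps L - w.ev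
  have hp : p 1 = 0 := by
    change D.eps L 1 - w.ev 1 = 0
    rw [hw]; simp
  let P : Module.End k (D.Alg L) := sc p LinearMap.id
  let W : Module.End k (D.Alg L) := sc w.ev LinearMap.id
  have hPW : P = 1 - W := by
    have h1 : W + P = sc (1 : Fn (XC D L)).ev LinearMap.id := by
      change bconv _ _ w.ev _ + bconv _ _ (D.eps L - w.ev) _ = bconv _ _ (D.eps L) _
      rw [← bconv_add_left, add_sub_cancel]
    rw [one_sc] at h1
    rw [eq_sub_iff_add_eq, add_comm, h1]; rfl
  have hnil : ∀ n, ∀ r ∈ wordsLT D L n, (P ^ n) r = 0 := by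
    intro n
    induction n with
    | zero => intro r hr; simpa [wordsLT] using hr
    | succ n ih =>
      intro r hr
      rw [pow_succ, Module.End.mul_apply]
      exact ih _ ((sc_id_mem n p r hr).2 hp)
  have hloc : ∀ r, ∃ n, (P ^ n) r = 0 := fun r => by
    obtain ⟨n, hn⟩ := exists_mem_deg1_pow r
    exact ⟨n + 1, hnil (n + 1) r hn⟩
  have hbij : Function.Bijective W := by
    constructor
    · rw [injective_iff_map_eq_zero]
      intro r hr
      have h1 : P r = r := by rw [hPW]; simp [hr]
      obtain ⟨n, hn⟩ := hloc r
      rw [← hn]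
      clear hn
      induction n with
      | zero => rfl
      | succ n ih => rw [pow_succ, Module.End.mul_apply, h1]; exact ih
    · intro r
      obtain ⟨n, hn⟩ := hloc r
      refine ⟨(∑ i ∈ Finset.range n, P ^ i) r, ?_⟩
      rw [← Module.End.mul_apply, show W = 1 - P by rw [hPW]; abel, mul_neg_geom_sum]
      simp [hn]
  let e := LinearEquiv.ofBijective W hbij
  let v : Fn (XC D L) := D.eps L ∘ₗ e.symm.toLinearMap
  refine ⟨v, ?_⟩
  rw [← sc_eq_mul]
  have h2 : v.ev ∘ₗ sc w.ev LinearMap.id = sc w v.ev := comp_sc w.ev LinearMap.id v.ev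
  rw [← h2]
  refine LinearMap.ext fun r => ?_
  change D.eps L (e.symm (e r)) = D.eps L r
  rw [e.symm_apply_apply]

theorem isUnit_fn (w : Fn (XC D L)) (hw : w.ev 1 = 1) : ∃ v : Fn (XC D L), w * v = 1 ∧ v * w = 1 := by
  obtain ⟨v, hv⟩ := exists_right_inv w hw
  have h1 : v.ev 1 = 1 := by
    have h2 : w.ev 1 * v.ev 1 = (w * v).ev 1 := (bconv_one (LinearMap.mul k k) w.ev v.ev).symm
    rw [hv, hw, one_mul] at h2
    rw [h2]
    exact map_one (D.counit L)
  obtain ⟨w', hw'⟩ := exists_right_inv v h1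
  have : w = w' := by
    rw [← mul_one w, ← hw', ← mul_assoc, hv, one_mul]
  exact ⟨v, hv, this ▸ hw'⟩

theorem ev_one_of_mul {v w : Fn (XC D L)} (h : v * w = 1) : v.ev 1 * w.ev 1 = 1 := by
  have h2 : v.ev 1 * w.ev 1 = (v * w).ev 1 := (bconv_one (LinearMap.mul k k) v.ev w.ev).symm
  rw [h2, h]
  exact map_one (D.counit L)

end Filtration

/-! ### The generators of `K` and the projection to `B` -/

section Generators

variable {k G ι : Type*} [Field k] [CommGroup G] [LinearOrder ι] {D : QLS k G ι}

theorem gens_comulOp {z : D.R} (hz : z ∈ D.gens) :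
    ∃ h, D.comulOp .pre z = D.opL .pre z + D.opR .pre h z := by
  rcases hz with ⟨i, rfl⟩ | ⟨i, j, h1, _, rfl⟩
  · exact ⟨_, comulOp_root i⟩
  · exact ⟨_, comulOp_link i j h1.ne⟩

theorem gens_subset_K {z : D.R} (hz : z ∈ D.gens) : z ∈ D.K := Algebra.subset_adjoin hz

theorem act_gens {z : D.R} (hz : z ∈ D.gens) (h : G) : D.act .pre h z = z :=
  D.act_K h z (gens_subset_K hz)

theorem counit_gens {z : D.R} (hz : z ∈ D.gens) : D.counit .pre z = 0 := by
  rcases hz with ⟨i, rfl⟩ | ⟨i, j, h1, _, rfl⟩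
  · rw [map_root]; simp [root, (D.N_pos i).ne']
  · rw [map_link]; simp [link]

@[simp]
theorem pi_x (i : ι) : D.pi (D.x .pre i) = D.x .nichols i := by simp [pi]

theorem pi_gens {z : D.R} (hz : z ∈ D.gens) : D.pi z = 0 := by
  rcases hz with ⟨i, rfl⟩ | ⟨i, j, h1, h2, rfl⟩
  · rw [map_root]; simpa using (D.sat_x .nichols).root_zero rfl i
  · rw [map_link]; simpa using (D.sat_x .nichols).link_zero rfl i j h1 h2

theorem isMorph_pi (D : QLS k G ι) : IsMorph D.pi := fun i => Or.inr ⟨i, pi_x i, rfl, rfl⟩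

theorem pi_surjective (D : QLS k G ι) : Function.Surjective D.pi := fun b => by
  induction b using word_induction with
  | one => exact ⟨1, map_one _⟩
  | add a b ha hb =>
    obtain ⟨a, rfl⟩ := ha
    obtain ⟨b, rfl⟩ := hb
    exact ⟨a + b, map_add _ _ _⟩
  | smul c a ha => obtain ⟨a, rfl⟩ := ha; exact ⟨c • a, map_smul _ _ _⟩
  | x_mul i a ha => obtain ⟨a, rfl⟩ := ha; exact ⟨D.x .pre i * a, by simp⟩

end Generators

/-! ### Linear maps on which `K` acts by scalars -/

section Characters

variable {k G ι : Type*} [Field k] [CommGroup G] [LinearOrder ι] {D : QLS k G ι}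
variable {A B M M' : Type*} [AddCommGroup A] [Module k A] [AddCommGroup B] [Module k B]
  [AddCommGroup M] [Module k M] [AddCommGroup M'] [Module k M']

/-- The generators `z` of `K` act on `θ` as the scalars `c z`, at any place of a product. -/
def KChar (c : D.R → k) (θ : D.R →ₗ[k] M) : Prop :=
  ∀ z ∈ D.gens, ∀ a b, θ (a * z * b) = c z • θ (a * b)

theorem KChar.lm {c : D.R → k} {θ : D.R →ₗ[k] M} (h : KChar c θ) (r : D.R) :
    KChar c (θ ∘ₗ QLS.lm r) := fun z hz a b => by simpa [mul_assoc] using h z hz (r * a) b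

theorem KChar.rm {c : D.R → k} {θ : D.R →ₗ[k] M} (h : KChar c θ) (r : D.R) :
    KChar c (θ ∘ₗ LinearMap.mulRight k r) := fun z hz a b => by
  simpa [mul_assoc] using h z hz a (b * r)

theorem KChar.act {c : D.R → k} {θ : D.R →ₗ[k] M} (h : KChar c θ) (g : G) :
    KChar c (θ ∘ₗ D.actl .pre g) := fun z hz a b => by
  simpa [act_gens hz] using h z hz (D.act .pre g a) (D.act .pre g b)

theorem kchar_pi : KChar (0 : D.R → k) D.pi.toLinearMap := fun z hz a b => by simp [pi_gens hz]

/-- The generator `z` is primitive. One term of the product rule gives the scalar `c z`, and the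
other one vanishes because `z` acts as zero through `θ'`. -/
theorem KChar.bconv {c : D.R → k} {θ : D.R →ₗ[k] A} {θ' : D.R →ₗ[k] B} (h : KChar c θ)
    (h' : KChar 0 θ') (β : A →ₗ[k] B →ₗ[k] M) : KChar c (QLS.bconv (D.comul .pre) β θ θ') := by
  intro z hz a b
  revert θ θ'
  induction a using word_induction with
  | one =>
    intro θ θ' h h'
    obtain ⟨g, hg⟩ := gens_comulOp hz
    have e1 : θ ∘ₗ QLS.lm z = c z • θ := by ext r; simpa using h z hz 1 r
    have e2 : θ' ∘ₗ QLS.lm z = 0 := by ext r; simpa using h' z hz 1 r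
    rw [one_mul, one_mul, bconv_mul_of_comulOp _ _ _ hg, e1, e2, bconv_smul_left]
    simp
  | add a a' ha hb =>
    intro θ θ' h h'
    simp only [add_mul, map_add, ha h h', hb h h', smul_add]
  | smul r a ha =>
    intro θ θ' h h'
    simp only [smul_mul_assoc, map_smul, ha h h', smul_comm r]
  | x_mul i a ih =>
    intro θ θ' h h'
    rw [mul_assoc, mul_assoc, bconv_x_mul, ← mul_assoc a, ih (h.lm _) h', ih (h.act _) (h'.lm _),
      mul_assoc, bconv_x_mul, smul_add]

/-- The ideal generated by the `z - c z`. -/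
def charIdeal (D : QLS k G ι) (c : D.R → k) : Submodule k D.R :=
  Submodule.span k {r | ∃ z ∈ D.gens, ∃ a b, r = a * z * b - c z • (a * b)}

theorem kchar_mkQ (c : D.R → k) : KChar c (charIdeal D c).mkQ := fun z hz a b => by
  rw [← map_smul, ← sub_eq_zero, ← map_sub, Submodule.mkQ_apply, Submodule.Quotient.mk_eq_zero]
  exact Submodule.subset_span ⟨z, hz, a, b, rfl⟩

theorem KChar.charIdeal_le {c : D.R → k} {θ : D.R →ₗ[k] M} (h : KChar c θ) :
    charIdeal D c ≤ LinearMap.ker θ := Submodule.span_le.2 <| by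
  rintro _ ⟨z, hz, a, b, rfl⟩
  simp [h z hz a b]

/-- Every surjection of the quotient by `z - c z` onto `B` is injective. -/
def Hopfian (D : QLS k G ι) (c : D.R → k) : Prop :=
  ∀ Φ : (D.R ⧸ charIdeal D c) →ₗ[k] D.B, Function.Surjective Φ → Function.Injective Φ

/-- The convolution of `w` with `π` respects the relations `z = c z`, so it factors through a map
`Φ` from the quotient of `R` by these relations to `B`. Convolving back with `v` shows that `Φ`
composed with `v * mkQ` is `π`. So `Φ` is surjective, hence injective by the Hopfian property, and
`v * mkQ` vanishes wherever `π` does. Every other `θ` factors through the quotient. -/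
theorem KChar.sc_eq_zero {c : D.R → k} (hc : Hopfian D c) {v w : Fn (XC D .pre)} (hvw : v * w = 1)
    (hw : KChar c w.ev) {θ : D.R →ₗ[k] M} (hθ : KChar c θ) {r : D.R} (hr : D.pi r = 0) :
    sc v.ev θ r = 0 := by
  have h1 : KChar c (sc w.ev D.pi.toLinearMap) := hw.bconv kchar_pi _
  let Φ := (charIdeal D c).liftQ _ h1.charIdeal_le
  have hΦ : Φ ∘ₗ (charIdeal D c).mkQ = sc w.ev D.pi.toLinearMap := Submodule.liftQ_mkQ _ _ _
  have h2 : Φ ∘ₗ sc v.ev (charIdeal D c).mkQ = D.pi.toLinearMap := by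
    rw [comp_sc, hΦ, sc_sc, hvw, one_sc]
  have h3 : Function.Surjective Φ := fun b => by
    obtain ⟨a, rfl⟩ := D.pi_surjective b
    exact ⟨_, LinearMap.congr_fun h2 a⟩
  have h4 : sc v.ev (charIdeal D c).mkQ r = 0 := by
    apply hc Φ h3
    rw [map_zero]
    exact (LinearMap.congr_fun h2 r).trans hr
  have h5 : sc v.ev θ = (charIdeal D c).liftQ θ hθ.charIdeal_le ∘ₗ sc v.ev (charIdeal D c).mkQ := by
    rw [comp_sc, Submodule.liftQ_mkQ]
  rw [h5, LinearMap.comp_apply, h4, map_zero]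

end Characters

/-! ### Functionals that descend from `R` to `B` -/

section Descent

variable {k G ι : Type*} [Field k] [CommGroup G] [LinearOrder ι] {D : QLS k G ι}

theorem exists_section (D : QLS k G ι) :
    ∃ s : D.B →ₗ[k] D.R, D.pi.toLinearMap ∘ₗ s = LinearMap.id :=
  LinearMap.exists_rightInverse_of_surjective _ (LinearMap.range_eq_top.2 D.pi_surjective)

theorem descend1 {F : Fn (XC D .pre)} (h : ∀ r, D.pi r = 0 → F.ev r = 0) :
    ∃ f, (isMorph_pi D).p1 f = F := by
  obtain ⟨s, hs⟩ := exists_section D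
  refine ⟨F.ev ∘ₗ s, LinearMap.ext fun r => ?_⟩
  change F.ev (s (D.pi r)) = F.ev r
  rw [← sub_eq_zero, ← map_sub]
  apply h
  have := LinearMap.congr_fun hs (D.pi r)
  simp only [LinearMap.comp_apply, AlgHom.toLinearMap_apply, LinearMap.id_apply] at this
  rw [map_sub, this, sub_self]

theorem descend2 {F : Fn (X2 D .pre)} (h : ∀ r s, D.pi r = 0 → F.ev (r ⊗ₜ s) = 0)
    (h' : ∀ r s, D.pi s = 0 → F.ev (r ⊗ₜ s) = 0) : ∃ f, (isMorph_pi D).p2 f = F := by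
  obtain ⟨s, hs⟩ := exists_section D
  have hs' : ∀ r, D.pi (s (D.pi r) - r) = 0 := fun r => by
    have := LinearMap.congr_fun hs (D.pi r)
    simp only [LinearMap.comp_apply, AlgHom.toLinearMap_apply, LinearMap.id_apply] at this
    rw [map_sub, this, sub_self]
  refine ⟨F.ev ∘ₗ TensorProduct.map s s, fn2_ext fun r t => ?_⟩
  change F.ev (s (D.pi r) ⊗ₜ s (D.pi t)) = F.ev (r ⊗ₜ t)
  have e1 := h _ (s (D.pi t)) (hs' r)
  have e2 := h' r _ (hs' t)
  rw [TensorProduct.sub_tmul, map_sub, sub_eq_zero] at e1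
  rw [TensorProduct.tmul_sub, map_sub, sub_eq_zero] at e2
  rw [e1, e2]

/-- The inverse on the larger coalgebra is not assumed to descend. Instead, convolution with `f` is
injective on the dual of the finite-dimensional `Y'`, since it becomes so after pullback, and is
therefore surjective. -/
theorem isUnit_of_hom {Y Y' : Type*} [AddCommGroup Y] [Module k Y] [AddCommGroup Y'] [Module k Y']
    [Module.Finite k Y'] {C : GCoalg k G Y} {C' : GCoalg k G Y'} {φ : Y →ₗ[k] Y'}
    (hφ : CMap C C' φ) (hs : Function.Surjective φ) {f : Fn C'} (hf : IsUnit (hφ.hom f)) :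
    IsUnit f := by
  let T : (Y' →ₗ[k] k) →ₗ[k] (Y' →ₗ[k] k) :=
    { toFun := fun f' => conv C'.Δ f.ev f'
      map_add' := fun a b => conv_add_right _ _ _ _
      map_smul' := fun c a => conv_smul_right _ _ _ _ }
  have hinj : Function.Injective T := fun a b hab => by
    apply hφ.hom_injective hs
    have h1 : hφ.hom f * hφ.hom (show Fn C' from a) = hφ.hom f * hφ.hom (show Fn C' from b) := by
      exact ((map_mul hφ.hom f (show Fn C' from a)).symm.trans (congrArg hφ.hom hab)).trans
        (map_mul hφ.hom f (show Fn C' from b))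
    exact hf.mul_left_cancel h1
  obtain ⟨g, hg⟩ := (LinearMap.injective_iff_surjective.1 hinj) C'.ε
  have h1 : f * (show Fn C' from g) = 1 := hg
  have h2 : (show Fn C' from g) * f = 1 := by
    apply hφ.hom_injective hs
    rw [map_mul, map_one]
    have h3 : hφ.hom f * hφ.hom (show Fn C' from g) = 1 := by rw [← map_mul, h1, map_one]
    apply hf.mul_left_cancel
    rw [← mul_assoc, h3, one_mul, mul_one]
  exact ⟨⟨f, g, h1, h2⟩, rfl⟩

end Descent

/-! ### Coboundaries on `R` that come from cocycles on `B` -/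

section Boundary

variable {k G ι : Type*} [Field k] [CommGroup G] [LinearOrder ι] {D : QLS k G ι}

/-- Since `∂⁰v` and `∂²v` commute, either one can be convolved last. This form has the inner
functional `v(r₁) w(r₂ s)`, which displays the dependence on `r`; `bdry_apply'` does the same for
`s`. -/
theorem bdry_apply {L : Layer} {v : Fn (XC D L)} (hv : v ∈ invFn (XC D L)) (w : Fn (XC D L))
    (r s : D.Alg L) : D.bdry L v w (r ⊗ₜ s)
      = sc v.ev ((d2 D L v * d1 D L w).ev ∘ₗ TensorProduct.mk k (D.Alg L) (D.Alg L) r) s := by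
  rw [← d0_mul_apply hv, ← mul_assoc, ← bdry_eq]

theorem bdry_apply' {L : Layer} {v : Fn (XC D L)} (hv : v ∈ invFn (XC D L)) (w : Fn (XC D L))
    (r s : D.Alg L) : D.bdry L v w (r ⊗ₜ s) = sc v.ev ((d0 D L v * d1 D L w).ev ∘ₗ
        (TensorProduct.mk k (D.Alg L) (D.Alg L)).flip s) r := by
  rw [← d2_mul_apply, ← mul_assoc, ← (d0_d2_commute hv v).eq, ← bdry_eq]

theorem d2_d1_apply {L : Layer} (v w : Fn (XC D L)) (r s : D.Alg L) :
    (d2 D L v * d1 D L w).ev (r ⊗ₜ s) = sc v.ev (w.ev ∘ₗ LinearMap.mulRight k s) r := by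
  rw [d2_mul_apply]
  congr 1

theorem d0_d1_apply {L : Layer} {v : Fn (XC D L)} (hv : v ∈ invFn (XC D L)) (w : Fn (XC D L))
    (r s : D.Alg L) :
    (d0 D L v * d1 D L w).ev (r ⊗ₜ s) = sc v.ev (w.ev ∘ₗ lm r) s := by
  rw [d0_mul_apply hv]
  congr 1

theorem sc_smul {L : Layer} {M : Type*} [AddCommGroup M] [Module k M] (c : k)
    (f : D.Alg L →ₗ[k] k) (φ : D.Alg L →ₗ[k] M) : sc f (c • φ) = c • sc f φ :=
  bconv_smul_right _ _ _ _ _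

theorem sc_zero {L : Layer} {M : Type*} [AddCommGroup M] [Module k M]
    (f : D.Alg L →ₗ[k] k) : sc f (0 : D.Alg L →ₗ[k] M) = 0 :=
  bconv_zero_right _ _ _

theorem bdry_one_left {L : Layer} {v w : Fn (XC D L)} (hv : v ∈ invFn (XC D L)) (h : v * w = 1)
    (h1 : v.ev 1 = 1) (s : D.Alg L) : D.bdry L v w (1 ⊗ₜ s) = D.counit L s := by
  have e : (d2 D L v * d1 D L w).ev ∘ₗ TensorProduct.mk k (D.Alg L) (D.Alg L) 1 = w.ev := by
    refine LinearMap.ext fun s => ?_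
    refine (d2_d1_apply v w 1 s).trans ?_
    rw [sc_one, h1]
    simp
  rw [bdry_apply hv, e, sc_eq_mul, h]
  rfl

theorem bdry_one_right {L : Layer} {v w : Fn (XC D L)} (hv : v ∈ invFn (XC D L)) (h : v * w = 1)
    (h1 : v.ev 1 = 1) (r : D.Alg L) : D.bdry L v w (r ⊗ₜ 1) = D.counit L r := by
  have e : (d0 D L v * d1 D L w).ev ∘ₗ (TensorProduct.mk k (D.Alg L) (D.Alg L)).flip 1 = w.ev := by
    refine LinearMap.ext fun s => ?_
    refine (d0_d1_apply hv w s 1).trans ?_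
    rw [sc_one, h1]
    simp
  rw [bdry_apply' hv, e, sc_eq_mul, h]
  rfl

variable {c : D.R → k} (hc : Hopfian D c)
include hc

theorem bdry_zero_left {v w : Fn (XC D .pre)} (hv : v ∈ invFn (XC D .pre)) (h : v * w = 1)
    (hw : KChar c w.ev) (r s : D.R) (hr : D.pi r = 0) : D.bdry .pre v w (r ⊗ₜ s) = 0 := by
  have e : (d2 D .pre v * d1 D .pre w).ev ∘ₗ TensorProduct.mk k D.R D.R r = 0 := by
    refine LinearMap.ext fun s => ?_
    refine (d2_d1_apply v w r s).trans ?_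
    exact hw.sc_eq_zero hc h (hw.rm s) hr
  rw [bdry_apply hv, e, sc_zero]
  rfl

theorem bdry_zero_right {v w : Fn (XC D .pre)} (hv : v ∈ invFn (XC D .pre)) (h : v * w = 1)
    (hw : KChar c w.ev) (r s : D.R) (hs : D.pi s = 0) : D.bdry .pre v w (r ⊗ₜ s) = 0 := by
  have e : (d0 D .pre v * d1 D .pre w).ev ∘ₗ (TensorProduct.mk k D.R D.R).flip s = 0 := by
    refine LinearMap.ext fun r => ?_
    refine (d0_d1_apply hv w r s).trans ?_
    exact hw.sc_eq_zero hc h (hw.lm r) hs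
  rw [bdry_apply' hv, e, sc_zero]
  rfl

/-- The coboundary vanishes as soon as one variable lies in the kernel of `π`. The cocycle
properties are verified after pullback to `R`, where they are those of `∂v`; invertibility descends
because `B` has finite dimension. -/
theorem exists_cocycle [Module.Finite k D.B] {v w : Fn (XC D .pre)} (hv : v ∈ invFn (XC D .pre))
    (hw : w ∈ invFn (XC D .pre)) (h : v * w = 1) (h' : w * v = 1) (h1 : v.ev 1 = 1)
    (hwc : KChar c w.ev) :
    ∃ σ : Fn (X2 D .nichols), Cocycle σ ∧ (isMorph_pi D).p2 σ = D.bdry .pre v w := by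
  obtain ⟨σ, hσ⟩ := descend2 (F := D.bdry .pre v w) (fun r s => bdry_zero_left hc hv h hwc r s)
    (fun r s => bdry_zero_right hc hv h hwc r s)
  have hs := D.pi_surjective
  have hunit : IsUnit ((isMorph_pi D).p2 σ) := by
    rw [hσ, bdry_eq]
    have u1 : IsUnit v := ⟨⟨v, w, h, h'⟩, rfl⟩
    have u2 : IsUnit w := ⟨⟨w, v, h', h⟩, rfl⟩
    exact ((u1.map _).mul (u1.map _)).mul (u2.map _)
  refine ⟨σ, ⟨?_, ?_, ?_, ?_, ?_⟩, hσ⟩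
  · refine CMap.mem_of_hom ((isMorph_pi D).cmap_map (isMorph_pi D).cmap) (TensorProduct.map_surjective hs hs) (f := σ) ?_
    change (isMorph_pi D).p2 σ ∈ _
    rw [hσ, bdry_eq]
    exact mul_mem (mul_mem (d0_mem hv) (d2_mem hv)) (d1_mem hw)
  · exact isUnit_of_hom ((isMorph_pi D).cmap_map (isMorph_pi D).cmap) (TensorProduct.map_surjective hs hs) hunit
  · apply (isMorph_pi D).p3_injective hs
    rw [map_mul, map_mul, IsMorph.p3_e0, IsMorph.p3_e1, IsMorph.p3_e2, IsMorph.p3_e3, hσ]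
    exact bdry_cocycle hv h'
  · intro a
    obtain ⟨a, rfl⟩ := hs a
    rw [(isMorph_pi D).counit_apply, ← bdry_one_left hv h h1, ← hσ, IsMorph.p2_apply, map_one]
  · intro a
    obtain ⟨a, rfl⟩ := hs a
    rw [(isMorph_pi D).counit_apply, ← bdry_one_right hv h h1, ← hσ, IsMorph.p2_apply, map_one]

/-- The functionals `w₁` and `w₂` have the same scalars, so `v₂ * w₁` and its inverse `v₁ * w₂`
vanish on the kernel of `π` and descend to `B`. The descended functional is the required `χ`. -/
theorem exists_twist {v₁ w₁ v₂ w₂ : Fn (XC D .pre)} (h₁ : D.Inv1 .pre v₁ w₁)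
    (h₂ : D.Inv1 .pre v₂ w₂) (k₁ : KChar c w₁.ev) (k₂ : KChar c w₂.ev) {σ₁ σ₂ : Fn (X2 D .nichols)}
    (e₁ : (isMorph_pi D).p2 σ₁ = D.bdry .pre v₁ w₁)
    (e₂ : (isMorph_pi D).p2 σ₂ = D.bdry .pre v₂ w₂) :
    ∃ χ χ' : Fn (XC D .nichols), D.Inv1 .nichols χ χ' ∧ σ₂ = D.twist .nichols χ χ' σ₁ := by
  obtain ⟨a1, b1, c1, c1'⟩ := inv1_iff.1 h₁
  obtain ⟨a2, b2, c2, c2'⟩ := inv1_iff.1 h₂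
  have hs := D.pi_surjective
  obtain ⟨χ, hχ⟩ := descend1 (F := v₂ * w₁) fun r hr => by
    rw [← sc_eq_mul]
    exact k₂.sc_eq_zero hc c2 k₁ hr
  obtain ⟨χ', hχ'⟩ := descend1 (F := v₁ * w₂) fun r hr => by
    rw [← sc_eq_mul]
    exact k₁.sc_eq_zero hc c1 k₂ hr
  have hinj := (isMorph_pi D).p1_injective hs
  refine ⟨χ, χ', inv1_iff.2 ⟨?_, ?_, ?_, ?_⟩, ?_⟩
  · refine CMap.mem_of_hom (isMorph_pi D).cmap hs (f := χ) ?_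
    change (isMorph_pi D).p1 χ ∈ _
    rw [hχ]; exact mul_mem a2 b1
  · refine CMap.mem_of_hom (isMorph_pi D).cmap hs (f := χ') ?_
    change (isMorph_pi D).p1 χ' ∈ _
    rw [hχ']; exact mul_mem a1 b2
  · apply hinj
    rw [map_mul, map_one, hχ, hχ', mul_assoc, ← mul_assoc w₁, c1', one_mul, c2]
  · apply hinj
    rw [map_mul, map_one, hχ, hχ', mul_assoc, ← mul_assoc w₂, c2', one_mul, c1]
  · apply (isMorph_pi D).p2_injective hs
    rw [IsMorph.p2_twist, hχ, hχ', e₁, e₂, bdry_eq, bdry_eq, twist_eq]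
    simp only [map_mul]
    have f1 : d1 D .pre w₁ * d1 D .pre v₁ = 1 := by rw [← map_mul, c1', map_one]
    have f2 : d2 D .pre w₁ * d2 D .pre v₁ = 1 := by rw [← map_mul, c1', map_one]
    have f0 : d0 D .pre w₁ * d0 D .pre v₁ = 1 := by rw [← map_mul, c1', map_one]
    have g1 := (d0_d2_commute b1 v₂).eq
    have g2 := (d0_d2_commute a1 w₁).eq
    symm
    calc _ = d0 D .pre v₂ * (d0 D .pre w₁ * d2 D .pre v₂) * (d2 D .pre w₁ * d0 D .pre v₁)
          * d2 D .pre v₁ * (d1 D .pre w₁ * d1 D .pre v₁) * d1 D .pre w₂ := by simp only [mul_assoc]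
      _ = d0 D .pre v₂ * d2 D .pre v₂ * (d0 D .pre w₁ * d0 D .pre v₁)
          * (d2 D .pre w₁ * d2 D .pre v₁) * d1 D .pre w₂ := by
        rw [g1, ← g2, f1, mul_one]; simp only [mul_assoc]
      _ = _ := by rw [f0, f2, mul_one, mul_one]

omit hc in
-- Solving `∂v = F` for `∂¹w` gives `w(rs) = w(r₁) H(r₂ ⊗ s)` with `H = ∂⁰w * F`. As `F` comes from
-- `B`, it vanishes on generators of `K` in either variable. With `z` in the first variable this
-- gives `w(zs) = w(z) w(s)`; used in the second variable, it gives `H(r ⊗ zs) = w(z) H(r ⊗ s)`, and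
-- then `w(rzs) = w(z) w(rs)`.
theorem kchar_of_bdry {v w : Fn (XC D .pre)} (h : D.Inv1 .pre v w) (h1 : w.ev 1 = 1)
    {σ : Fn (X2 D .nichols)} (e : (isMorph_pi D).p2 σ = D.bdry .pre v w) :
    KChar w.ev w.ev := by
  obtain ⟨a, b, c1, c1'⟩ := inv1_iff.1 h
  let F : Fn (X2 D .pre) := (isMorph_pi D).p2 σ
  let H : Fn (X2 D .pre) := d0 D .pre w * F
  have hF : ∀ r s, F.ev (r ⊗ₜ s) = σ.ev (D.pi r ⊗ₜ D.pi s) := fun r s => rfl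
  have hH : ∀ r s, H.ev (r ⊗ₜ s) = sc w.ev (F.ev ∘ₗ TensorProduct.mk k D.R D.R r) s :=
    fun r s => d0_mul_apply b F r s
  have hd : d1 D .pre w = d2 D .pre w * H := by
    have f2 : d2 D .pre w * d2 D .pre v = 1 := by rw [← map_mul, c1', map_one]
    have f0 : d0 D .pre w * d0 D .pre v = 1 := by rw [← map_mul, c1', map_one]
    change _ = d2 D .pre w * (d0 D .pre w * (isMorph_pi D).p2 σ)
    rw [e, bdry_eq]
    simp only [← mul_assoc]
    rw [mul_assoc (d2 D .pre w), f0, mul_one, f2, one_mul]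
  have hw : ∀ r s, w.ev (r * s)
      = sc w.ev (H.ev ∘ₗ (TensorProduct.mk k D.R D.R).flip s) r := fun r s => by
    rw [← d1_apply, hd, d2_mul_apply]
  have hH1 : ∀ s, H.ev (1 ⊗ₜ s) = w.ev s := fun s => by
    have := hw 1 s
    rw [sc_one, h1, one_mul, one_smul] at this
    exact this.symm
  have hz : ∀ z ∈ D.gens, ∀ s, w.ev (z * s) = w.ev z * w.ev s := fun z hz s => by
    obtain ⟨g, hg⟩ := gens_comulOp hz
    have e1 : H.ev (z ⊗ₜ s) = 0 := by
      have e2 : F.ev ∘ₗ TensorProduct.mk k D.R D.R z = 0 := LinearMap.ext fun t => by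
        refine (hF z t).trans ?_
        rw [pi_gens hz]; simp
      rw [hH, e2, sc_zero]; rfl
    have e3 := bconv_mul_of_comulOp (LinearMap.lsmul k k) w.ev
      (H.ev ∘ₗ (TensorProduct.mk k D.R D.R).flip s) hg 1
    rw [hw]
    rw [mul_one, bconv_one, bconv_one] at e3
    refine e3.trans ?_
    simp only [LinearMap.comp_apply, LinearMap.mulLeft_apply, mul_one, LinearMap.flip_apply,
      TensorProduct.mk_apply, e1, map_zero, add_zero, hH1]
    rfl
  have hHz : ∀ z ∈ D.gens, ∀ r s, H.ev (r ⊗ₜ (z * s)) = w.ev z * H.ev (r ⊗ₜ s) :=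
      fun z hz' r s => by
    obtain ⟨g, hg⟩ := gens_comulOp hz'
    have e1 : (F.ev ∘ₗ TensorProduct.mk k D.R D.R r) ∘ₗ lm z = 0 := LinearMap.ext fun t => by
      refine (hF r (z * t)).trans ?_
      rw [map_mul, pi_gens hz']; simp
    have e2 : w.ev ∘ₗ lm z = w.ev z • w.ev := LinearMap.ext fun t => hz z hz' t
    rw [hH, hH, sc, bconv_mul_of_comulOp _ _ _ hg, e1, e2, bconv_zero_right, bconv_smul_left]
    simp
  intro z hz' r s
  have e1 : H.ev ∘ₗ (TensorProduct.mk k D.R D.R).flip (z * s)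
      = w.ev z • (H.ev ∘ₗ (TensorProduct.mk k D.R D.R).flip s) :=
    LinearMap.ext fun t => hHz z hz' t s
  rw [mul_assoc, hw, e1, sc_smul, LinearMap.smul_apply, ← hw]

end Boundary

/-! ### Linkable vertices -/

section Combinatorics

variable {k G ι : Type*} [Field k] [CommGroup G] {D : QLS k G ι}

theorem cartan_inv (D : QLS k G ι) {i j : ι} (h : i ≠ j) : D.χ i (D.g j) = (D.χ j (D.g i))⁻¹ :=
  eq_inv_of_mul_eq_one_left (D.cartan i j h)

theorem cartan_val (D : QLS k G ι) {i j : ι} (h : i ≠ j) :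
    (D.χ i (D.g j) : k) * (D.χ j (D.g i) : k) = 1 := by
  rw [← Units.val_mul, D.cartan i j h, Units.val_one]

theorem chi_pow_N (D : QLS k G ι) (i : ι) (h : G) : D.χ i h ^ D.N i = 1 := by
  simpa [N] using congrArg (fun f : G →* kˣ => f h) (D.chi_pow i)

theorem chi_pow_N' (D : QLS k G ι) {i j : ι} (h : i ≠ j) : D.χ i (D.g j) ^ D.N j = 1 := by
  rw [cartan_inv D h, inv_pow, chi_pow_N, inv_one]

theorem Linkable.symm {i j : ι} (h : D.Linkable i j) : D.Linkable j i :=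
  ⟨h.1.symm, (mul_comm (D.χ j) (D.χ i)).trans h.2⟩

theorem Linkable.chi {i j : ι} (h : D.Linkable i j) (g : G) : D.χ j g = (D.χ i g)⁻¹ := by
  refine eq_inv_of_mul_eq_one_right ?_
  simpa using congrArg (fun f : G →* kˣ => f g) h.2

theorem Linkable.chi_left {i j : ι} (h : D.Linkable i j) : D.χ i (D.g j) = D.χ i (D.g i) := by
  rw [cartan_inv D h.1, h.chi, inv_inv]

theorem Linkable.chi_right {i j : ι} (h : D.Linkable i j) :
    D.χ j (D.g i) = D.χ j (D.g j) := h.symm.chi_left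

/-- For linkable vertices `χⱼ(gⱼ) = χⱼ(gᵢ) = χᵢ(gᵢ)⁻¹`. -/
theorem Linkable.N_eq {i j : ι} (h : D.Linkable i j) : D.N i = D.N j := by
  unfold N
  rw [← h.chi_right, h.chi, orderOf_inv]

/-- A vertex is linkable to at most one other vertex. -/
theorem Linkable.unique {i j j' : ι} (h : D.Linkable i j) (h' : D.Linkable i j') : j = j' := by
  by_contra hne
  have e : ∀ g, D.χ j' g = D.χ j g := fun g => by rw [h.chi, h'.chi]
  have e1 : D.χ j (D.g j') = D.χ j (D.g j) := by
    rw [← e (D.g j'), ← h'.chi_right, e, h.chi_right]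
  have e2 := D.cartan j j' hne
  -- This yields `χⱼ(gⱼ)² = 1`, which is excluded by `Nⱼ > 2`.
  rw [e, e1, ← pow_two] at e2
  have := Nat.le_of_dvd two_pos (orderOf_dvd_of_pow_eq_one e2)
  have := D.two_lt_order j
  omega

end Combinatorics

/-! ### Commutation of the generators of `K` -/

section Central

variable {k G ι : Type*} [Field k] [CommGroup G] [LinearOrder ι] {D : QLS k G ι} {L : Layer}

theorem x_swap {i j : ι} (h : i ≠ j) (hl : ¬ D.Linkable i j) :
    D.x L j * D.x L i = (D.χ i (D.g j) : k) • (D.x L i * D.x L j) := by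
  rcases lt_or_gt_of_ne h with h1 | h1
  · exact sub_eq_zero.1 ((D.sat_x L).comm i j h1 hl)
  · have := sub_eq_zero.1 ((D.sat_x L).comm j i h1 fun h => hl h.symm)
    rw [this, smul_smul, cartan_val D h, one_smul]

theorem mul_pow_swap {A : Type*} [Ring A] [Algebra k A] {a b : A} {c : k}
    (h : b * a = c • (a * b)) (n : ℕ) : b * a ^ n = c ^ n • (a ^ n * b) := by
  induction n with
  | zero => simp
  | succ n ih =>
    rw [pow_succ, ← mul_assoc, ih, smul_mul_assoc, mul_assoc, h, mul_smul_comm, smul_smul,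
      ← pow_succ, mul_assoc]

/-- For linkable vertices this is a defining relation; for other distinct vertices, passing `xⱼ`
over `xᵢ ^ Nᵢ` costs the scalar `χᵢ(gⱼ) ^ Nᵢ = 1`. -/
theorem root_commute_x (i j : ι) : Commute (D.root (D.x L) i) (D.x L j) := by
  by_cases h : j = i
  · subst h; exact (Commute.refl _).pow_left _
  by_cases hl : D.Linkable j i
  · exact ((D.sat_x L).x_root j i hl).symm
  · have h1 := mul_pow_swap (x_swap (L := L) (Ne.symm h) fun h => hl h.symm) (D.N i)
    rw [← Units.val_pow_eq_pow_val, chi_pow_N, Units.val_one, one_smul] at h1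
    exact h1.symm

/-- By uniqueness of partners `l` is linkable neither to `i` nor to `j`, and passing `x_l` over both
costs `χᵢ(g_l) χⱼ(g_l) = 1`. -/
theorem link_commute_x {i j l : ι} (hl : D.Linkable i j) (hi : l ≠ i) (hj : l ≠ j) :
    Commute (D.link (D.x L) j i) (D.x L l) := by
  have h1 : D.x L l * D.x L i = _ := x_swap (L := L) hi.symm fun h => hj (h.unique hl)
  have h2 : D.x L l * D.x L j = _ := x_swap (L := L) hj.symm fun h => hi (h.unique hl.symm)
  have e : (D.χ j (D.g l) : k) * (D.χ i (D.g l) : k) = 1 := by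
    rw [← Units.val_mul, hl.chi]; simp
  have e' : (D.χ i (D.g l) : k) * (D.χ j (D.g l) : k) = 1 := by rw [mul_comm, e]
  refine Commute.symm ?_
  have h3 : D.x L l * (D.x L j * D.x L i) = D.x L j * D.x L i * D.x L l := by
    rw [← mul_assoc, h2, smul_mul_assoc, mul_assoc, h1, mul_smul_comm, smul_smul, e, one_smul,
      mul_assoc]
  have h4 : D.x L l * (D.x L i * D.x L j) = D.x L i * D.x L j * D.x L l := by
    rw [← mul_assoc, h1, smul_mul_assoc, mul_assoc, h2, mul_smul_comm, smul_smul, e', one_smul,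
      mul_assoc]
  unfold Commute SemiconjBy link
  rw [mul_sub, sub_mul, mul_smul_comm, smul_mul_assoc, h3, h4]

theorem commute_of_x {r : D.Alg L} (h : ∀ i, Commute r (D.x L i)) (s : D.Alg L) : Commute r s := by
  induction s using word_induction with
  | one => exact Commute.one_right r
  | add a b ha hb => exact ha.add_right hb
  | smul c a ha => exact ha.smul_right c
  | x_mul i a ha => exact (h i).mul_right ha

theorem root_central (i : ι) (s : D.Alg L) : Commute (D.root (D.x L) i) s :=
  commute_of_x (root_commute_x i) s

/-- The `zᵢ` are central. Two links `zⱼᵢ` involve the same pair or disjoint pairs of vertices, since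
a vertex has at most one partner. -/
theorem gens_commute {a b : D.R} (ha : a ∈ D.gens) (hb : b ∈ D.gens) : a * b = b * a := by
  rcases ha with ⟨i, rfl⟩ | ⟨i, j, h1, h2, rfl⟩
  · exact root_central i b
  rcases hb with ⟨i', rfl⟩ | ⟨i', j', h1', h2', rfl⟩
  · exact (root_central i' _).symm
  by_cases h : i' = i
  · subst h
    rw [h2.unique h2']
  have hj : i' ≠ j := fun e => by
    subst e
    have := h2'.unique h2.symm
    subst this
    exact lt_asymm h1 h1'
  have hj' : j' ≠ j := fun e => by subst e; exact h (h2'.symm.unique h2.symm)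
  have hi' : j' ≠ i := fun e => by subst e; exact hj (h2'.symm.unique h2)
  have c1 := link_commute_x (L := .pre) h2 h hj
  have c2 := link_commute_x (L := .pre) h2 hi' hj'
  exact (c2.mul_right c1).sub_right ((c1.mul_right c2).smul_right _)

@[simp]
theorem incl_x (L : Layer) (S : Finset ι) (i : S) :
    D.incl L S ((D.restrict S).x L i) = D.x L i := by simp [incl]

/-- `K` is commutative. -/
abbrev commRingK (D : QLS k G ι) : CommRing D.K :=
  { (inferInstance : Ring D.K) with
    mul_comm := (Algebra.isMulCommutative_adjoin k fun _ ha _ hb => gens_commute ha hb).is_comm.comm }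

end Central

/-! ### Weighted shift operators -/

section Shift

variable {A V : Type*} [CommRing A] [AddCommGroup V]

/-- The weighted shift `φ ↦ (a ↦ c(a) φ(a - s))`. -/
def shift (c : V → A) (s : V) : Module.End A (V → A) where
  toFun φ a := c a * φ (a - s)
  map_add' φ ψ := by ext a; simp [mul_add]
  map_smul' r φ := by ext a; simp [mul_left_comm]

theorem shift_apply (c : V → A) (s : V) (φ : V → A) (a : V) : shift c s φ a = c a * φ (a - s) := rfl

theorem shift_mul (c d : V → A) (s t : V) :
    shift c s * shift d t = shift (fun a => c a * d (a - s)) (s + t) := by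
  ext φ a; simp [shift_apply, mul_assoc, sub_sub]

theorem shift_pow (c : V → A) (s : V) (n : ℕ) :
    shift c s ^ n = shift (fun a => ∏ j ∈ Finset.range n, c (a - j • s)) (n • s) := by
  induction n with
  | zero => ext φ a; simp [shift_apply]
  | succ n ih =>
    rw [pow_succ, ih, shift_mul, succ_nsmul]
    simp only [Finset.prod_range_succ]

theorem shift_swap {k : Type*} [Field k] [Algebra k A] {c d : V → A} {s t : V} {r : k}
    (h : ∀ a, c a * d (a - s) = r • (d a * c (a - t))) :
    shift c s * shift d t = r • (shift d t * shift c s) := by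
  rw [shift_mul, shift_mul, add_comm t s]
  ext φ a
  simp [shift_apply, h]

theorem shift_single [DecidableEq V] (c : V → A) (s b : V) (x : A) :
    shift c s (Pi.single b x) = Pi.single (b + s) (c (b + s) * x) := by
  ext a
  rw [shift_apply]
  by_cases h : a = b + s
  · subst h; simp
  · rw [Pi.single_eq_of_ne h, Pi.single_eq_of_ne (fun e => h (by rw [← e]; simp)), mul_zero]

end Shift

/-! ### The model on functions of exponents -/

section Model

set_option linter.unusedSectionVars false

variable {k G ι : Type*} [Field k] [CommGroup G] [Fintype ι] [LinearOrder ι] (D : QLS k G ι)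

instance (i : ι) : NeZero (D.N i) := ⟨(D.N_pos i).ne'⟩

/-- The exponents of the ordered monomials. -/
abbrev Exps : Type _ := ∀ i, ZMod (D.N i)

theorem pow_val_add {n : ℕ} [NeZero n] {M : Type*} [Monoid M] {u : M} (h : u ^ n = 1)
    (a b : ZMod n) : u ^ (a + b).val = u ^ a.val * u ^ b.val := by
  rw [ZMod.val_add, ← pow_add, ← pow_mod_orderOf, Nat.mod_mod_of_dvd _ (orderOf_dvd_of_pow_eq_one h),
    pow_mod_orderOf]

/-- The scalar with `x_l x^a = c_l(a) x^a x_l`, where only the `xᵢ` with `i < l` are moved. -/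
def wt (l : ι) (a : D.Exps) : kˣ := ∏ i with i < l, D.χ i (D.g l) ^ (a i).val

/-- The exponent of `x_l`. -/
abbrev unit (l : ι) : D.Exps := Pi.single l 1

theorem wt_add (l : ι) (a b : D.Exps) : D.wt l (a + b) = D.wt l a * D.wt l b := by
  rw [wt, wt, wt, ← Finset.prod_mul_distrib]
  exact Finset.prod_congr rfl fun i _ => pow_val_add (chi_pow_N D i _) _ _

theorem wt_zero (l : ι) : D.wt l 0 = 1 := by simp [wt]

theorem wt_sub (l : ι) (a b : D.Exps) : D.wt l (a - b) = D.wt l a * (D.wt l b)⁻¹ := by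
  rw [eq_mul_inv_iff_mul_eq, ← wt_add, sub_add_cancel]

theorem wt_neg (l : ι) (a : D.Exps) : D.wt l (-a) = (D.wt l a)⁻¹ := by
  rw [← zero_sub, wt_sub, wt_zero, one_mul]

theorem wt_unit (l i : ι) : D.wt l (D.unit i) = if i < l then D.χ i (D.g l) else 1 := by
  have : Fact (1 < D.N i) := ⟨by have := D.two_lt_order i; unfold N; omega⟩
  unfold wt
  split_ifs with h
  · rw [Finset.prod_eq_single i]
    · simp [unit, ZMod.val_one]
    · intro j _ hj; simp [unit, Pi.single_eq_of_ne hj]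
    · intro hi; simp [h] at hi
  · refine Finset.prod_eq_one fun j hj => ?_
    rw [Finset.mem_filter] at hj
    have : j ≠ i := fun e => h (e ▸ hj.2)
    simp [unit, Pi.single_eq_of_ne this]

theorem wt_unit_self (l : ι) : D.wt l (D.unit l) = 1 := by simp [wt_unit]

/-- Exactly one of `xᵢ` and `xⱼ` has to pass the other, and the two cases agree by `χᵢ(gⱼ) χⱼ(gᵢ) =
1`. -/
theorem wt_unit_mul {i j : ι} (h : i ≠ j) :
    D.wt j (D.unit i) = D.χ i (D.g j) * D.wt i (D.unit j) := by
  rw [wt_unit, wt_unit]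
  rcases lt_or_gt_of_ne h with h1 | h1
  · simp [h1, h1.not_gt]
  · simp [h1, h1.not_gt, D.cartan i j h]

theorem wt_pow_N (l : ι) (a : D.Exps) : D.wt l a ^ D.N l = 1 := by
  rw [wt, ← Finset.prod_pow]
  refine Finset.prod_eq_one fun i hi => ?_
  rw [Finset.mem_filter] at hi
  rw [← pow_mul, mul_comm, pow_mul, chi_pow_N' D hi.2.ne, one_pow]

theorem wt_eq_one {l : ι} {a : D.Exps} (h : ∀ i < l, a i = 0) : D.wt l a = 1 :=
  Finset.prod_eq_one fun i hi => by
    rw [Finset.mem_filter] at hi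
    rw [h i hi.2]; simp

/-- The `q`-number `[n]`, for `q = χ_p(g_p)`. -/
def qnum (p : ι) (n : ZMod (D.N p)) : k :=
  (((D.χ p (D.g p) ^ n.val : kˣ) : k) - 1) / ((D.χ p (D.g p) : k) - 1)

theorem qq_ne_one (p : ι) : (D.χ p (D.g p) : k) - 1 ≠ 0 := fun h => by
  have h1 : D.χ p (D.g p) = 1 := Units.ext (by simpa [sub_eq_zero] using h)
  have := D.two_lt_order p
  rw [h1, orderOf_one] at this
  omega

@[simp]
theorem qnum_zero (p : ι) : D.qnum p 0 = 0 := by simp [qnum]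

theorem qnum_add_one (p : ι) (n : ZMod (D.N p)) :
    D.qnum p (n + 1) = (D.χ p (D.g p) : k) * D.qnum p n + 1 := by
  have : Fact (1 < D.N p) := ⟨by have := D.two_lt_order p; unfold N; omega⟩
  have h := D.qq_ne_one p
  unfold qnum
  rw [pow_val_add (chi_pow_N D p _), ZMod.val_one]
  push_cast
  field_simp
  ring

variable {A : Type*} [CommRing A] [Algebra k A] (lam ze : ι → A)

/-- Multiplication by `x_l`, in the case of `z_{ji} = 0` and `z_l = λ_l`. -/
def raise (l : ι) : Module.End A (D.Exps → A) :=
  -- Here `a` is the new exponent. It vanishes at `l` exactly when the old one was `N_l - 1`, and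
  -- then the power `x_l ^ N_l` is replaced by `λ_l`.
  shift (fun a => algebraMap k A (D.wt l a) * (if a l = 0 then lam l else 1)) (D.unit l)

/-- The skew derivation with respect to `x_p`. -/
def lower (p : ι) : Module.End A (D.Exps → A) :=
  -- The old exponent at `p` is `a p + 1`. If it is zero, the `q`-number vanishes, so lowering never
  -- wraps around.
  shift (fun a => algebraMap k A ((D.wt p a)⁻¹ * D.qnum p (a p + 1))) (- D.unit p)

theorem raise_swap {i j : ι} (h : i ≠ j) : D.raise lam j * D.raise lam i
    = (D.χ i (D.g j) : k) • (D.raise lam i * D.raise lam j) := by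
  refine shift_swap fun a => ?_
  have e1 : (a - D.unit j) i = a i := by simp [unit, h]
  have e2 : (a - D.unit i) j = a j := by simp [unit, h.symm]
  have e3 : (D.wt i (D.unit j))⁻¹ = D.χ i (D.g j) * (D.wt j (D.unit i))⁻¹ := by
    rw [D.wt_unit_mul h]; simp
  rw [e1, e2, wt_sub, wt_sub, e3, Algebra.smul_def]
  simp only [Units.val_mul, map_mul]
  ring

theorem raise_lower {j p : ι} (h : j ≠ p) : D.raise lam j * D.lower p
    = (D.χ j (D.g p) : k) • (D.lower p * D.raise lam j) := by
  refine shift_swap fun a => ?_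
  have e1 : (a - D.unit j) p = a p := by simp [unit, h.symm]
  have e2 : (a - -D.unit p) j = a j := by simp [unit, h]
  rw [e1, e2, wt_sub, wt_sub, wt_neg, inv_inv, mul_inv, inv_inv, D.wt_unit_mul h, Algebra.smul_def]
  simp only [Units.val_mul, map_mul]
  ring

theorem lower_raise_of_ne {j p : ι} (h : j ≠ p) : D.lower p * D.raise lam j
    = (D.χ p (D.g j) : k) • (D.raise lam j * D.lower p) := by
  rw [raise_lower _ _ h, smul_smul, cartan_val D h.symm, one_smul]

theorem lower_swap {p r : ι} (h : r ≠ p) : (D.lower p * D.lower r : Module.End A (D.Exps → A))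
    = (D.χ r (D.g p) : k) • (D.lower r * D.lower p) := by
  refine shift_swap fun a => ?_
  have e1 : (a - -D.unit p) r = a r := by simp [unit, h]
  have e2 : (a - -D.unit r) p = a p := by simp [unit, h.symm]
  have e3 : (D.wt r (D.unit p))⁻¹ = D.χ r (D.g p) * (D.wt p (D.unit r))⁻¹ := by
    rw [D.wt_unit_mul h]; simp
  rw [e1, e2, wt_sub, wt_sub, wt_neg, wt_neg, inv_inv, inv_inv, mul_inv, mul_inv, e3,
    Algebra.smul_def]
  simp only [Units.val_mul, map_mul]
  ring

/-- This is the `q`-Weyl relation, that is, `[n + 1] = q [n] + 1`. At the places where raising wraps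
around, `λ_p` is multiplied by `[0] = 0`, so the relation holds for every value of `λ_p`. -/
theorem lower_raise (p : ι) : D.lower p * D.raise lam p
    = (D.χ p (D.g p) : k) • (D.raise lam p * D.lower p) + 1 := by
  refine LinearMap.ext fun φ => funext fun a => ?_
  have e1 : (a - -D.unit p) p = a p + 1 := by simp [unit]
  have e2 : (a - D.unit p) p + 1 = a p := by simp [unit]
  have e3 : a - -D.unit p - D.unit p = a := by abel
  have e4 : a - D.unit p - -D.unit p = a := by abel
  have e5 : algebraMap k A (D.qnum p (a p + 1)) * (if a p + 1 = 0 then lam p else 1)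
      = algebraMap k A (D.qnum p (a p + 1)) := by
    split_ifs with h
    · simp [h]
    · rw [mul_one]
  have e6 : (if a p = 0 then lam p else 1) * algebraMap k A (D.qnum p (a p))
      = algebraMap k A (D.qnum p (a p)) := by
    split_ifs with h
    · simp [h]
    · rw [one_mul]
  have e7 : algebraMap k A (D.wt p a)⁻¹ * algebraMap k A (D.wt p a) = 1 := by
    rw [← map_mul]; simp
  have e8 := congrArg (algebraMap k A) (D.qnum_add_one p (a p))
  rw [map_add, map_mul, map_one] at e8
  simp only [Module.End.mul_apply, LinearMap.add_apply, LinearMap.smul_apply, Pi.add_apply,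
    Pi.smul_apply, Module.End.one_apply, raise, lower, shift_apply, e1, e2, e3, e4, wt_sub, wt_neg,
    wt_unit_self, inv_one, mul_one, map_mul, Units.val_inv_eq_inv_val] at e7 ⊢
  rw [Algebra.smul_def]
  linear_combination (φ a) * (algebraMap k A (D.wt p a)⁻¹ * algebraMap k A (D.wt p a)) * (e5 + e8)
    - φ a * algebraMap k A (D.χ p (D.g p)) *
      (algebraMap k A (D.wt p a)⁻¹ * algebraMap k A (D.wt p a)) * e6 + φ a * e7

theorem N_nsmul_unit (l : ι) : D.N l • D.unit l = 0 := by
  rw [unit, ← Pi.single_smul]; simp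

theorem nsmul_unit_apply (l : ι) (j : ℕ) : (j • D.unit l) l = (j : ZMod (D.N l)) := by
  simp [unit]

theorem wt_nsmul_unit (l : ι) (j : ℕ) : D.wt l (j • D.unit l) = 1 :=
  D.wt_eq_one fun i hi => by simp [unit, hi.ne]

/-- Among `N_l` consecutive shifts exactly one wraps around and contributes `λ_l`; the weights
multiply to an `N_l`-th power, which is `1`. -/
theorem raise_pow (l : ι) : D.raise lam l ^ D.N l = algebraMap A _ (lam l) := by
  rw [raise, shift_pow, N_nsmul_unit]
  refine LinearMap.ext fun φ => funext fun a => ?_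
  have e : ∏ j ∈ Finset.range (D.N l), (if (a - j • D.unit l) l = 0 then lam l else 1) = lam l := by
    rw [Finset.prod_eq_single (a l).val]
    · rw [Pi.sub_apply, nsmul_unit_apply]; simp
    · intro j hj hne
      rw [if_neg]
      rw [Pi.sub_apply, nsmul_unit_apply, sub_eq_zero]
      intro h
      rw [h, ZMod.val_natCast, Nat.mod_eq_of_lt (Finset.mem_range.1 hj)] at hne
      exact hne rfl
    · intro h; exact absurd (Finset.mem_range.2 (ZMod.val_lt _)) h
  rw [shift_apply, Finset.prod_mul_distrib, e]
  simp only [wt_sub, wt_nsmul_unit, inv_one, mul_one, Finset.prod_const, Finset.card_range,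
    ← map_pow, ← Units.val_pow_eq_pow_val, wt_pow_N]
  simp [Module.algebraMap_end_apply]

theorem lower_pow (p : ι) : (D.lower p : Module.End A (D.Exps → A)) ^ D.N p = 0 := by
  rw [lower, shift_pow]
  refine LinearMap.ext fun φ => funext fun a => ?_
  -- The chosen factor is the one for which the exponent before lowering is zero, so that its
  -- `q`-number is `[0]`.
  rw [shift_apply, Finset.prod_eq_zero (i := (-(a p + 1)).val)]
  · simp
  · exact Finset.mem_range.2 (ZMod.val_lt _)
  · have : (a - (-(a p + 1)).val • -D.unit p) p + 1 = 0 := by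
      rw [smul_neg, sub_neg_eq_add, Pi.add_apply, nsmul_unit_apply]; simp
    rw [this]; simp

open Classical in
/-- The skew derivation with respect to the vertex below `l` that is linkable to `l`, if any. -/
def lowerOf (l : ι) : Module.End A (D.Exps → A) :=
  if h : ∃ p < l, D.Linkable p l then D.lower h.choose else 0

theorem lowerOf_eq {p l : ι} (h : p < l) (hl : D.Linkable p l) :
    (D.lowerOf l : Module.End A (D.Exps → A)) = D.lower p := by
  have h1 : ∃ p < l, D.Linkable p l := ⟨p, h, hl⟩
  rw [lowerOf, dif_pos h1, h1.choose_spec.2.symm.unique hl.symm]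

theorem lowerOf_cases (l : ι) :
    (∃ p < l, D.Linkable p l ∧ (D.lowerOf l : Module.End A (D.Exps → A)) = D.lower p) ∨
      (D.lowerOf l : Module.End A (D.Exps → A)) = 0 := by
  by_cases h : ∃ p < l, D.Linkable p l
  · obtain ⟨p, h1, h2⟩ := h
    exact Or.inl ⟨p, h1, h2, D.lowerOf_eq h1 h2⟩
  · exact Or.inr (dif_neg h)

theorem lowerOf_eq_zero {p l : ι} (h : p < l) (hl : D.Linkable p l) :
    (D.lowerOf p : Module.End A (D.Exps → A)) = 0 := by
  refine dif_neg ?_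
  rintro ⟨q, h1, h2⟩
  have := h2.symm.unique hl
  subst this
  exact lt_asymm h1 h

/-- The generators of `R`, acting on the functions of the exponents, such that `z_l` and `z_{lp}`
act as the scalars `λ_l` and `ζ_l`. -/
def gen (l : ι) : Module.End A (D.Exps → A) := D.raise lam l + ze l • D.lowerOf l

/-- The vertex `p` has no partner below itself, so only `x_l` carries a derivation. The raising
parts cancel, and the `q`-Weyl relation leaves `ζ_l`. -/
theorem gen_link {p l : ι} (h : p < l) (hl : D.Linkable p l) :
    D.link (D.gen lam ze) l p = algebraMap A _ (ze l) := by
  rw [link, gen, gen, D.lowerOf_eq h hl, D.lowerOf_eq_zero h hl, smul_zero, add_zero, add_mul,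
    mul_add, D.raise_swap lam hl.1, smul_mul_assoc, D.lower_raise, hl.chi_left, mul_smul_comm,
    smul_add, smul_add, smul_comm (ze l), Algebra.algebraMap_eq_smul_one]
  abel

/-- The skew derivation added to `xᵢ` belongs to a vertex with character `χᵢ⁻¹`. It therefore has
the same commutation factors as `xᵢ`, and all four products commute with the same scalar. -/
theorem gen_comm {i j : ι} (h : i ≠ j) (hl : ¬ D.Linkable i j) :
    D.link (D.gen lam ze) j i = 0 := by
  have h1 : D.raise lam j * D.lowerOf i = (D.χ i (D.g j) : k) • (D.lowerOf i * D.raise lam j) := by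
    rcases D.lowerOf_cases (A := A) i with ⟨p, h1, h2, h3⟩ | h3
    · have hp : j ≠ p := fun e => hl (e ▸ h2.symm)
      rw [h3, raise_lower _ _ hp, h2.chi, cartan_inv D hp]
    · simp [h3]
  have h2 : D.lowerOf j * D.raise lam i = (D.χ i (D.g j) : k) • (D.raise lam i * D.lowerOf j) := by
    rcases D.lowerOf_cases (A := A) j with ⟨p, h1, h2, h3⟩ | h3
    · have hp : i ≠ p := fun e => hl (e ▸ h2)
      rw [h3, lower_raise_of_ne _ _ hp, cartan_inv D h, h2.chi, inv_inv]
    · simp [h3]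
  have h3 : (D.lowerOf j * D.lowerOf i : Module.End A (D.Exps → A))
      = (D.χ i (D.g j) : k) • (D.lowerOf i * D.lowerOf j) := by
    rcases D.lowerOf_cases (A := A) i with ⟨p, h1, h2, h3⟩ | h3
    · rcases D.lowerOf_cases (A := A) j with ⟨r, h1', h2', h3'⟩ | h3'
      · have hp : p ≠ r := fun e => by subst e; exact h (h2.unique h2')
        have hi : i ≠ r := fun e => hl (e ▸ h2')
        rw [h3, h3', D.lower_swap hp, h2.symm.chi, cartan_inv D h, h2'.chi, inv_inv,
          cartan_inv D hi.symm]
      · simp [h3']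
    · simp [h3]
  have h1' : D.raise lam j * (ze i • D.lowerOf i)
      = (D.χ i (D.g j) : k) • ((ze i • D.lowerOf i) * D.raise lam j) := by
    rw [mul_smul_comm, h1, smul_mul_assoc, smul_comm]
  have h2' : (ze j • D.lowerOf j) * D.raise lam i
      = (D.χ i (D.g j) : k) • (D.raise lam i * (ze j • D.lowerOf j)) := by
    rw [mul_smul_comm, smul_mul_assoc, h2, smul_comm]
  have h3' : ((ze j • D.lowerOf j) * (ze i • D.lowerOf i) : Module.End A (D.Exps → A))
      = (D.χ i (D.g j) : k) • ((ze i • D.lowerOf i) * (ze j • D.lowerOf j)) := by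
    rw [smul_mul_assoc, mul_smul_comm, h3, smul_mul_assoc, mul_smul_comm,
      smul_comm (ze i) (D.χ i (D.g j) : k), smul_comm (ze j) (D.χ i (D.g j) : k),
      smul_comm (ze j) (ze i)]
  rw [link, gen, gen, sub_eq_zero, add_mul, mul_add, mul_add, add_mul, mul_add, mul_add,
    D.raise_swap lam h, h1', h2', h3', smul_add, smul_add, smul_add]
  abel

/-- The two summands of `gen` commute up to `χ_l(g_l)`, a root of unity of order `N_l`, so the
`q`-binomial formula keeps only their `N_l`-th powers. That of the derivation vanishes because
linkable vertices have equal orders. -/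
theorem gen_root (l : ι) : D.root (D.gen lam ze) l = algebraMap A _ (lam l) := by
  rw [root, gen]
  rcases D.lowerOf_cases (A := A) l with ⟨p, h1, h2, h3⟩ | h3
  · rw [h3, add_comm, N, add_pow_order (D.χ l (D.g l))]
    · change (ze l • D.lower p) ^ D.N l + D.raise lam l ^ D.N l = _
      rw [raise_pow, smul_pow, ← h2.N_eq, lower_pow, smul_zero, zero_add]
    · rw [mul_smul_comm, smul_mul_assoc, raise_lower _ _ h2.1.symm, h2.chi_right, smul_comm]
    · exact D.N_pos l
  · rw [h3, smul_zero, add_zero, raise_pow]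

theorem sat_gen (L : Layer) (hlam : L = .nichols → lam = 0) (hze : L = .nichols → ze = 0) :
    D.Sat L (D.gen lam ze) where
  comm i j h hl := D.gen_comm lam ze h.ne hl
  x_root i j _ := by rw [gen_root]; exact (Algebra.commutes _ _).symm
  root_link_left i j _ _ := by rw [gen_root]; exact Algebra.commutes _ _
  root_link_right i j _ _ := by rw [gen_root]; exact Algebra.commutes _ _
  root_zero hL i := by rw [gen_root, hlam hL, Pi.zero_apply, map_zero]
  link_zero hL i j h hl := by rw [gen_link _ _ _ h hl, hze hL, Pi.zero_apply, map_zero]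

/-- The basis vector corresponding to the monomial `x^a`. -/
abbrev vec (a : D.Exps) : D.Exps → A := Pi.single a 1

/-- As all exponents below `l` are zero, the weight is `1` and the derivation with respect to a
vertex below `l` finds nothing to lower. This is the situation when an ordered monomial is applied
from right to left. -/
theorem gen_vec {l : ι} {b : D.Exps} (h : ∀ i < l, b i = 0) (hl : b l + 1 ≠ 0) :
    D.gen lam ze l (D.vec b) = D.vec (b + D.unit l) := by
  have e1 : D.lowerOf l (D.vec b : D.Exps → A) = 0 := by
    rcases D.lowerOf_cases (A := A) l with ⟨p, h1, h2, h3⟩ | h3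
    · rw [h3, lower, shift_single]
      simp [unit, h p h1]
    · simp [h3]
  have e2 : D.wt l (b + D.unit l) = 1 := by rw [wt_add, wt_unit_self, wt_eq_one _ h, one_mul]
  have e3 : (b + D.unit l) l = b l + 1 := by simp [unit]
  rw [gen, LinearMap.add_apply, LinearMap.smul_apply, e1, smul_zero, add_zero, raise, shift_single,
    e2, e3, if_neg hl]
  simp

theorem gen_pow_vec {l : ι} {b : D.Exps} (h : ∀ i ≤ l, b i = 0) {n : ℕ} (hn : n < D.N l) :
    (D.gen lam ze l ^ n) (D.vec b) = D.vec (b + n • D.unit l) := by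
  induction n with
  | zero => simp
  | succ n ih =>
    rw [pow_succ', Module.End.mul_apply, ih (by omega), gen_vec, succ_nsmul, add_assoc]
    · intro i hi; simp [unit, hi.ne, h i hi.le]
    · rw [Pi.add_apply, h l le_rfl, zero_add, nsmul_unit_apply, ← Nat.cast_succ]
      intro e
      rw [ZMod.natCast_eq_zero_iff] at e
      exact absurd (Nat.le_of_dvd (by omega) e) (by omega)

theorem prod_gen_vec {a : ι → ℕ} (ha : ∀ i, a i < D.N i) {t : List ι} (ht : t.Pairwise (· < ·)) :
    (t.map fun i => D.gen lam ze i ^ a i).prod (D.vec 0)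
      = D.vec (fun i => if i ∈ t then (a i : ZMod (D.N i)) else 0) := by
  induction t with
  | nil => simp; rfl
  | cons l t ih =>
    rw [List.pairwise_cons] at ht
    rw [List.map_cons, List.prod_cons, Module.End.mul_apply, ih ht.2, gen_pow_vec]
    · congr 1
      ext i
      by_cases hi : i = l
      · subst hi
        rw [Pi.add_apply, nsmul_unit_apply, if_neg fun h => lt_irrefl _ (ht.1 _ h)]
        simp
      · simp [unit, hi]
    · intro i hi
      rw [if_neg fun h => (ht.1 _ h).not_ge hi]
    · exact ha l

/-- The representation of `R` or `B` on the functions of the exponents. -/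
def rep (L : Layer) (hlam : L = .nichols → lam = 0) (hze : L = .nichols → ze = 0) :
    D.Alg L →ₐ[k] Module.End A (D.Exps → A) :=
  D.lift L (D.gen lam ze) (D.sat_gen lam ze L hlam hze)

section

variable {L : Layer} (hlam : L = .nichols → lam = 0) (hze : L = .nichols → ze = 0)

theorem rep_x (i : ι) : D.rep lam ze L hlam hze (D.x L i) = D.gen lam ze i := by simp [rep]

theorem rep_mono {a : ι → ℕ} (ha : ∀ i, a i < D.N i) :
    D.rep lam ze L hlam hze ((Finset.univ.sort (· ≤ ·)).map fun i => D.x L i ^ a i).prod (D.vec 0)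
      = D.vec (fun i => (a i : ZMod (D.N i))) := by
  rw [map_list_prod, List.map_map]
  simp only [Function.comp_def, map_pow, rep_x]
  rw [prod_gen_vec _ _ _ ha (Finset.sortedLT_sort _).pairwise]
  simp

theorem rep_root (i : ι) :
    D.rep lam ze L hlam hze (D.root (D.x L) i) = algebraMap A _ (lam i) := by
  rw [map_root]; simp only [rep_x]; exact D.gen_root lam ze i

theorem rep_link {i j : ι} (h : i < j) (hl : D.Linkable i j) :
    D.rep lam ze L hlam hze (D.link (D.x L) j i) = algebraMap A _ (ze j) := by
  rw [map_link]; simp only [rep_x]; exact D.gen_link lam ze h hl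

end

end Model

/-! ### The ideal `J` -/

section Ideal

variable {k G ι : Type*} [Field k] [CommGroup G] [LinearOrder ι] {D : QLS k G ι}

/-- The bracket with `z` is a derivation in `r`, and `J` contains its values at the letters; for the
central `zᵢ` it vanishes. -/
theorem bracket_mem_J {z : D.R} (hz : z ∈ D.gens) (r : D.R) : r * z - z * r ∈ D.J := by
  rcases hz with ⟨i, rfl⟩ | ⟨i, j, h1, h2, rfl⟩
  · rw [(root_central i r).eq, sub_self]
    exact zero_mem _
  · induction r using word_induction with
    | one => rw [one_mul, mul_one, sub_self]; exact zero_mem _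
    | add a b ha hb =>
      rw [add_mul, mul_add, add_sub_add_comm]; exact add_mem ha hb
    | smul c a ha =>
      rw [smul_mul_assoc, mul_smul_comm, ← smul_sub, ← one_mul (_ - _), ← smul_mul_assoc]
      exact D.J.mul_mem_left _ _ ha
    | x_mul l a ha =>
      have h : D.x .pre l * D.link (D.x .pre) j i - D.link (D.x .pre) j i * D.x .pre l ∈ D.J :=
        TwoSidedIdeal.subset_span ⟨i, j, l, h1, h2, rfl⟩
      have := add_mem (D.J.mul_mem_left (D.x .pre l) _ ha) (D.J.mul_mem_right _ a h)
      convert! this using 1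
      noncomm_ring

theorem eq_zero_of_mem_J {M : Type*} [AddCommGroup M] [Module k M] {θ : D.R →ₗ[k] M}
    (h : ∀ z ∈ D.gens, ∀ a b r, θ (a * (r * z - z * r) * b) = 0) {w : D.R} (hw : w ∈ D.J) :
    θ w = 0 := by
  suffices H : ∀ a b, θ (a * w * b) = 0 by simpa using H 1 1
  induction hw using TwoSidedIdeal.span_induction with
  | mem w hw =>
    obtain ⟨i, j, l, h1, h2, rfl⟩ := hw
    exact fun a b => h _ (Or.inr ⟨i, j, h1, h2, rfl⟩) a b _
  | zero => simp
  | add x y _ _ hx hy => intro a b; rw [mul_add, add_mul, map_add, hx, hy, add_zero]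
  | neg x _ hx => intro a b; rw [mul_neg, neg_mul, map_neg, hx, neg_zero]
  | left_absorb a x _ hx => intro a' b; rw [← mul_assoc]; exact hx _ _
  | right_absorb b x _ hx =>
    intro a b'; rw [← mul_assoc a, mul_assoc _ b]; exact hx _ _

theorem KChar.J {M : Type*} [AddCommGroup M] [Module k M] {c : D.R → k} {θ : D.R →ₗ[k] M}
    (h : KChar c θ) {w : D.R} (hw : w ∈ D.J) : θ w = 0 := by
  refine eq_zero_of_mem_J (fun z hz a b r => ?_) hw
  have h1 := h z hz (a * r) b
  have h2 := h z hz a (r * b)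
  rw [show a * (r * z - z * r) * b = a * r * z * b - a * z * (r * b) by noncomm_ring, map_sub, h1,
    h2, mul_assoc a r b, sub_self]

theorem KChar.mul_K {M : Type*} [AddCommGroup M] [Module k M] {c : D.R → k} {θ : D.R →ₗ[k] M}
    (h : KChar c θ) {y : D.R} (hy : y ∈ D.K) : ∃ s : k, ∀ r, θ (r * y) = s • θ r := by
  induction hy using Algebra.adjoin_induction with
  | mem z hz => exact ⟨c z, fun r => by simpa using h z hz r 1⟩
  | algebraMap s => exact ⟨s, fun r => by rw [← Algebra.commutes, ← Algebra.smul_def, map_smul]⟩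
  | add a b _ _ ha hb =>
    obtain ⟨s, hs⟩ := ha
    obtain ⟨t, ht⟩ := hb
    exact ⟨s + t, fun r => by rw [mul_add, map_add, hs, ht, add_smul]⟩
  | mul a b _ _ ha hb =>
    obtain ⟨s, hs⟩ := ha
    obtain ⟨t, ht⟩ := hb
    exact ⟨t * s, fun r => by rw [← mul_assoc, ht, hs, smul_smul]⟩

end Ideal

/-! ### Spanning by reduced monomials -/

section Spanning

variable {k G ι : Type*} [Field k] [CommGroup G] [LinearOrder ι] {D : QLS k G ι}
variable {Q : Type*} [Ring Q] [Algebra k Q] (p : D.R →ₐ[k] Q)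

/-- The span of the products of an ordered monomial in the `xᵢ`, `i ∈ t`, and an element of `K`. -/
def monoSpan : List ι → Submodule k Q
  | [] => Subalgebra.toSubmodule (D.K.map p)
  | i :: t => ⨆ n : ℕ, (monoSpan t).map (LinearMap.mulLeft k (p (D.x .pre i) ^ n))

theorem pow_mul_mem {i : ι} {t : List ι} (n : ℕ) {m : Q} (hm : m ∈ monoSpan p t) :
    p (D.x .pre i) ^ n * m ∈ monoSpan p (i :: t) :=
  Submodule.mem_iSup_of_mem n ⟨m, hm, rfl⟩

theorem monoSpan_le {i : ι} {t : List ι} {P : Submodule k Q} {f : Q →ₗ[k] Q}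
    (h : ∀ n, ∀ m ∈ monoSpan p t, f (p (D.x .pre i) ^ n * m) ∈ P) {m : Q}
    (hm : m ∈ monoSpan p (i :: t)) : f m ∈ P := by
  have : monoSpan p (i :: t) ≤ P.comap f := iSup_le fun n => by
    rintro _ ⟨m, hm, rfl⟩
    exact h n m hm
  exact this hm

variable {p} (hp : ∀ z ∈ D.gens, ∀ r, Commute (p z) (p r))
include hp

theorem K_commute {y : D.R} (hy : y ∈ D.K) (r : D.R) : Commute (p y) (p r) := by
  induction hy using Algebra.adjoin_induction with
  | mem z hz => exact hp z hz r
  | algebraMap s => rw [AlgHom.commutes]; exact Algebra.commutes _ _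
  | add a b _ _ ha hb => rw [map_add]; exact ha.add_left hb
  | mul a b _ _ ha hb => rw [map_mul]; exact ha.mul_left hb

theorem K_mul_mem {y : D.R} (hy : y ∈ D.K) {t : List ι} {m : Q} (hm : m ∈ monoSpan p t) :
    p y * m ∈ monoSpan p t := by
  induction t generalizing m with
  | nil => exact (D.K.map p).mul_mem ⟨y, hy, rfl⟩ hm
  | cons i t ih =>
    refine monoSpan_le p (f := LinearMap.mulLeft k (p y)) (fun n m hm => ?_) hm
    have := (K_commute hp hy (D.x .pre i ^ n)).eq
    rw [map_pow] at this
    rw [LinearMap.mulLeft_apply, ← mul_assoc, this, mul_assoc]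
    exact pow_mul_mem p n (ih hm)

/-- By induction on the power `n`, the letter `x_l` is moved past the smaller `xᵢ`. The braided
commutator of the two lies in `K`, is central in `Q`, and is absorbed by the factor from `K`. -/
theorem x_mul_mem {l : ι} {t : List ι} (ht : t.Pairwise (· < ·)) (hl : l ∈ t) {m : Q}
    (hm : m ∈ monoSpan p t) : p (D.x .pre l) * m ∈ monoSpan p t := by
  induction t generalizing m with
  | nil => simp at hl
  | cons i t ih =>
    rw [List.pairwise_cons] at ht
    have hi : ∀ m ∈ monoSpan p (i :: t), p (D.x .pre i) * m ∈ monoSpan p (i :: t) := fun m hm =>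
      monoSpan_le p (f := LinearMap.mulLeft k (p (D.x .pre i))) (fun n m hm => by
        rw [LinearMap.mulLeft_apply, ← mul_assoc, ← pow_succ']
        exact pow_mul_mem p _ hm) hm
    rcases List.mem_cons.1 hl with rfl | hl
    · exact hi m hm
    refine monoSpan_le p (f := LinearMap.mulLeft k (p (D.x .pre l))) (fun n m hm => ?_) hm
    rw [LinearMap.mulLeft_apply]
    induction n with
    | zero =>
      rw [pow_zero, one_mul]
      simpa using pow_mul_mem p (i := i) 0 (ih ht.2 hl hm)
    | succ n ihn =>
      have hz : D.link (D.x .pre) l i ∈ D.K := by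
        by_cases h : D.Linkable i l
        · exact Algebra.subset_adjoin (Or.inr ⟨i, l, ht.1 l hl, h, rfl⟩)
        · rw [(D.sat_x .pre).comm i l (ht.1 l hl) h]; exact zero_mem _
      have e : p (D.x .pre l) * p (D.x .pre i) = (D.χ i (D.g l) : k) •
          (p (D.x .pre i) * p (D.x .pre l)) + p (D.link (D.x .pre) l i) := by
        rw [link, map_sub, map_smul, map_mul, map_mul]; abel
      rw [pow_succ', mul_assoc, ← mul_assoc (p _), e, add_mul, smul_mul_assoc, mul_assoc]
      exact add_mem (Submodule.smul_mem _ _ (hi _ ihn)) (K_mul_mem hp hz (pow_mul_mem p n hm))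

theorem mem_monoSpan [Fintype ι] (r : D.R) :
    p r ∈ monoSpan p (Finset.univ.sort (· ≤ ·) : List ι) := by
  induction r using word_induction with
  | one =>
    have : ∀ t : List ι, (1 : Q) ∈ monoSpan p t := fun t => by
      induction t with
      | nil => exact (D.K.map p).one_mem
      | cons i t ih => simpa using pow_mul_mem p (i := i) 0 ih
    rw [map_one]; exact this _
  | add a b ha hb => rw [map_add]; exact add_mem ha hb
  | smul c a ha => rw [map_smul]; exact Submodule.smul_mem _ _ ha
  | x_mul l a ha =>
    rw [map_mul]
    exact x_mul_mem hp (Finset.sortedLT_sort _).pairwise (by simp) ha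

omit hp

theorem monoSpan_le_span {t : List ι} (ht : t.Nodup) :
    monoSpan p t ≤ Submodule.span k {q | ∃ a : ι → ℕ, ∃ y ∈ D.K,
      q = p ((t.map fun i => D.x .pre i ^ a i).prod * y)} := by
  induction t with
  | nil =>
    rintro _ ⟨y, hy, rfl⟩
    exact Submodule.subset_span ⟨0, y, hy, by simp⟩
  | cons i t ih =>
    rw [List.nodup_cons] at ht
    refine iSup_le fun n => (Submodule.map_mono (ih ht.2)).trans ?_
    rw [Submodule.map_span, Submodule.span_le]
    rintro _ ⟨_, ⟨a, y, hy, rfl⟩, rfl⟩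
    refine Submodule.subset_span ⟨Function.update a i n, y, hy, ?_⟩
    have : (t.map fun l => D.x .pre l ^ Function.update a i n l) = t.map fun l => D.x .pre l ^ a l :=
      List.map_congr_left fun l hl => by
        rw [Function.update_of_ne]; rintro rfl; exact ht.1 hl
    rw [List.map_cons, List.prod_cons, this]
    simp [mul_assoc]

/-- Full powers `xᵢ ^ Nᵢ` are central and are collected at the right end. -/
theorem mono_mod (t : List ι) (a : ι → ℕ) : ∃ y ∈ D.K,
    (t.map fun i => D.x .pre i ^ a i).prod = (t.map fun i => D.x .pre i ^ (a i % D.N i)).prod * y := by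
  induction t with
  | nil => exact ⟨1, one_mem _, by simp⟩
  | cons i t ih =>
    obtain ⟨y, hy, h⟩ := ih
    have hz : D.root (D.x .pre) i ∈ D.K := Algebra.subset_adjoin (Or.inl ⟨i, rfl⟩)
    refine ⟨D.root (D.x .pre) i ^ (a i / D.N i) * y, mul_mem (pow_mem hz _) hy, ?_⟩
    have e := ((root_central (L := .pre) (D := D) i
      (t.map fun i => D.x .pre i ^ (a i % D.N i)).prod).pow_left (a i / D.N i)).eq
    rw [List.map_cons, List.prod_cons, List.map_cons, List.prod_cons, h]
    conv_lhs => rw [← Nat.mod_add_div (a i) (D.N i), pow_add, pow_mul]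
    rw [mul_assoc, mul_assoc]
    congr 1
    rw [← mul_assoc, ← mul_assoc, ← e]
    rfl

variable [Fintype ι]

/-- The algebra `R` is the sum of `J` and of the products of reduced monomials and elements of
`K`. -/
theorem exists_decomp (r : D.R) : ∃ s ∈ Submodule.span k {q : D.R | ∃ a : ι → ℕ,
    (∀ i, a i < D.N i) ∧ ∃ y ∈ D.K, q = D.mono a * y}, r - s ∈ D.J := by
  -- In the quotient by `J` the generators of `K` become central, as `x_mul_mem` requires.
  let p : D.R →ₐ[k] D.J.ringCon.Quotient := RingCon.mkₐ k D.J.ringCon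
  have hJ : ∀ a b, p a = p b ↔ a - b ∈ D.J := fun a b =>
    (RingCon.eq _).trans (TwoSidedIdeal.rel_iff _ a b)
  have hp : ∀ z ∈ D.gens, ∀ r, Commute (p z) (p r) := fun z hz r => by
    have := (hJ _ _).2 (bracket_mem_J hz r)
    rw [map_mul, map_mul] at this
    exact this.symm
  have h1 := monoSpan_le_span (p := p) (Finset.sort_nodup _ _) (mem_monoSpan hp r)
  have h2 : Submodule.span k {q | ∃ a : ι → ℕ, ∃ y ∈ D.K,
      q = p (((Finset.univ.sort (· ≤ ·)).map fun i => D.x .pre i ^ a i).prod * y)} ≤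
      (Submodule.span k {q : D.R | ∃ a : ι → ℕ,
        (∀ i, a i < D.N i) ∧ ∃ y ∈ D.K, q = D.mono a * y}).map p.toLinearMap := by
    rw [Submodule.span_le]
    rintro _ ⟨a, y, hy, rfl⟩
    obtain ⟨y', hy', e⟩ := mono_mod (D := D) (Finset.univ.sort (· ≤ ·)) a
    refine ⟨_, Submodule.subset_span ⟨fun i => a i % D.N i, fun i => Nat.mod_lt _ (D.N_pos i),
      y' * y, mul_mem hy' hy, rfl⟩, ?_⟩
    rw [e, mul_assoc]
    rfl
  obtain ⟨s, hs, e⟩ := h2 h1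
  exact ⟨s, hs, (hJ _ _).1 e.symm⟩

/-- This is the test for identities between maps that kill `J`. It shows in particular that the
retraction is determined by its defining properties. -/
theorem linearMap_ext_mono {M : Type*} [AddCommGroup M] [Module k M] {F F' : D.R →ₗ[k] M}
    (hF : ∀ w ∈ D.J, F w = 0) (hF' : ∀ w ∈ D.J, F' w = 0)
    (h : ∀ a : ι → ℕ, (∀ i, a i < D.N i) → ∀ y : D.K, F (D.mono a * y) = F' (D.mono a * y)) :
    F = F' := by
  ext r
  obtain ⟨s, hs, hr⟩ := exists_decomp r
  have e1 := hF _ hr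
  have e2 := hF' _ hr
  rw [map_sub, sub_eq_zero] at e1 e2
  rw [e1, e2]
  have : Submodule.span k {q : D.R | ∃ a : ι → ℕ, (∀ i, a i < D.N i) ∧ ∃ y ∈ D.K,
      q = D.mono a * y} ≤ LinearMap.eqLocus F F' := by
    rw [Submodule.span_le]
    rintro _ ⟨a, ha, y, hy, rfl⟩
    exact h a ha ⟨y, hy⟩
  exact this hs

end Spanning

/-! ### Dimensions of `B` and of its deformations -/

section Dimension

variable {k G ι : Type*} [Field k] [CommGroup G] [LinearOrder ι] [Fintype ι] {D : QLS k G ι}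

theorem KChar.mem_span {M : Type*} [AddCommGroup M] [Module k M] {c : D.R → k} {θ : D.R →ₗ[k] M}
    (h : KChar c θ) (r : D.R) :
    θ r ∈ Submodule.span k (Set.range fun a : D.Exps => θ (D.mono fun i => (a i).val)) := by
  obtain ⟨s, hs, hr⟩ := exists_decomp r
  have e1 := h.J hr
  rw [map_sub, sub_eq_zero] at e1
  rw [e1]
  have : Submodule.span k {q : D.R | ∃ a : ι → ℕ, (∀ i, a i < D.N i) ∧ ∃ y ∈ D.K,
      q = D.mono a * y} ≤ (Submodule.span k
        (Set.range fun a : D.Exps => θ (D.mono fun i => (a i).val))).comap θ := by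
    rw [Submodule.span_le]
    rintro _ ⟨a, ha, y, hy, rfl⟩
    obtain ⟨t, ht⟩ := h.mul_K hy
    rw [SetLike.mem_coe, Submodule.mem_comap, ht]
    refine Submodule.smul_mem _ _ (Submodule.subset_span ⟨fun i => (a i : ZMod (D.N i)), ?_⟩)
    simp only [ZMod.val_natCast, fun i => Nat.mod_eq_of_lt (ha i)]
  exact this hs

instance : Module.Finite k D.B := by
  refine ⟨⟨(Set.finite_range fun a : D.Exps => D.pi (D.mono fun i => (a i).val)).toFinset, ?_⟩⟩
  rw [Set.Finite.coe_toFinset, eq_top_iff]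
  rintro b -
  obtain ⟨r, rfl⟩ := D.pi_surjective b
  exact kchar_pi.mem_span r

/-- In the model with all scalars zero, `B` acts and the reduced monomials carry the basis vector of
exponent zero to distinct basis vectors. -/
theorem linearIndependent_mono (D : QLS k G ι) :
    LinearIndependent k fun a : D.Exps => D.pi (D.mono fun i => (a i).val) := by
  let ρ := D.rep (A := k) (0 : ι → k) 0 .nichols (fun _ => rfl) (fun _ => rfl)
  let E : D.B →ₗ[k] (D.Exps → k) := LinearMap.applyₗ (D.vec 0) ∘ₗ ρ.toLinearMap
  refine LinearIndependent.of_comp E ?_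
  have : (E ∘ fun a : D.Exps => D.pi (D.mono fun i => (a i).val)) = fun a => Pi.single a 1 := by
    funext a
    have e : D.pi (D.mono fun i => (a i).val)
        = ((Finset.univ.sort (· ≤ ·)).map fun i => D.x .nichols i ^ (a i).val).prod := by
      rw [mono, map_list_prod, List.map_map]
      simp only [Function.comp_def, map_pow, pi_x]
    simp only [Function.comp_apply, e]
    refine (D.rep_mono _ _ _ _ fun i => ZMod.val_lt (a i)).trans ?_
    simp
  rw [this]
  exact Pi.linearIndependent_single_one _ _

/-- The quotient is spanned by the images of the `∏ Nᵢ` reduced monomials, and `B` has at least this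
dimension. A surjection onto `B` is then one between spaces of equal finite dimension. -/
theorem hopfian (D : QLS k G ι) (c : D.R → k) : Hopfian D c := by
  intro Φ hΦ
  have hspan : Submodule.span k
      (Set.range fun a : D.Exps => (charIdeal D c).mkQ (D.mono fun i => (a i).val)) = ⊤ := by
    rw [eq_top_iff]
    rintro b -
    obtain ⟨r, rfl⟩ := (charIdeal D c).mkQ_surjective b
    exact (kchar_mkQ c).mem_span r
  have hfin : Module.Finite k (D.R ⧸ charIdeal D c) := by
    refine ⟨⟨(Set.finite_range fun a : D.Exps =>
      (charIdeal D c).mkQ (D.mono fun i => (a i).val)).toFinset, ?_⟩⟩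
    rw [Set.Finite.coe_toFinset, hspan]
  have h1 : Module.finrank k (D.R ⧸ charIdeal D c) ≤ Fintype.card D.Exps := by
    have := finrank_range_le_card (R := k)
      (b := fun a : D.Exps => (charIdeal D c).mkQ (D.mono fun i => (a i).val))
    rwa [Set.finrank, hspan, finrank_top] at this
  have h2 : Fintype.card D.Exps ≤ Module.finrank k D.B :=
    (linearIndependent_mono D).fintype_card_le_finrank
  have h3 : Module.finrank k D.B ≤ Module.finrank k (D.R ⧸ charIdeal D c) :=
    LinearMap.finrank_le_finrank_of_surjective hΦ
  exact (LinearMap.injective_iff_surjective_of_finrank_eq_finrank (by omega)).2 hΦ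

end Dimension

/-! ### The coefficient of `1` in the model -/

section Evaluation

set_option linter.unusedSectionVars false

variable {k G ι : Type*} [Field k] [CommGroup G] [Fintype ι] [LinearOrder ι] (D : QLS k G ι)
variable {A : Type*} [CommRing A] [Algebra k A]

/-- The values of the scalars by which the `zᵢ` act. -/
def rootVal (c : D.R → A) (i : ι) : A := c (D.root (D.x .pre) i)

open Classical in
/-- The values of the scalars by which the `zⱼᵢ` act. -/
def linkVal (c : D.R → A) (j : ι) : A :=
  if h : ∃ i < j, D.Linkable i j then c (D.link (D.x .pre) j h.choose) else 0

/-- The representation of `R` on which the generators `z` of `K` act as the scalars `c z`. -/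
abbrev scalarRep (c : D.R → A) : D.R →ₐ[k] Module.End A (D.Exps → A) :=
  D.rep (D.rootVal c) (D.linkVal c) .pre nofun nofun

theorem scalarRep_gens (c : D.R → A) {z : D.R} (hz : z ∈ D.gens) :
    D.scalarRep c z = algebraMap A _ (c z) := by
  rcases hz with ⟨i, rfl⟩ | ⟨i, j, h1, h2, rfl⟩
  · exact D.rep_root _ _ _ _ i
  · rw [D.rep_link _ _ _ _ h1 h2]
    have h : ∃ i < j, D.Linkable i j := ⟨i, h1, h2⟩
    rw [linkVal, dif_pos h, ← h2.symm.unique h.choose_spec.2.symm]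

/-- The coefficient of `1`. -/
def ev0 (c : D.R → A) : D.R →ₗ[k] A where
  toFun r := D.scalarRep c r (D.vec 0) 0
  map_add' r s := by simp
  map_smul' t r := by simp

variable {D} (c : D.R → A)

theorem ev0_apply (r : D.R) : D.ev0 c r = D.scalarRep c r (D.vec 0) 0 := rfl

theorem ev0_one : D.ev0 c 1 = 1 := by simp [ev0_apply]

theorem scalarRep_K {y : D.R} (hy : y ∈ D.K) : D.scalarRep c y = algebraMap A _ (D.ev0 c y) := by
  suffices h : ∃ s : A, D.scalarRep c y = algebraMap A _ s by
    obtain ⟨s, hs⟩ := h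
    rw [ev0_apply, hs]
    simp [Module.algebraMap_end_apply]
  induction hy using Algebra.adjoin_induction with
  | mem z hz => exact ⟨_, D.scalarRep_gens c hz⟩
  | algebraMap s => exact ⟨algebraMap k A s, by
      rw [AlgHom.commutes, ← IsScalarTower.algebraMap_apply]⟩
  | add a b _ _ ha hb =>
    obtain ⟨s, hs⟩ := ha
    obtain ⟨t, ht⟩ := hb
    exact ⟨s + t, by rw [map_add, map_add, hs, ht]⟩
  | mul a b _ _ ha hb =>
    obtain ⟨s, hs⟩ := ha
    obtain ⟨t, ht⟩ := hb
    exact ⟨s * t, by rw [map_mul, map_mul, hs, ht]⟩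

theorem ev0_gens {z : D.R} (hz : z ∈ D.gens) : D.ev0 c z = c z := by
  rw [ev0_apply, scalarRep_gens D c hz]
  simp [Module.algebraMap_end_apply]

theorem ev0_K_mul {y : D.R} (hy : y ∈ D.K) (r : D.R) : D.ev0 c (y * r) = D.ev0 c y * D.ev0 c r := by
  rw [ev0_apply, map_mul, scalarRep_K c hy]
  simp [Module.algebraMap_end_apply, ev0_apply]

theorem ev0_mul_K {y : D.R} (hy : y ∈ D.K) (r : D.R) : D.ev0 c (r * y) = D.ev0 c r * D.ev0 c y := by
  rw [ev0_apply, map_mul, scalarRep_K c hy]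
  simp [Module.algebraMap_end_apply, ev0_apply, mul_comm]

theorem ev0_J {w : D.R} (hw : w ∈ D.J) : D.ev0 c w = 0 := by
  refine eq_zero_of_mem_J (fun z hz a b r => ?_) hw
  have : D.scalarRep c (r * z - z * r) = 0 := by
    rw [map_sub, map_mul, map_mul, scalarRep_gens D c hz, Algebra.commutes, sub_self]
  rw [ev0_apply, map_mul, map_mul, this]
  simp

theorem mono_zero : D.mono 0 = 1 := by
  simp [mono]

theorem counit_mono_of_ne {a : ι → ℕ} (ha : a ≠ 0) : D.counit .pre (D.mono a) = 0 := by
  obtain ⟨i, hi⟩ := Function.ne_iff.1 ha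
  rw [mono, map_list_prod, List.map_map]
  refine List.prod_eq_zero (List.mem_map.2 ⟨i, by simp, ?_⟩)
  simpa using hi

theorem ev0_mono {a : ι → ℕ} (ha : ∀ i, a i < D.N i) :
    D.ev0 c (D.mono a) = algebraMap k A (D.counit .pre (D.mono a)) := by
  have h : D.scalarRep c (D.mono a) (D.vec 0) = D.vec (fun i => (a i : ZMod (D.N i))) :=
    D.rep_mono _ _ _ _ ha
  by_cases h0 : a = 0
  · subst h0
    rw [mono_zero, ev0_one, map_one, map_one]
  · rw [counit_mono_of_ne h0, map_zero, ev0_apply, h]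
    refine Pi.single_eq_of_ne (fun e => ?_) _
    apply h0
    funext i
    have := congrFun e i
    exact Nat.eq_zero_of_dvd_of_lt ((ZMod.natCast_eq_zero_iff _ _).1 this.symm) (ha i)

theorem gen_apply_eq_zero {lam ze : ι → A} {Z : Set D.Exps} {l : ι}
    (h1 : ∀ a ∈ Z, a - D.unit l ∈ Z) (h2 : ∀ p, D.Linkable p l → ∀ a ∈ Z, a + D.unit p ∈ Z)
    {φ : D.Exps → A} (hφ : ∀ a ∈ Z, φ a = 0) : ∀ a ∈ Z, D.gen lam ze l φ a = 0 := by
  intro a ha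
  have e : D.lowerOf l φ a = 0 := by
    rcases D.lowerOf_cases (A := A) l with ⟨p, _, h3, h4⟩ | h4
    · rw [h4, lower, shift_apply, sub_neg_eq_add, hφ _ (h2 p h3 a ha), mul_zero]
    · simp [h4]
  rw [gen, LinearMap.add_apply, Pi.add_apply, LinearMap.smul_apply, Pi.smul_apply, e, smul_zero,
    raise, shift_apply, hφ _ (h1 a ha), mul_zero, add_zero]

/-- A letter `x_l` relates the value of a function at `a` only to values at `a` with the exponent of
`l` lowered or that of the partner of `l` raised. Vanishing on a set stable under these moves
therefore persists. -/
theorem scalarRep_incl_apply_eq_zero {Z : Set D.Exps} {S : Finset ι}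
    (h1 : ∀ l ∈ S, ∀ a ∈ Z, a - D.unit l ∈ Z)
    (h2 : ∀ l ∈ S, ∀ p, D.Linkable p l → ∀ a ∈ Z, a + D.unit p ∈ Z) (r : (D.restrict S).R)
    {φ : D.Exps → A} (hφ : ∀ a ∈ Z, φ a = 0) :
    ∀ a ∈ Z, D.scalarRep c (D.incl .pre S r) φ a = 0 := by
  induction r using word_induction with
  | one => simpa using hφ
  | add r s hr hs => intro a ha; simp [hr a ha, hs a ha]
  | smul t r hr => intro a ha; simp [hr a ha]
  | x_mul i r hr =>
    rw [map_mul, incl_x, map_mul, rep_x]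
    exact gen_apply_eq_zero (h1 i i.2) (h2 i i.2) hr

/-- Elements of `R_T` applied to the vector of exponent zero produce a function `φ` supported on
exponents that vanish on `S`. Thus `φ` minus its constant part vanishes wherever all the
`T`-exponents are zero. Elements of `R_S` do not move `T`-exponents, since no partner of a vertex of
`S` lies in `T`, so only the constant part contributes to the coefficient at zero. -/
theorem ev0_incl_mul {S T : Finset ι} (hST : Disjoint S T) (hcover : S ∪ T = Finset.univ)
    (hlink : ∀ i ∈ S, ∀ j ∈ T, ¬ D.Linkable i j) (a : (D.restrict S).R) (b : (D.restrict T).R) :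
    D.ev0 c (D.incl .pre S a * D.incl .pre T b)
      = D.ev0 c (D.incl .pre S a) * D.ev0 c (D.incl .pre T b) := by
  have hS : ∀ i, i ∉ S → i ∈ T := fun i hi => by
    have := Finset.mem_univ i
    rw [← hcover, Finset.mem_union] at this
    exact this.resolve_left hi
  set φ := D.scalarRep c (D.incl .pre T b) (D.vec 0) with hφ
  have h1 : ∀ a ∈ {a : D.Exps | ∃ i ∈ S, a i ≠ 0}, φ a = 0 := by
    refine scalarRep_incl_apply_eq_zero c ?_ ?_ b ?_
    · rintro l hl a ⟨i, hi, ha⟩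
      have : i ≠ l := fun e => Finset.disjoint_left.1 hST hi (e ▸ hl)
      exact ⟨i, hi, by simpa [unit, this] using ha⟩
    · rintro l hl p hp a ⟨i, hi, ha⟩
      have : i ≠ p := fun e => hlink i hi l hl (e ▸ hp)
      exact ⟨i, hi, by simpa [unit, this] using ha⟩
    · rintro a ⟨i, hi, ha⟩
      exact Pi.single_eq_of_ne (fun e => ha (by rw [e]; rfl)) _
  have h2 : ∀ a' ∈ {a : D.Exps | ∀ i ∈ T, a i = 0},
      D.scalarRep c (D.incl .pre S a) (φ - φ 0 • D.vec 0) a' = 0 := by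
    refine scalarRep_incl_apply_eq_zero c ?_ ?_ a ?_
    · intro l hl a ha i hi
      have : i ≠ l := fun e => Finset.disjoint_left.1 hST hl (e ▸ hi)
      simpa [unit, this] using ha i hi
    · intro l hl p hp a ha i hi
      have : i ≠ p := fun e => hlink l hl i hi (e ▸ hp.symm)
      simpa [unit, this] using ha i hi
    · intro a ha
      by_cases h0 : a = 0
      · subst h0; simp
      · obtain ⟨i, hi⟩ := Function.ne_iff.1 h0
        have : i ∈ S := by
          by_contra h
          exact hi (ha i (hS i h))
        rw [Pi.sub_apply, h1 a ⟨i, this, hi⟩]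
        simp [Pi.single_eq_of_ne h0]
  have h3 := h2 0 (fun i _ => rfl)
  rw [map_sub, map_smul, Pi.sub_apply, Pi.smul_apply, sub_eq_zero] at h3
  rw [ev0_apply, map_mul, Module.End.mul_apply, ← hφ, h3, smul_eq_mul, mul_comm]
  rfl

end Evaluation

/-! ### Existence and properties of the retraction -/

section Retraction

variable {k G ι : Type*} [Field k] [CommGroup G] [Fintype ι] [LinearOrder ι] {D : QLS k G ι}

open Classical in
-- The coefficients of the model are taken in the commutative algebra `K` itself, with each
-- generator of `K` acting as itself, and `u` is the coefficient of `1`. The multiplicativity on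
-- `R_S R_T` is recorded for the sake of `u = u_S * u_T`.
theorem exists_isRetraction (D : QLS k G ι) : ∃ u : D.R →ₗ[k] D.K, D.IsRetraction u ∧
    ∀ S T : Finset ι, Disjoint S T → S ∪ T = Finset.univ →
      (∀ i ∈ S, ∀ j ∈ T, ¬ D.Linkable i j) → ∀ (a : (D.restrict S).R) (b : (D.restrict T).R),
      u (D.incl .pre S a * D.incl .pre T b) = u (D.incl .pre S a) * u (D.incl .pre T b) := by
  let _ := commRingK D
  -- Only the values on the generators matter, and these lie in `K`; the default `0` is never used.
  let c : D.R → D.K := fun r => if h : r ∈ D.K then ⟨r, h⟩ else 0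
  let u : D.R →ₗ[k] D.K := D.ev0 c
  have hK : ∀ y : D.K, u y = y := fun y => by
    let φ : D.K →ₐ[k] D.K := AlgHom.ofLinearMap (u ∘ₗ D.K.val.toLinearMap) (ev0_one c)
      (fun a b => ev0_K_mul c a.2 b)
    have h : φ = AlgHom.id k D.K := by
      refine AlgHom.adjoin_ext fun z hz => ?_
      have : φ ⟨z, Algebra.subset_adjoin hz⟩ = c z := ev0_gens c hz
      exact this.trans (dif_pos (Algebra.subset_adjoin hz))
    exact congrArg (fun f : D.K →ₐ[k] D.K => f y) h
  refine ⟨u, ⟨fun w hw => ev0_J c hw, fun a ha y => ?_, fun y r => ?_, fun y r => ?_⟩, ?_⟩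
  · have h1 : u (D.mono a * y) = u (D.mono a) * u y := ev0_mul_K c y.2 _
    have h2 : u (D.mono a) = algebraMap k D.K _ := ev0_mono c ha
    rw [h1, h2, hK, Algebra.smul_def]
  · have h1 : u (y * r) = u y * u r := ev0_K_mul c y.2 _
    rw [h1, hK]
  · have h1 : u (r * y) = u r * u y := ev0_mul_K c y.2 _
    rw [h1, hK]
  · intro S T h1 h2 h3 a b
    exact ev0_incl_mul c h1 h2 h3 a b

variable {u : D.R →ₗ[k] D.K} (hu : D.IsRetraction u)
include hu

theorem IsRetraction.one : u 1 = 1 := by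
  have := hu.mono_mul 0 D.N_pos 1
  simpa [mono_zero] using this

theorem IsRetraction.K (y : D.K) : u y = y := by
  have := hu.left_linear y 1
  rwa [mul_one, hu.one, mul_one] at this

theorem IsRetraction.mul_gens_mul {z : D.R} (hz : z ∈ D.gens) (a b : D.R) :
    u (a * z * b) = ⟨z, gens_subset_K hz⟩ * u (a * b) := by
  have h : (a * z - z * a) * b ∈ D.J := D.J.mul_mem_right _ _ (bracket_mem_J hz a)
  have h1 := hu.ideal _ h
  rw [sub_mul, map_sub, sub_eq_zero] at h1
  rw [h1, mul_assoc z]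
  exact hu.left_linear ⟨z, gens_subset_K hz⟩ (a * b)

/-- The action preserves `J`, fixes `K` and multiplies `x^a` by a scalar. This scalar has no effect,
since `ε` is invariant and vanishes on `x^a` unless `a = 0`. -/
theorem IsRetraction.comp_act (h : G) : u ∘ₗ D.actl .pre h = u := by
  refine linearMap_ext_mono (fun w hw => ?_) hu.ideal fun a ha y => ?_
  · refine eq_zero_of_mem_J (fun z hz a b r => ?_) hw
    refine hu.ideal _ ?_
    simp only [AlgHom.toLinearMap_apply, map_mul, map_sub, act_gens hz]
    exact D.J.mul_mem_right _ _ (D.J.mul_mem_left _ _ (bracket_mem_J hz _))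
  · have h1 : ∃ s : k, D.act .pre h (D.mono a) = s • D.mono a := by
      unfold mono
      induction (Finset.univ.sort (· ≤ ·) : List ι) with
      | nil => exact ⟨1, by simp⟩
      | cons i t ih =>
        obtain ⟨s, hs⟩ := ih
        exact ⟨(D.χ i h : k) ^ a i * s, by
          rw [List.map_cons, List.prod_cons, map_mul, hs, map_pow, act_x, smul_pow,
            smul_mul_smul_comm]⟩
    obtain ⟨s, hs⟩ := h1
    have h2 : s * D.counit .pre (D.mono a) = D.counit .pre (D.mono a) := by
      rw [← smul_eq_mul, ← map_smul, ← hs, counit_act]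
    rw [LinearMap.comp_apply, AlgHom.toLinearMap_apply, map_mul, hs, D.act_K h y y.2,
      smul_mul_assoc, map_smul, hu.mono_mul a ha, smul_smul, h2]

end Retraction

/-! ### The group `Alg_G(K, k)` -/

section Characters

variable {k G ι : Type*} [Field k] [CommGroup G] [LinearOrder ι] {D : QLS k G ι}

/-- A generator of `K`, as an element of `K`. -/
abbrev toK {z : D.R} (hz : z ∈ D.gens) : D.K := ⟨z, gens_subset_K hz⟩

theorem AlgG.ext {f f' : D.AlgG} (h : ∀ z, ∀ hz : z ∈ D.gens, f.1 (toK hz) = f'.1 (toK hz)) :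
    f = f' :=
  Subtype.ext (AlgHom.adjoin_ext fun z hz => h z hz)

theorem comul_gens {z : D.R} (hz : z ∈ D.gens) : D.comul .pre z = z ⊗ₜ 1 + 1 ⊗ₜ z := by
  obtain ⟨h, hh⟩ := gens_comulOp hz
  rw [← mul_one z, comul_mul, hh, comul_one]
  simp [opL, opR]

theorem comulK_gens {z : D.R} (hz : z ∈ D.gens) :
    D.comulK (toK hz) = toK hz ⊗ₜ 1 + 1 ⊗ₜ toK hz :=
  D.valval_inj <| by
    rw [valval_comulK]
    simp [valval, comul_gens hz]

/-- The generators are primitive, so convolution adds values on them. All group laws are verified in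
this way. -/
theorem AlgG.mul_gens (f f' : D.AlgG) {z : D.R} (hz : z ∈ D.gens) :
    (f * f').1 (toK hz) = f.1 (toK hz) + f'.1 (toK hz) := by
  have := LinearMap.congr_fun (AlgG.mul_def D f f') (toK hz)
  refine this.trans ?_
  simp [conv, comulK_gens hz]

theorem AlgG.one_gens {z : D.R} (hz : z ∈ D.gens) : (1 : D.AlgG).1 (toK hz) = 0 :=
  counit_gens hz

variable [Fintype ι]

/-- The algebra map `K → k` with prescribed values on the generators. -/
def AlgG.ofVals (D : QLS k G ι) (c : D.R → k) : D.AlgG :=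
  ⟨AlgHom.ofLinearMap (D.ev0 c ∘ₗ D.K.val.toLinearMap) (ev0_one c) (fun a b => ev0_K_mul c a.2 b),
    fun h y => by rw [actK_eq]⟩

theorem AlgG.ofVals_gens (c : D.R → k) {z : D.R} (hz : z ∈ D.gens) :
    (AlgG.ofVals D c).1 (toK hz) = c z := ev0_gens c hz

/-- The inverse has the opposite values on generators; an algebra map with these values exists by
evaluation in the model. -/
theorem AlgG.exists_inv (f : D.AlgG) : ∃ f' : D.AlgG, f * f' = 1 ∧ f' * f = 1 ∧
    ∀ z, ∀ hz : z ∈ D.gens, f'.1 (toK hz) = - f.1 (toK hz) := by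
  classical
  let c : D.R → k := fun r => if h : r ∈ D.K then - f.1 ⟨r, h⟩ else 0
  have hc : ∀ z, ∀ hz : z ∈ D.gens, (AlgG.ofVals D c).1 (toK hz) = - f.1 (toK hz) := fun z hz =>
    (AlgG.ofVals_gens c hz).trans (dif_pos (gens_subset_K hz))
  refine ⟨AlgG.ofVals D c, AlgG.ext fun z hz => ?_, AlgG.ext fun z hz => ?_, hc⟩
  · rw [AlgG.mul_gens, hc, AlgG.one_gens, add_neg_cancel]
  · rw [AlgG.mul_gens, hc, AlgG.one_gens, neg_add_cancel]

end Characters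

/-! ### Construction of the connecting map -/

section Connecting

variable {k G ι : Type*} [Field k] [CommGroup G] [LinearOrder ι] {D : QLS k G ι}

theorem KChar.congr {M : Type*} [AddCommGroup M] [Module k M] {c c' : D.R → k} {θ : D.R →ₗ[k] M}
    (h : KChar c θ) (e : ∀ z ∈ D.gens, c z = c' z) : KChar c' θ := fun z hz a b => by
  rw [← e z hz]; exact h z hz a b

theorem mul_eval_gens (v w : Fn (XC D .pre)) {z : D.R} (hz : z ∈ D.gens) :
    (v * w).ev z = v.ev z * w.ev 1 + v.ev 1 * w.ev z := by
  change conv (D.comul .pre) v.ev w.ev z = _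
  simp [conv, comul_gens hz]

/-- The convolution inverse of a character is a character on `K`. -/
theorem inv_mul_K {v w : Fn (XC D .pre)} (hw : w ∈ invFn (XC D .pre)) (h : v * w = 1)
    (h' : w * v = 1) {f : D.AlgG}
    (hwf : ∀ z, ∀ hz : z ∈ D.gens, ∀ r, w.ev (z * r) = - f.1 (toK hz) * w.ev r) (y : D.K) (r : D.R) :
    v.ev (y * r) = f.1 y * v.ev r := by
  have hgen : ∀ z, ∀ hz : z ∈ D.gens, ∀ r, v.ev (z * r) = f.1 (toK hz) * v.ev r := fun z hz r => by
    obtain ⟨g, hg⟩ := gens_comulOp hz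
    let c := f.1 (toK hz)
    let v' : Fn (XC D .pre) := v.ev ∘ₗ lm z
    let v'' : Fn (XC D .pre) := (c • v.ev : D.R →ₗ[k] k)
    -- Evaluating `w * v = ε` at `z r` and using that `z` is primitive gives `0 = -c (w * v)(r) + (w
    -- * v')(r)`. Cancelling `w` then yields `v(z r) = c v(r)`.
    have e1 : w * v' = w * v'' := by
      refine LinearMap.ext fun r => ?_
      have e2 := bconv_mul_of_comulOp (LinearMap.mul k k) w.ev v.ev hg r
      have e3 : w.ev ∘ₗ lm z = (-c) • w.ev := LinearMap.ext fun r => hwf z hz r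
      have e4 : w.ev ∘ₗ D.actl .pre g = w.ev := hw g
      have e5 : bconv (D.comul .pre) (LinearMap.mul k k) w.ev v.ev = D.eps .pre := h'
      rw [e3, e4, bconv_smul_left, e5, LinearMap.smul_apply, eps_apply, eps_apply, map_mul,
        counit_gens hz, zero_mul] at e2
      have e6 : bconv (D.comul .pre) (LinearMap.mul k k) w.ev (c • v.ev) r = c • D.eps .pre r := by
        rw [bconv_smul_right, e5]; rfl
      refine Eq.trans ?_ e6.symm
      have e7 := eq_neg_of_add_eq_zero_right e2.symm
      refine e7.trans ?_
      simp
    have e2 : v' = v'' := by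
      rw [← one_mul v', ← h, mul_assoc, e1, ← mul_assoc, h, one_mul]
    exact LinearMap.congr_fun e2 r
  obtain ⟨y, hy⟩ := y
  suffices H : ∀ hy : y ∈ D.K, ∀ r, v.ev (y * r) = f.1 ⟨y, hy⟩ * v.ev r from H hy r
  induction hy using Algebra.adjoin_induction with
  | mem z hz => exact fun _ r => hgen z hz r
  | algebraMap s =>
    intro hy r
    have : f.1 ⟨algebraMap k _ s, hy⟩ = s := f.1.commutes s
    rw [this, ← Algebra.smul_def, map_smul, smul_eq_mul]
  | add a b ha hb iha ihb =>
    intro hy r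
    have : f.1 ⟨a + b, hy⟩ = f.1 ⟨a, ha⟩ + f.1 ⟨b, hb⟩ := map_add f.1 ⟨a, ha⟩ ⟨b, hb⟩
    rw [this, add_mul, map_add, iha ha, ihb hb, add_mul]
  | mul a b ha hb iha ihb =>
    intro hy r
    have : f.1 ⟨a * b, hy⟩ = f.1 ⟨a, ha⟩ * f.1 ⟨b, hb⟩ := map_mul f.1 ⟨a, ha⟩ ⟨b, hb⟩
    rw [this, mul_assoc, iha ha, ihb hb, mul_assoc]

variable [Fintype ι] {u : D.R →ₗ[k] D.K} (hu : D.IsRetraction u)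
include hu

/-- The functional `w = f⁻¹ u` kills `J`, so generators of `K` may be pulled out of any place in a
product. It is invertible because `w(1) = 1`, and its inverse restricts to `f` on `K`. -/
theorem exists_extension (f : D.AlgG) : ∃ (f' : D.AlgG) (v : D.R →ₗ[k] k) (σ : D.Z2),
    f * f' = 1 ∧ f' * f = 1 ∧ D.Inv1 .pre v (f'.1.toLinearMap ∘ₗ u) ∧
    v ∘ₗ D.K.val.toLinearMap = f.1.toLinearMap ∧
    D.pull σ = D.bdry .pre v (f'.1.toLinearMap ∘ₗ u) ∧
    KChar (f'.1.toLinearMap ∘ₗ u) (f'.1.toLinearMap ∘ₗ u) := by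
  obtain ⟨f', h1, h2, h3⟩ := f.exists_inv
  let w : Fn (XC D .pre) := f'.1.toLinearMap ∘ₗ u
  have hw1 : w.ev 1 = 1 := by
    change f'.1 (u 1) = 1
    rw [hu.one, map_one]
  have hwz : ∀ z, ∀ hz : z ∈ D.gens, w.ev z = f'.1 (toK hz) := fun z hz =>
    congrArg f'.1 (hu.K (toK hz))
  have hwc : KChar w.ev w.ev := fun z hz a b => by
    change f'.1 (u (a * z * b)) = _
    rw [hu.mul_gens_mul hz, map_mul, hwz z hz]
    rfl
  have hwi : w ∈ invFn (XC D .pre) := fun h =>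
    congrArg (LinearMap.comp f'.1.toLinearMap) (hu.comp_act h)
  obtain ⟨v, hv, hv'⟩ := isUnit_fn w hw1
  have hvi := inv_mem hwi hv hv'
  have hv1 : v.ev 1 = 1 := by
    have := ev_one_of_mul hv
    rwa [hw1, one_mul] at this
  obtain ⟨σ, hσ, e⟩ := exists_cocycle (hopfian D w.ev) hvi hwi hv' hv hv1 hwc
  refine ⟨f', v, ⟨σ, isCocycle_iff.2 hσ⟩, h1, h2, inv1_iff.2 ⟨hvi, hwi, hv', hv⟩, ?_, e, hwc⟩
  refine LinearMap.ext fun y => ?_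
  have := inv_mul_K hwi hv' hv (f := f) (fun z hz r => by
    have := hwc z hz 1 r
    rw [one_mul, one_mul, hwz z hz, h3 z hz] at this
    exact this) y 1
  rw [mul_one, hv1, mul_one] at this
  exact this

/-- If any other extension of `f` has a coboundary that descends, then its inverse has the scalar
property by `kchar_of_bdry`. Its scalars are forced by `f`, so it differs from the constructed
extension by a functional on `B`. -/
theorem exists_isConnecting : ∃ δ, D.IsConnecting u δ := by
  choose f' v σ h1 h2 h3 h4 h5 h6 using exists_extension hu
  refine ⟨fun f => D.cls (σ f), fun f => ⟨f' f, v f, σ f, h1 f, h2 f, h3 f, h4 f, h5 f, rfl⟩, ?_⟩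
  intro f w w' τ hw hf e
  obtain ⟨_, _, g1, g2⟩ := inv1_iff.1 hw
  have hw1 : Fn.ev (C := XC D .pre) w 1 = 1 := by
    have : w ((1 : D.K) : D.R) = f.1 1 := LinearMap.congr_fun hf 1
    rw [map_one] at this
    exact this
  have hw1' : Fn.ev (C := XC D .pre) w' 1 = 1 := by
    have := ev_one_of_mul g1
    rwa [hw1, one_mul] at this
  have k2 := kchar_of_bdry hw hw1' (σ := τ.1) e
  -- At a primitive element, `w * w' = 1` and `f * f' = 1` give `w'(z) = -f(z) = f'(z)`.
  have hz : ∀ z ∈ D.gens, Fn.ev (C := XC D .pre) w' z = (f' f).1 (u z) := fun z hz => by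
    have e1 := mul_eval_gens w w' hz
    rw [g1, hw1, hw1', mul_one, one_mul] at e1
    have e2 : Fn.ev (C := XC D .pre) (1 : Fn (XC D .pre)) z = 0 := counit_gens hz
    have e3 : Fn.ev (C := XC D .pre) w z = f.1 (toK hz) := LinearMap.congr_fun hf (toK hz)
    have e4 := AlgG.mul_gens f (f' f) hz
    rw [h1, AlgG.one_gens] at e4
    have e5 : u z = toK hz := hu.K (toK hz)
    rw [e2, e3] at e1
    rw [e5]
    linear_combination e4 - e1
  obtain ⟨χ, χ', hχ, e'⟩ := exists_twist (hopfian D _) (h3 f) hw (h6 f)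
    (k2.congr hz) (σ₁ := (σ f).1) (σ₂ := τ.1) (h5 f) e
  exact Quot.sound ⟨χ, χ', hχ, e'⟩

end Connecting

/-! ### Naturality of the braiding -/

section Naturality

variable {k : Type*} [Field k]

theorem sandwich_map {A B C E A' B' C' E' : Type*} [AddCommGroup A] [Module k A] [AddCommGroup B]
    [Module k B] [AddCommGroup C] [Module k C] [AddCommGroup E] [Module k E] [AddCommGroup A']
    [Module k A'] [AddCommGroup B'] [Module k B'] [AddCommGroup C'] [Module k C'] [AddCommGroup E']
    [Module k E'] (a : A →ₗ[k] A') (b : B →ₗ[k] B') (c : C →ₗ[k] C') (e : E →ₗ[k] E')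
    {σ : C ⊗[k] B →ₗ[k] B ⊗[k] C} {σ' : C' ⊗[k] B' →ₗ[k] B' ⊗[k] C'}
    (h : σ' ∘ₗ TensorProduct.map c b = TensorProduct.map b c ∘ₗ σ) :
    mid σ' ∘ₗ TensorProduct.map (TensorProduct.map a c) (TensorProduct.map b e)
      = TensorProduct.map (TensorProduct.map a b) (TensorProduct.map c e) ∘ₗ mid σ := by
  refine TensorProduct.ext_fourfold' fun x y z w => ?_
  have h' := LinearMap.congr_fun h (y ⊗ₜ z)
  simp only [LinearMap.comp_apply, TensorProduct.map_tmul] at h'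
  simp only [LinearMap.comp_apply, TensorProduct.map_tmul, mid_tmul, h']
  induction σ (y ⊗ₜ z) using TensorProduct.induction_on with
  | zero => simp
  | add s t hs ht => simp only [map_add, hs, ht]
  | tmul s t => simp [sandwich]

variable {G ι ι₁ ι₂ : Type*} [CommGroup G] [LinearOrder ι] [LinearOrder ι₁] [LinearOrder ι₂]
variable {D : QLS k G ι} {L : Layer} {D₁ : QLS k G ι₁} {D₂ : QLS k G ι₂}

theorem IsMorph.braid {θ₁ : D.Alg L →ₐ[k] D₁.Alg L} {θ₂ : D.Alg L →ₐ[k] D₂.Alg L}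
    (h₁ : IsMorph θ₁) (h₂ : IsMorph θ₂) :
    QLS.braid (D₂.coact L).toLinearMap (D₁.actl L) ∘ₗ
        TensorProduct.map θ₂.toLinearMap θ₁.toLinearMap
      = TensorProduct.map θ₁.toLinearMap θ₂.toLinearMap ∘ₗ
        QLS.braid (D.coact L).toLinearMap (D.actl L) := by
  refine TensorProduct.ext' fun b y => ?_
  simp only [LinearMap.comp_apply, TensorProduct.map_tmul, AlgHom.toLinearMap_apply]
  induction b using word_induction with
  | one => rw [map_one, braid_one _ (D₁.actl_one L), braid_one _ (D.actl_one L)]; simp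
  | add a b ha hb => simp only [TensorProduct.add_tmul, map_add, ha, hb]
  | smul c a ha => simp only [← TensorProduct.smul_tmul', map_smul, ha]
  | x_mul i a ih =>
    rw [braid_x_mul _ (D.actl_mul L)]
    have key : ∀ F : D₂.Alg L →ₗ[k] D₂.Alg L, θ₂.toLinearMap ∘ₗ lm (D.x L i) = F ∘ₗ θ₂.toLinearMap →
        TensorProduct.map θ₁.toLinearMap θ₂.toLinearMap (TensorProduct.map (D.actl L (D.g i))
          (lm (D.x L i)) (QLS.braid (D.coact L).toLinearMap (D.actl L) (a ⊗ₜ y)))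
        = TensorProduct.map (D₁.actl L (D.g i)) F (TensorProduct.map θ₁.toLinearMap θ₂.toLinearMap
            (QLS.braid (D.coact L).toLinearMap (D.actl L) (a ⊗ₜ y))) := fun F hF => by
      have e : TensorProduct.map θ₁.toLinearMap θ₂.toLinearMap ∘ₗ
          TensorProduct.map (D.actl L (D.g i)) (lm (D.x L i))
          = TensorProduct.map (D₁.actl L (D.g i)) F ∘ₗ
            TensorProduct.map θ₁.toLinearMap θ₂.toLinearMap := by
        rw [← TensorProduct.map_comp, ← TensorProduct.map_comp, h₁.comp_act, hF]
      exact LinearMap.congr_fun e _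
    rcases h₂ i with h0 | ⟨i', hi, hg, -⟩
    · rw [key 0 (by ext; simp [h0]), map_mul, h0]
      simp [TensorProduct.map_zero_right]
    · rw [key (lm (D₂.x L i')) (by ext; simp [hi]), ← ih, map_mul, hi,
        braid_x_mul _ (D₁.actl_mul L), hg]

end Naturality

/-! ### Inclusions and projections of subdiagrams -/

section Restriction

variable {k G ι : Type*} [Field k] [CommGroup G] [LinearOrder ι] (D : QLS k G ι) (L : Layer)
  (S T : Finset ι)

theorem res_x (i : ι) : D.res L S (D.x L i) = D.xres L S i := by simp [res]

theorem res_x_mem {i : ι} (h : i ∈ S) : D.res L S (D.x L i) = (D.restrict S).x L ⟨i, h⟩ := by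
  rw [res_x, xres, dif_pos h]

theorem res_x_notMem {i : ι} (h : i ∉ S) : D.res L S (D.x L i) = 0 := by
  rw [res_x, xres, dif_neg h]

theorem isMorph_res : IsMorph (D.res L S) := fun i => by
  by_cases h : i ∈ S
  · exact Or.inr ⟨⟨i, h⟩, D.res_x_mem L S h, rfl, rfl⟩
  · exact Or.inl (D.res_x_notMem L S h)

theorem isMorph_incl : IsMorph (D.incl L S) := fun i => Or.inr ⟨i, incl_x L S i, rfl, rfl⟩

theorem res_comp_incl : (D.res L S).comp (D.incl L S) = AlgHom.id k _ := hom_ext fun i => by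
  simp [res_x_mem D L S i.2]

theorem res_incl (r : (D.restrict S).Alg L) : D.res L S (D.incl L S r) = r :=
  congrArg (fun f : (D.restrict S).Alg L →ₐ[k] (D.restrict S).Alg L => f r) (D.res_comp_incl L S)

variable {S T}

theorem res_incl_of_disjoint (hST : Disjoint S T) (r : (D.restrict S).Alg L) :
    D.res L T (D.incl L S r) = algebraMap k _ ((D.restrict S).counit L r) := by
  have : (D.res L T).comp (D.incl L S) = (Algebra.ofId k _).comp ((D.restrict S).counit L) :=
    hom_ext fun i => by
      simp [res_x_notMem D L T (Finset.disjoint_left.1 hST i.2)]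
  exact congrArg (fun f : (D.restrict S).Alg L →ₐ[k] (D.restrict T).Alg L => f r) this

theorem res_x_eq_zero (hST : Disjoint S T) (i : ι) :
    D.res L S (D.x L i) = 0 ∨ D.res L T (D.x L i) = 0 := by
  by_cases h : i ∈ S
  · exact Or.inr (D.res_x_notMem L T (Finset.disjoint_left.1 hST h))
  · exact Or.inl (D.res_x_notMem L S h)

theorem res_pi (S : Finset ι) (r : D.R) :
    D.res .nichols S (D.pi r) = (D.restrict S).pi (D.res .pre S r) := by
  have : (D.res .nichols S).comp D.pi = (D.restrict S).pi.comp (D.res .pre S) := hom_ext fun i => by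
    by_cases h : i ∈ S
    · simp [res_x_mem D _ S h]
    · simp [res_x_notMem D _ S h]
  exact congrArg (fun f : D.R →ₐ[k] (D.restrict S).B => f r) this

variable {D L}

theorem p2_commute (hST : Disjoint S T) {f : Fn (X2 (D.restrict S) L)} {f' : Fn (X2 (D.restrict T) L)}
    (hf : f ∈ invFn _) (hf' : f' ∈ invFn _) :
    Commute ((D.isMorph_res L S).p2 f) ((D.isMorph_res L T).p2 f') := by
  have hS := D.isMorph_res L S
  have hT := D.isMorph_res L T
  have h := D.res_x_eq_zero L hST
  exact (semiComm_TC hS hT h hS.cmap hT.cmap (semiComm_X hS hT h)).commute _ _ hf hf'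

theorem p3_commute (hST : Disjoint S T) {f : Fn (X3 (D.restrict S) L)} {f' : Fn (X3 (D.restrict T) L)}
    (hf : f ∈ invFn _) (hf' : f' ∈ invFn _) :
    Commute ((D.isMorph_res L S).p3 f) ((D.isMorph_res L T).p3 f') := by
  have hS := D.isMorph_res L S
  have hT := D.isMorph_res L T
  have h := D.res_x_eq_zero L hST
  exact (semiComm_TC hS hT h (hS.cmap_map hS.cmap) (hT.cmap_map hT.cmap)
    (semiComm_TC hS hT h hS.cmap hT.cmap (semiComm_X hS hT h))).commute _ _ hf hf'

/-- By naturality of the braiding, `p_S` and `p_T` may be applied after the braiding of `B` with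
itself, and the formula for `ρ²` becomes a convolution on `B ⊗ B`. -/
theorem rho2_eq (σ : Fn (X2 (D.restrict S) .nichols)) (σ' : Fn (X2 (D.restrict T) .nichols)) :
    D.rho2 S T σ σ' = (D.isMorph_res .nichols S).p2 σ * (D.isMorph_res .nichols T).p2 σ' := by
  have hS := D.isMorph_res .nichols S
  have hT := D.isMorph_res .nichols T
  have h := sandwich_map (D.res .nichols S).toLinearMap (D.res .nichols S).toLinearMap
    (D.res .nichols T).toLinearMap (D.res .nichols T).toLinearMap (hS.braid hT)
  change tens σ.ev σ'.ev ∘ₗ mid _ ∘ₗ TensorProduct.map (_ ∘ₗ _) (_ ∘ₗ _)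
    = conv (D.comul2 .nichols) (σ.ev ∘ₗ _) (σ'.ev ∘ₗ _)
  rw [conv, comul2, TensorProduct.map_comp, TensorProduct.map_comp]
  exact congrArg (fun Z => LinearMap.mul' k k ∘ₗ TensorProduct.map σ.ev σ'.ev ∘ₗ Z ∘ₗ
    TensorProduct.map (D.comul .nichols) (D.comul .nichols)) h

end Restriction

/-! ### Products of cocycles and coboundaries from `S` and `T` -/

section Products

variable {k G ι : Type*} [Field k] [CommGroup G] [LinearOrder ι] {D : QLS k G ι} {L : Layer}

theorem mul_one_tmul (F F' : Fn (X2 D L)) (a : D.Alg L) : (F * F').ev (1 ⊗ₜ a)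
    = conv (D.comul L) (F.ev ∘ₗ TensorProduct.mk k _ _ 1) (F'.ev ∘ₗ TensorProduct.mk k _ _ 1) a :=
  TC_one (XC D L) F.ev F'.ev a

/-- Unlike `mul_one_tmul`, this needs an induction, because the recursion for the tensor square runs
over the first factor. -/
theorem mul_tmul_one (F F' : D.Alg L ⊗[k] D.Alg L →ₗ[k] k) (a : D.Alg L) :
    conv (X2 D L).Δ F F' (a ⊗ₜ 1) = conv (D.comul L) (F ∘ₗ (TensorProduct.mk k _ _).flip 1)
      (F' ∘ₗ (TensorProduct.mk k _ _).flip 1) a := by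
  revert F F'
  induction a using word_induction with
  | one =>
    intro F F'
    refine (TC_one (XC D L) F F' 1).trans ?_
    refine (bconv_one (D := D) (L := L) (LinearMap.mul k k) _ _).trans ?_
    exact (bconv_one (D := D) (L := L) (LinearMap.mul k k)
      (F ∘ₗ (TensorProduct.mk k _ _).flip 1) (F' ∘ₗ (TensorProduct.mk k _ _).flip 1)).symm
  | add a b ha hb => intro F F'; simp only [TensorProduct.add_tmul, map_add, ha, hb]
  | smul c a ha => intro F F'; simp only [← TensorProduct.smul_tmul', map_smul, ha]
  | x_mul i a ih =>
    intro F F'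
    refine (TC_x_mul (XC D L) F F' i a 1).trans ?_
    refine Eq.trans ?_ (bconv_x_mul (LinearMap.mul k k) _ _ i a).symm
    have e1 : ∀ F : D.Alg L ⊗[k] D.Alg L →ₗ[k] k, (F ∘ₗ (TensorProduct.mk k _ _).flip 1) ∘ₗ
        lm (D.x L i) = (F ∘ₗ lmT D L _ i) ∘ₗ (TensorProduct.mk k _ _).flip 1 := fun F => by
      ext; simp
    have e2 : (F ∘ₗ (TensorProduct.mk k _ _).flip 1) ∘ₗ D.actl L (D.g i)
        = (F ∘ₗ (X2 D L).act (D.g i)) ∘ₗ (TensorProduct.mk k _ _).flip 1 := by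
      ext r
      simp [TC, XC, actT]
    rw [e1, e1, e2]
    exact congrArg₂ (· + ·) (ih _ _) (ih _ _)

variable {S T : Finset ι} (hST : Disjoint S T)
include hST

/-- On the tensor cube invariant functionals from `S` and from `T` commute, so the two cocycle
identities can be multiplied. -/
theorem cocycle_mul {σ : Fn (X2 (D.restrict S) L)} {σ' : Fn (X2 (D.restrict T) L)}
    (h : Cocycle σ) (h' : Cocycle σ') :
    Cocycle ((D.isMorph_res L S).p2 σ * (D.isMorph_res L T).p2 σ') := by
  have H := (D.isMorph_res L S).p2_cocycle h
  have H' := (D.isMorph_res L T).p2_cocycle h'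
  refine ⟨mul_mem H.inv H'.inv, H.unit.mul H'.unit, ?_, fun a => ?_, fun a => ?_⟩
  · have c1 : Commute (e2 D L ((D.isMorph_res L S).p2 σ)) (e0 D L ((D.isMorph_res L T).p2 σ')) := by
      rw [← IsMorph.p3_e2, ← IsMorph.p3_e0]
      exact p3_commute hST (CMap.hom_mem _ h.inv) (CMap.hom_mem _ h'.inv)
    have c2 : Commute (e1 D L ((D.isMorph_res L S).p2 σ)) (e3 D L ((D.isMorph_res L T).p2 σ')) := by
      rw [← IsMorph.p3_e1, ← IsMorph.p3_e3]
      exact p3_commute hST (CMap.hom_mem _ h.inv) (CMap.hom_mem _ h'.inv)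
    simp only [map_mul]
    rw [mul_assoc, ← mul_assoc (e0 D L _) (e2 D L _), ← c1.eq, mul_assoc, H'.cocycle,
      ← mul_assoc, H.cocycle, mul_assoc, ← mul_assoc (e1 D L _) (e3 D L _), c2.eq]
    simp only [mul_assoc]
  · rw [mul_one_tmul]
    have e1 : ∀ {F : Fn (X2 D L)}, Cocycle F → F.ev ∘ₗ TensorProduct.mk k _ _ 1 = D.eps L :=
      fun hF => LinearMap.ext hF.norm_left
    rw [e1 H, e1 H']
    exact LinearMap.congr_fun (mul_one (1 : Fn (XC D L))) a
  · refine (mul_tmul_one _ _ a).trans ?_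
    have e1 : ∀ {F : Fn (X2 D L)}, Cocycle F →
        F.ev ∘ₗ (TensorProduct.mk k _ _).flip 1 = D.eps L :=
      fun hF => LinearMap.ext hF.norm_right
    refine (congrArg₂ (fun F F' => conv (D.comul L) F F' a) (e1 H) (e1 H')).trans ?_
    exact LinearMap.congr_fun (mul_one (1 : Fn (XC D L))) a

/-- The factor `∂¹χ'` stands between the two cocycles and is moved past the one from `T`. For a
twist of the second cocycle it is `∂⁰χ * ∂²χ` that has to be moved. -/
theorem twist_mul_left {σ : Fn (X2 (D.restrict S) L)} {σ' : Fn (X2 (D.restrict T) L)}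
    (h' : σ' ∈ invFn _) {χ χ' : Fn (XC (D.restrict S) L)}
    (hχ : (D.restrict S).Inv1 L χ χ') :
    (D.isMorph_res L S).p2 ((D.restrict S).twist L χ χ' σ) * (D.isMorph_res L T).p2 σ'
      = D.twist L ((D.isMorph_res L S).p1 χ) ((D.isMorph_res L S).p1 χ')
        ((D.isMorph_res L S).p2 σ * (D.isMorph_res L T).p2 σ') := by
  have c := p2_commute (D := D) (L := L) hST (d1_mem (inv1_iff.1 hχ).2.1) h'
  rw [IsMorph.p2_d1] at c
  rw [IsMorph.p2_twist, twist_eq, twist_eq, mul_assoc, c.eq]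
  simp only [mul_assoc]

theorem twist_mul_right {σ : Fn (X2 (D.restrict S) L)} {σ' : Fn (X2 (D.restrict T) L)}
    (h : σ ∈ invFn _) {χ χ' : Fn (XC (D.restrict T) L)}
    (hχ : (D.restrict T).Inv1 L χ χ') :
    (D.isMorph_res L S).p2 σ * (D.isMorph_res L T).p2 ((D.restrict T).twist L χ χ' σ')
      = D.twist L ((D.isMorph_res L T).p1 χ) ((D.isMorph_res L T).p1 χ')
        ((D.isMorph_res L S).p2 σ * (D.isMorph_res L T).p2 σ') := by
  have c0 := p2_commute (D := D) (L := L) hST h (d0_mem (inv1_iff.1 hχ).1)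
  have c2 := p2_commute (D := D) (L := L) hST h (d2_mem (inv1_iff.1 hχ).1)
  rw [IsMorph.p2_d0] at c0
  rw [IsMorph.p2_d2] at c2
  have c := c0.mul_right c2
  rw [IsMorph.p2_twist, twist_eq, twist_eq, ← mul_assoc, ← mul_assoc, c.eq]
  simp only [mul_assoc]

/-- Commuting the factors from `S` and `T` sorts the product by faces. The inverse of the product is
the product of the inverses in reversed order. -/
theorem bdry_mul {v w : Fn (XC (D.restrict S) L)} {v' w' : Fn (XC (D.restrict T) L)}
    (h : (D.restrict S).Inv1 L v w) (h' : (D.restrict T).Inv1 L v' w') :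
    (D.isMorph_res L S).p2 ((D.restrict S).bdry L v w)
        * (D.isMorph_res L T).p2 ((D.restrict T).bdry L v' w')
      = D.bdry L ((D.isMorph_res L S).p1 v * (D.isMorph_res L T).p1 v')
        ((D.isMorph_res L T).p1 w' * (D.isMorph_res L S).p1 w) := by
  obtain ⟨a1, b1, -, -⟩ := inv1_iff.1 h
  obtain ⟨a2, b2, -, -⟩ := inv1_iff.1 h'
  have c1 := (p2_commute (D := D) (L := L) hST (d1_mem b1)
    (mul_mem (mul_mem (d0_mem a2) (d2_mem a2)) (d1_mem b2))).eq
  have c2 := (p2_commute (D := D) (L := L) hST (d2_mem a1) (d0_mem a2)).eq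
  simp only [map_mul, IsMorph.p2_d0, IsMorph.p2_d1, IsMorph.p2_d2] at c1 c2
  rw [IsMorph.p2_bdry, IsMorph.p2_bdry, bdry_eq, bdry_eq, bdry_eq, map_mul, map_mul, map_mul,
    mul_assoc _ _ (d0 D L _ * _ * _), c1]
  simp only [mul_assoc]
  rw [← mul_assoc (d2 D L _) (d0 D L _), c2]
  simp only [mul_assoc]

omit hST in
theorem inv1_mul {v w : Fn (XC (D.restrict S) L)} {v' w' : Fn (XC (D.restrict T) L)}
    (h : (D.restrict S).Inv1 L v w) (h' : (D.restrict T).Inv1 L v' w') :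
    D.Inv1 L ((D.isMorph_res L S).p1 v * (D.isMorph_res L T).p1 v')
        ((D.isMorph_res L T).p1 w' * (D.isMorph_res L S).p1 w) := by
  obtain ⟨a1, b1, c1, d1⟩ := inv1_iff.1 ((D.isMorph_res L S).p1_inv h)
  obtain ⟨a2, b2, c2, d2⟩ := inv1_iff.1 ((D.isMorph_res L T).p1_inv h')
  refine inv1_iff.2 ⟨mul_mem a1 a2, mul_mem b2 b1, ?_, ?_⟩
  · rw [mul_assoc, ← mul_assoc _ _ ((D.isMorph_res L S).p1 w), c2, one_mul, c1]
  · rw [mul_assoc, ← mul_assoc _ _ ((D.isMorph_res L T).p1 v'), d1, one_mul, d2]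

/-- On `B_S` the projection to `T` is the counit, so normalisation turns the second factor into the
unit. -/
theorem incl_p2_res {σ : Fn (X2 (D.restrict S) L)} {σ' : Fn (X2 (D.restrict T) L)}
    (h' : Cocycle σ') : (D.isMorph_incl L S).p2
      ((D.isMorph_res L S).p2 σ * (D.isMorph_res L T).p2 σ') = σ := by
  have e1 : (D.isMorph_incl L S).p2 ((D.isMorph_res L S).p2 σ) = σ := fn2_ext fun r s => by
    rw [IsMorph.p2_apply, IsMorph.p2_apply, res_incl, res_incl]
  have e2 : (D.isMorph_incl L S).p2 ((D.isMorph_res L T).p2 σ') = 1 := fn2_ext fun r s => by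
    rw [IsMorph.p2_apply, IsMorph.p2_apply, res_incl_of_disjoint D L hST,
      Algebra.algebraMap_eq_smul_one, ← TensorProduct.smul_tmul', map_smul, h'.norm_left,
      (D.isMorph_res L T).counit_apply, (D.isMorph_incl L S).counit_apply]
    change _ = tens ((D.restrict S).eps L) ((D.restrict S).eps L) (r ⊗ₜ s)
    simp [tens]
  rw [map_mul, e1, e2, mul_one]

theorem incl_p2_res_right {σ : Fn (X2 (D.restrict S) L)} {σ' : Fn (X2 (D.restrict T) L)}
    (h : Cocycle σ) (h' : Cocycle σ') : (D.isMorph_incl L T).p2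
      ((D.isMorph_res L S).p2 σ * (D.isMorph_res L T).p2 σ') = σ' := by
  rw [(p2_commute hST h.inv h'.inv).eq, incl_p2_res hST.symm h]

end Products

/-! ### Generators of `K` under restriction -/

section Generators

variable {k G ι : Type*} [Field k] [CommGroup G] [LinearOrder ι] {D : QLS k G ι} {S T : Finset ι}

theorem incl_root (S : Finset ι) (i : S) : D.incl .pre S ((D.restrict S).root ((D.restrict S).x _) i)
    = D.root (D.x .pre) i := by
  rw [map_root]
  simp only [incl_x]
  rfl

theorem incl_link (S : Finset ι) (j i : S) :
    D.incl .pre S ((D.restrict S).link ((D.restrict S).x _) j i) = D.link (D.x .pre) j i := by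
  rw [map_link]
  simp only [incl_x]
  rfl

theorem incl_gens {z : (D.restrict S).R} (hz : z ∈ (D.restrict S).gens) :
    D.incl .pre S z ∈ D.gens := by
  rcases hz with ⟨i, rfl⟩ | ⟨i, j, h1, h2, rfl⟩
  · rw [incl_root]
    exact Or.inl ⟨i, rfl⟩
  · rw [incl_link]
    exact Or.inr ⟨i, j, h1, (D.linkable_restrict S i j).1 h2, rfl⟩

theorem res_root (S : Finset ι) (i : ι) : D.res .pre S (D.root (D.x _) i) =
    if h : i ∈ S then (D.restrict S).root ((D.restrict S).x _) ⟨i, h⟩ else 0 := by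
  rw [map_root]
  simp only [res_x]
  exact root_xres D _ S i

theorem res_link (S : Finset ι) (j i : ι) : D.res .pre S (D.link (D.x _) j i) =
    if h : i ∈ S ∧ j ∈ S then (D.restrict S).link ((D.restrict S).x _) ⟨j, h.2⟩ ⟨i, h.1⟩
    else 0 := by
  rw [map_link]
  simp only [res_x]
  exact link_xres D _ S j i

theorem incl_res_gens (S : Finset ι) {z : D.R} (hz : z ∈ D.gens) :
    D.incl .pre S (D.res .pre S z) = z ∨ D.res .pre S z = 0 := by
  rcases hz with ⟨i, rfl⟩ | ⟨i, j, h1, h2, rfl⟩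
  · rw [res_root]
    split_ifs with h
    · exact Or.inl (incl_root S _)
    · exact Or.inr rfl
  · rw [res_link]
    split_ifs with h
    · exact Or.inl (incl_link S _ _)
    · exact Or.inr rfl

/-- The absence of links between `S` and `T` forces both vertices of a link to lie on the same side.
-/
theorem gens_split (hST : Disjoint S T) (hcover : ∀ i, i ∈ S ∨ i ∈ T)
    (hlink : ∀ i ∈ S, ∀ j ∈ T, ¬ D.Linkable i j) {z : D.R} (hz : z ∈ D.gens) :
    (D.incl .pre S (D.res .pre S z) = z ∧ D.res .pre T z = 0) ∨
      (D.res .pre S z = 0 ∧ D.incl .pre T (D.res .pre T z) = z) := by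
  have hS := fun i (h : i ∈ S) => Finset.disjoint_left.1 hST h
  have hT := fun i (h : i ∈ T) => Finset.disjoint_right.1 hST h
  rcases hz with ⟨i, rfl⟩ | ⟨i, j, h1, h2, rfl⟩
  · rw [res_root, res_root]
    rcases hcover i with h | h
    · rw [dif_pos h, dif_neg (hS i h)]
      exact Or.inl ⟨incl_root S _, rfl⟩
    · rw [dif_neg (hT i h), dif_pos h]
      exact Or.inr ⟨rfl, incl_root T _⟩
  · rw [res_link, res_link]
    rcases hcover i with h | h
    · have h' : j ∈ S := (hcover j).resolve_right fun h' => hlink i h j h' h2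
      rw [dif_pos ⟨h, h'⟩, dif_neg fun e => hS i h e.1]
      exact Or.inl ⟨incl_link S _ _, rfl⟩
    · have h' : j ∈ T := (hcover j).resolve_left fun h' => hlink j h' i h h2.symm
      rw [dif_neg fun e => hT i h e.1, dif_pos ⟨h, h'⟩]
      exact Or.inr ⟨rfl, incl_link T _ _⟩

theorem resK_inclK (y : (D.restrict S).K) : D.resK S (D.inclK S y) = y :=
  Subtype.ext (D.res_incl .pre S y)

end Generators

/-! ### Ordered monomials under restriction -/

section Monomials

variable {k G ι : Type*} [Field k] [CommGroup G] [LinearOrder ι] [Fintype ι] {D : QLS k G ι}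
  {S : Finset ι}

theorem list_prod_filter {ι M : Type*} [Monoid M] (p : ι → Prop) [DecidablePred p] (f : ι → M)
    (hf : ∀ i, ¬ p i → f i = 1) (l : List ι) : ((l.filter p).map f).prod = (l.map f).prod := by
  induction l with
  | nil => rfl
  | cons i l ih =>
    by_cases h : p i
    · simp [h, ih]
    · simp [h, ih, hf i h]

theorem sort_univ_map_val (S : Finset ι) :
    ((Finset.univ : Finset S).sort (· ≤ ·)).map Subtype.val
      = ((Finset.univ : Finset ι).sort (· ≤ ·)).filter (· ∈ S) := by
  refine List.Perm.eq_of_pairwise (le := (· ≤ ·)) (fun a b _ _ => le_antisymm) ?_ ?_ ?_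
  · exact List.pairwise_map.2 (Finset.pairwise_sort _ _)
  · exact (Finset.pairwise_sort _ _).filter _
  · refine (List.perm_ext_iff_of_nodup ((Finset.sort_nodup _ _).map Subtype.val_injective)
      ((Finset.sort_nodup _ _).filter _)).2 fun i => ?_
    simp

theorem incl_mono (a : S → ℕ) : D.incl .pre S ((D.restrict S).mono a)
    = D.mono (fun i => if h : i ∈ S then a ⟨i, h⟩ else 0) := by
  rw [mono, mono, ← list_prod_filter (· ∈ S) _ (fun i hi => by simp [hi]), ← sort_univ_map_val,
    map_list_prod, List.map_map, List.map_map]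
  congr 1
  refine List.map_congr_left fun i _ => ?_
  simp

theorem incl_res_mono {a : ι → ℕ} (h : ∀ i, i ∉ S → a i = 0) :
    D.incl .pre S (D.res .pre S (D.mono a)) = D.mono a := by
  rw [mono, map_list_prod, map_list_prod, List.map_map, List.map_map]
  congr 1
  refine List.map_congr_left fun i _ => ?_
  by_cases hi : i ∈ S
  · simp [res_x_mem D _ S hi]
  · simp [h i hi]

theorem res_mono_eq_zero {a : ι → ℕ} {i : ι} (hi : i ∉ S) (h : a i ≠ 0) :
    D.res .pre S (D.mono a) = 0 := by
  rw [mono, map_list_prod, List.map_map]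
  refine List.prod_eq_zero (List.mem_map.2 ⟨i, by simp, ?_⟩)
  simp [res_x_notMem D _ S hi, h]

end Monomials

/-! ### Retractions of subdiagrams -/

section Retractions

variable {k G ι : Type*} [Field k] [CommGroup G] [LinearOrder ι] [Fintype ι] {D : QLS k G ι}
  {u : D.R →ₗ[k] D.K} (hu : D.IsRetraction u) (S T : Finset ι)
include hu

theorem IsRetraction.restrict : (D.restrict S).IsRetraction
    ((D.resK S).toLinearMap ∘ₗ u ∘ₗ (D.incl .pre S).toLinearMap) where
  ideal w hw := by
    refine eq_zero_of_mem_J (fun z hz a b r => ?_) hw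
    have := hu.ideal _ (D.J.mul_mem_right _ (D.incl .pre S b) (D.J.mul_mem_left
      (D.incl .pre S a) _ (bracket_mem_J (incl_gens hz) (D.incl .pre S r))))
    simp [this]
  mono_mul a ha y := by
    have h := hu.mono_mul (fun i => if h : i ∈ S then a ⟨i, h⟩ else 0) (fun i => by
      split_ifs with h
      · exact ha ⟨i, h⟩
      · exact D.N_pos i) (D.inclK S y)
    rw [← incl_mono, (D.isMorph_incl .pre S).counit_apply] at h
    simp only [LinearMap.comp_apply, AlgHom.toLinearMap_apply, map_mul]
    refine (congrArg (D.resK S) h).trans ?_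
    rw [map_smul, resK_inclK]
  left_linear y r := by
    have h := hu.left_linear (D.inclK S y) (D.incl .pre S r)
    simp only [LinearMap.comp_apply, AlgHom.toLinearMap_apply, map_mul]
    refine (congrArg (D.resK S) h).trans ?_
    rw [map_mul, resK_inclK]
  right_linear y r := by
    have h := hu.right_linear (D.inclK S y) (D.incl .pre S r)
    simp only [LinearMap.comp_apply, AlgHom.toLinearMap_apply, map_mul]
    refine (congrArg (D.resK S) h).trans ?_
    rw [map_mul, resK_inclK]

/-- The projection `e_S` either fixes a monomial or kills it. In the second case the monomial is not
`1`, so its counit vanishes too. -/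
theorem IsRetraction.comp_eR : u ∘ₗ D.eR S = D.eK S ∘ₗ u := by
  refine linearMap_ext_mono (fun w hw => ?_) (fun w hw => ?_) fun a ha y => ?_
  · refine eq_zero_of_mem_J (θ := u ∘ₗ D.eR S) (fun z hz a b r => hu.ideal _ ?_) hw
    simp only [eR, LinearMap.comp_apply, AlgHom.toLinearMap_apply, map_mul, map_sub]
    rcases incl_res_gens S hz with h | h
    · rw [h]
      exact D.J.mul_mem_right _ _ (D.J.mul_mem_left _ _ (bracket_mem_J hz _))
    · simp only [h, map_zero, mul_zero, zero_mul, sub_self]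
      exact zero_mem _
  · rw [LinearMap.comp_apply, hu.ideal w hw, map_zero]
  · rw [LinearMap.comp_apply, LinearMap.comp_apply, hu.mono_mul a ha, map_smul]
    have e : D.eR S (D.mono a * y)
        = D.incl .pre S (D.res .pre S (D.mono a)) * ((D.eK S y : D.K) : D.R) := by
      simp only [eR, LinearMap.comp_apply, AlgHom.toLinearMap_apply, map_mul]
      rfl
    rw [e]
    by_cases h : ∀ i, i ∉ S → a i = 0
    · rw [incl_res_mono h, hu.mono_mul a ha]
    · push Not at h
      obtain ⟨i, hi, h⟩ := h
      rw [res_mono_eq_zero hi h, map_zero, zero_mul, map_zero,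
        counit_mono_of_ne fun e => h (congrFun e i), zero_smul]

end Retractions

/-! ### The decomposition `R = R_S R_T` -/

section Decomposition

variable {k G ι : Type*} [Field k] [CommGroup G] [LinearOrder ι] {D : QLS k G ι} {L : Layer}
  {S T : Finset ι}

theorem x_mul_incl {i : ι} (h : ∀ s ∈ S, s ≠ i ∧ ¬ D.Linkable s i) (a : (D.restrict S).Alg L) :
    D.x L i * D.incl L S a = D.incl L S ((D.restrict S).act L (D.g i) a) * D.x L i := by
  induction a using word_induction with
  | one => simp
  | add a b ha hb => simp only [map_add, mul_add, add_mul, ha, hb]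
  | smul c a ha => simp only [map_smul, mul_smul_comm, smul_mul_assoc, ha]
  | x_mul s a ih =>
    have e : D.x L i * D.x L s = (D.χ s (D.g i) : k) • (D.x L s * D.x L i) :=
      x_swap (h s s.2).1 (h s s.2).2
    rw [map_mul, map_mul, map_mul, incl_x, act_x, map_smul, incl_x, ← mul_assoc, e,
      smul_mul_assoc, mul_assoc, ih, smul_mul_assoc, smul_mul_assoc, mul_assoc]
    rfl

/-- A letter from `T` can be moved to the right past `R_S` at the cost of the action on `R_S`, so
the products `ab` span a left ideal that contains `1`. -/
theorem linearMap_ext_split (hST : Disjoint S T) (hcover : ∀ i, i ∈ S ∨ i ∈ T)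
    (hlink : ∀ i ∈ S, ∀ j ∈ T, ¬ D.Linkable i j) {M : Type*} [AddCommGroup M] [Module k M]
    {F F' : D.Alg L →ₗ[k] M}
    (h : ∀ a b, F (D.incl L S a * D.incl L T b) = F' (D.incl L S a * D.incl L T b)) : F = F' := by
  let W : Submodule k (D.Alg L) := Submodule.span k
    {r | ∃ a b, r = D.incl L S a * D.incl L T b}
  have hW : ∀ r, r ∈ W := fun r => by
    induction r using word_induction with
    | one => exact Submodule.subset_span ⟨1, 1, by simp⟩
    | add a b ha hb => exact add_mem ha hb
    | smul c a ha => exact W.smul_mem c ha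
    | x_mul i r ih =>
      induction ih using Submodule.span_induction with
      | mem r hr =>
        obtain ⟨a, b, rfl⟩ := hr
        refine Submodule.subset_span ?_
        rcases hcover i with hi | hi
        · refine ⟨(D.restrict S).x L ⟨i, hi⟩ * a, b, ?_⟩
          rw [map_mul, incl_x, mul_assoc]
        · refine ⟨(D.restrict S).act L (D.g i) a, (D.restrict T).x L ⟨i, hi⟩ * b, ?_⟩
          rw [map_mul, incl_x, ← mul_assoc, x_mul_incl, mul_assoc]
          exact fun s hs => ⟨fun e => Finset.disjoint_left.1 hST hs (e ▸ hi), hlink s hs i hi⟩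
      | zero => rw [mul_zero]; exact zero_mem _
      | add a b _ _ ha hb => rw [mul_add]; exact add_mem ha hb
      | smul c a _ ha => rw [mul_smul_comm]; exact W.smul_mem c ha
  refine LinearMap.ext fun r => ?_
  refine LinearMap.eqOn_span' (f := F) (g := F') (s := {r | ∃ a b, r = D.incl L S a * D.incl L T b})
    ?_ (hW r)
  rintro _ ⟨a, b, rfl⟩
  exact h a b

/-- Letters from `S` are killed by `p_T` and go to the first map; letters from `T` go to the second
one. The action appears only on the image of `1` and is trivial. -/
theorem bconv_res_incl_mul (hST : Disjoint S T) {A B M : Type*} [AddCommGroup A] [Module k A]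
    [AddCommGroup B] [Module k B] [AddCommGroup M] [Module k M] (β : A →ₗ[k] B →ₗ[k] M)
    (f : (D.restrict S).Alg L →ₗ[k] A) (f' : (D.restrict T).Alg L →ₗ[k] B)
    (a : (D.restrict S).Alg L) (b : (D.restrict T).Alg L) :
    bconv (D.comul L) β (f ∘ₗ (D.res L S).toLinearMap) (f' ∘ₗ (D.res L T).toLinearMap)
      (D.incl L S a * D.incl L T b) = β (f a) (f' b) := by
  have hmem : ∀ (S : Finset ι) (i : S), (D.res L S).toLinearMap ∘ₗ lm (D.x L i)
      = lm ((D.restrict S).x L i) ∘ₗ (D.res L S).toLinearMap := fun S i =>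
    LinearMap.ext fun r => by simp [res_x_mem D L S i.2]
  have hnot : ∀ (S : Finset ι) (i : ι), i ∉ S → (D.res L S).toLinearMap ∘ₗ lm (D.x L i) = 0 :=
    fun S i h => LinearMap.ext fun r => by simp [res_x_notMem D L S h]
  revert f
  induction a using word_induction with
  | one =>
    intro f
    rw [map_one, one_mul]
    revert f f'
    induction b using word_induction with
    | one => intro f f'; rw [map_one, bconv_one]; simp
    | add a b ha hb => intro f f'; simp only [map_add, ha, hb]
    | smul c a ha => intro f f'; simp only [map_smul, ha]
    | x_mul i b ih =>
      intro f f'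
      rw [map_mul, incl_x, bconv_x_mul, LinearMap.comp_assoc,
        hnot S i (Finset.disjoint_right.1 hST i.2), LinearMap.comp_zero, bconv_zero_left,
        LinearMap.zero_apply, zero_add, LinearMap.comp_assoc, (D.isMorph_res L S).comp_act,
        LinearMap.comp_assoc, hmem, ← LinearMap.comp_assoc, ← LinearMap.comp_assoc, ih]
      simp
  | add a a' ha hb => intro f; simp only [map_add, add_mul, ha, hb, LinearMap.add_apply]
  | smul c a ha => intro f; simp only [map_smul, smul_mul_assoc, ha, LinearMap.smul_apply]
  | x_mul i a ih =>
    intro f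
    rw [map_mul (D.incl L S), incl_x, mul_assoc, bconv_x_mul, LinearMap.comp_assoc, hmem,
      LinearMap.comp_assoc (f := lm _) (g := (D.res L T).toLinearMap),
      hnot T i (Finset.disjoint_left.1 hST i.2), LinearMap.comp_zero, bconv_zero_right,
      LinearMap.zero_apply, add_zero, ← LinearMap.comp_assoc, ih]
    simp

end Decomposition

/-! ### The isomorphism `ρ¹` -/

section Characters

variable {k G ι : Type*} [Field k] [CommGroup G] [LinearOrder ι] {D : QLS k G ι} {S T : Finset ι}

theorem res_gens (S : Finset ι) {z : D.R} (hz : z ∈ D.gens) :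
    D.res .pre S z ∈ (D.restrict S).gens ∨ D.res .pre S z = 0 := by
  rcases hz with ⟨i, rfl⟩ | ⟨i, j, h1, h2, rfl⟩
  · rw [res_root]
    split_ifs with h
    · exact Or.inl (Or.inl ⟨_, rfl⟩)
    · exact Or.inr rfl
  · rw [res_link]
    split_ifs with h
    · exact Or.inl (Or.inr ⟨⟨i, h.1⟩, ⟨j, h.2⟩, h1, (D.linkable_restrict S _ _).2 h2, rfl⟩)
    · exact Or.inr rfl

/-- The pullback of an algebra map along `p_S : K → K_S`. -/
def AlgG.comapRes (D : QLS k G ι) (S : Finset ι) (f : (D.restrict S).AlgG) : D.AlgG :=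
  ⟨f.1.comp (D.resK S), fun h y => by rw [actK_eq]⟩

/-- The pullback of an algebra map along `i_S : K_S → K`. -/
def AlgG.comapIncl (D : QLS k G ι) (S : Finset ι) (f : D.AlgG) : (D.restrict S).AlgG :=
  ⟨f.1.comp (D.inclK S), fun h y => by rw [actK_eq]⟩

theorem AlgG.comapRes_mul (f f' : (D.restrict S).AlgG) :
    AlgG.comapRes D S (f * f') = AlgG.comapRes D S f * AlgG.comapRes D S f' :=
  AlgG.ext fun z hz => by
    rw [AlgG.mul_gens]
    change (f * f').1 (D.resK S (toK hz)) = f.1 (D.resK S (toK hz)) + f'.1 (D.resK S (toK hz))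
    rcases res_gens S hz with h | h
    · exact AlgG.mul_gens f f' h
    · have : D.resK S (toK hz) = 0 := Subtype.ext h
      simp [this]

theorem AlgG.mul_comm (f f' : D.AlgG) : f * f' = f' * f :=
  AlgG.ext fun z hz => by rw [AlgG.mul_gens, AlgG.mul_gens, add_comm]

theorem AlgG.mul_assoc (f f' f'' : D.AlgG) : f * f' * f'' = f * (f' * f'') :=
  AlgG.ext fun z hz => by simp only [AlgG.mul_gens, add_assoc]

theorem AlgG.comapIncl_mul_comapRes (hST : Disjoint S T) (f : (D.restrict S).AlgG)
    (f' : (D.restrict T).AlgG) :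
    AlgG.comapIncl D S (AlgG.comapRes D S f * AlgG.comapRes D T f') = f :=
  AlgG.ext fun z hz => by
    refine (AlgG.mul_gens _ _ (incl_gens hz)).trans ?_
    have e1 : D.resK S (toK (incl_gens hz)) = toK hz := resK_inclK (toK hz)
    have e2 : D.resK T (toK (incl_gens hz)) = 0 := Subtype.ext <| by
      refine (D.res_incl_of_disjoint .pre hST z).trans ?_
      rw [counit_gens hz, map_zero]
      rfl
    change f.1 (D.resK S (toK (incl_gens hz))) + f'.1 (D.resK T (toK (incl_gens hz))) = _
    rw [e1, e2, map_zero, add_zero]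

/-- The isomorphism `Alg_G(K_S, k) × Alg_G(K_T, k) ≃ Alg_G(K, k)`. -/
def AlgG.split (hST : Disjoint S T) (hcover : ∀ i, i ∈ S ∨ i ∈ T)
    (hlink : ∀ i ∈ S, ∀ j ∈ T, ¬ D.Linkable i j) :
    (D.restrict S).AlgG × (D.restrict T).AlgG ≃* D.AlgG where
  toFun p := AlgG.comapRes D S p.1 * AlgG.comapRes D T p.2
  invFun g := (AlgG.comapIncl D S g, AlgG.comapIncl D T g)
  left_inv p := Prod.ext (AlgG.comapIncl_mul_comapRes hST _ _) <| by
    change AlgG.comapIncl D T (AlgG.comapRes D S p.1 * AlgG.comapRes D T p.2) = p.2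
    rw [AlgG.mul_comm (AlgG.comapRes D S p.1)]
    exact AlgG.comapIncl_mul_comapRes hST.symm _ _
  right_inv g := AlgG.ext fun z hz => by
    rw [AlgG.mul_gens]
    change g.1 (D.inclK S (D.resK S (toK hz))) + g.1 (D.inclK T (D.resK T (toK hz))) = _
    rcases gens_split hST hcover hlink hz with ⟨h1, h2⟩ | ⟨h1, h2⟩
    · have e1 : D.inclK S (D.resK S (toK hz)) = toK hz := Subtype.ext h1
      have e2 : D.resK T (toK hz) = 0 := Subtype.ext h2
      rw [e1, e2, map_zero, map_zero, add_zero]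
    · have e1 : D.resK S (toK hz) = 0 := Subtype.ext h1
      have e2 : D.inclK T (D.resK T (toK hz)) = toK hz := Subtype.ext h2
      rw [e1, e2, map_zero, map_zero, zero_add]
  map_mul' p q := by
    change AlgG.comapRes D S (p.1 * q.1) * AlgG.comapRes D T (p.2 * q.2) = _
    rw [AlgG.comapRes_mul, AlgG.comapRes_mul]
    simp only [AlgG.mul_assoc]
    rw [← AlgG.mul_assoc (AlgG.comapRes D S q.1), AlgG.mul_comm (AlgG.comapRes D S q.1)]
    simp only [AlgG.mul_assoc]

theorem AlgG.comapRes_mul_comapRes (f : (D.restrict S).AlgG) (f' : (D.restrict T).AlgG) :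
    (AlgG.comapRes D S f * AlgG.comapRes D T f').1.toLinearMap
      = tens f.1.toLinearMap f'.1.toLinearMap ∘ₗ D.rhoK S T := by
  rw [AlgG.mul_def]
  change conv D.comulK.toLinearMap (f.1.toLinearMap ∘ₗ (D.resK S).toLinearMap)
    (f'.1.toLinearMap ∘ₗ (D.resK T).toLinearMap) = _
  rw [conv, TensorProduct.map_comp]
  rfl

theorem p1_mul_p1_K {v : Fn (XC (D.restrict S) .pre)} {v' : Fn (XC (D.restrict T) .pre)}
    {f : (D.restrict S).AlgG} {f' : (D.restrict T).AlgG}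
    (h : v.ev ∘ₗ (D.restrict S).K.val.toLinearMap = f.1.toLinearMap)
    (h' : v'.ev ∘ₗ (D.restrict T).K.val.toLinearMap = f'.1.toLinearMap) :
    ((D.isMorph_res .pre S).p1 v * (D.isMorph_res .pre T).p1 v').ev ∘ₗ D.K.val.toLinearMap
      = (AlgG.comapRes D S f * AlgG.comapRes D T f').1.toLinearMap := by
  rw [AlgG.mul_def]
  refine LinearMap.ext fun y => ?_
  change conv (D.comul .pre) (v.ev ∘ₗ (D.res .pre S).toLinearMap)
    (v'.ev ∘ₗ (D.res .pre T).toLinearMap) y = conv D.comulK.toLinearMap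
      (f.1.toLinearMap ∘ₗ (D.resK S).toLinearMap) (f'.1.toLinearMap ∘ₗ (D.resK T).toLinearMap) y
  rw [← h, ← h']
  simp only [conv, LinearMap.comp_apply, ← valval_comulK, valval]
  rw [← LinearMap.comp_apply (TensorProduct.map _ _) (TensorProduct.map _ _),
    ← TensorProduct.map_comp]
  rfl

end Characters

/-! ### The map `ρ²` and the commuting square -/

section Cohomology

variable {k G ι : Type*} [Field k] [CommGroup G] [LinearOrder ι] {D : QLS k G ι} {S T : Finset ι}

/-- A cocycle as a functional on the braided tensor square. -/
def Z2.fn (σ : D.Z2) : Fn (X2 D .nichols) := σ.1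

theorem Z2.cocycle (σ : D.Z2) : Cocycle σ.fn := isCocycle_iff.1 σ.2

theorem Z2.ext {σ σ' : D.Z2} (h : σ.fn = σ'.fn) : σ = σ' := Subtype.ext h

/-- The cocycle `ρ²(σ, σ')`. -/
def Z2.prod (hST : Disjoint S T) (σ : (D.restrict S).Z2) (σ' : (D.restrict T).Z2) : D.Z2 :=
  ⟨D.rho2 S T σ.fn σ'.fn, isCocycle_iff.2 <|
    Eq.mpr (congrArg Cocycle (rho2_eq σ.fn σ'.fn)) (cocycle_mul hST σ.cocycle σ'.cocycle)⟩

theorem Z2.prod_fn (hST : Disjoint S T) (σ : (D.restrict S).Z2) (σ' : (D.restrict T).Z2) :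
    (Z2.prod hST σ σ').fn
      = (D.isMorph_res .nichols S).p2 σ.fn * (D.isMorph_res .nichols T).p2 σ'.fn :=
  rho2_eq σ.fn σ'.fn

theorem cohomologous_iff {σ σ' : D.Z2} : D.Cohomologous σ σ' ↔
    ∃ χ χ' : Fn (XC D .nichols), D.Inv1 .nichols χ χ' ∧ σ'.fn = D.twist .nichols χ χ' σ.fn :=
  Iff.rfl

/-- The map `ρ²` on classes. -/
def H2.prod (hST : Disjoint S T) (p : (D.restrict S).H2 × (D.restrict T).H2) : D.H2 :=
  Quot.map₂ (Z2.prod hST)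
    (fun σ σ₁ σ₂ h => by
      obtain ⟨χ, χ', hχ, e⟩ := cohomologous_iff.1 h
      refine cohomologous_iff.2 ⟨_, _, (D.isMorph_res .nichols T).p1_inv hχ, ?_⟩
      rw [Z2.prod_fn, Z2.prod_fn, e]
      exact twist_mul_right hST σ.cocycle.inv hχ)
    (fun σ₁ σ₂ σ h => by
      obtain ⟨χ, χ', hχ, e⟩ := cohomologous_iff.1 h
      refine cohomologous_iff.2 ⟨_, _, (D.isMorph_res .nichols S).p1_inv hχ, ?_⟩
      rw [Z2.prod_fn, Z2.prod_fn, e]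
      exact twist_mul_left hST σ.cocycle.inv hχ) p.1 p.2

/-- The pullback of a cocycle along `i_S : B_S → B`. -/
def Z2.restrict (S : Finset ι) (σ : D.Z2) : (D.restrict S).Z2 :=
  ⟨(D.isMorph_incl .nichols S).p2 σ.fn,
    isCocycle_iff.2 ((D.isMorph_incl .nichols S).p2_cocycle σ.cocycle)⟩

theorem Z2.restrict_fn (S : Finset ι) (σ : D.Z2) :
    (Z2.restrict S σ).fn = (D.isMorph_incl .nichols S).p2 σ.fn := rfl

/-- The pullback of a class along `i_S : B_S → B`. -/
def H2.restrict (S : Finset ι) : D.H2 → (D.restrict S).H2 :=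
  Quot.map (Z2.restrict S) fun σ σ' h => by
    obtain ⟨χ, χ', hχ, e⟩ := cohomologous_iff.1 h
    refine cohomologous_iff.2 ⟨_, _, (D.isMorph_incl .nichols S).p1_inv hχ, ?_⟩
    rw [Z2.restrict_fn, Z2.restrict_fn, e]
    exact (D.isMorph_incl .nichols S).p2_twist χ χ' σ.fn

/-- The restrictions to `B_S` and `B_T` are a left inverse of `ρ²` even on cocycles, which gives
injectivity on classes. -/
theorem H2.restrict_prod (hST : Disjoint S T) (p : (D.restrict S).H2 × (D.restrict T).H2) :
    (H2.restrict S (H2.prod hST p), H2.restrict T (H2.prod hST p)) = p := by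
  obtain ⟨⟨σ⟩, ⟨σ'⟩⟩ := p
  refine Prod.ext (congrArg (Quot.mk _) (Z2.ext ?_)) (congrArg (Quot.mk _) (Z2.ext ?_))
  · rw [Z2.restrict_fn, Z2.prod_fn]
    exact incl_p2_res hST σ'.cocycle
  · rw [Z2.restrict_fn, Z2.prod_fn]
    exact incl_p2_res_right hST σ.cocycle σ'.cocycle

theorem H2.prod_injective (hST : Disjoint S T) :
    Function.Injective (H2.prod (D := D) hST) := fun p q h => by
  rw [← H2.restrict_prod hST p, h, H2.restrict_prod]

theorem pull_eq (σ : D.Z2) : D.pull σ = (isMorph_pi D).p2 σ.fn := rfl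

theorem pull_prod (hST : Disjoint S T) (σ : (D.restrict S).Z2) (σ' : (D.restrict T).Z2) :
    D.pull (Z2.prod hST σ σ') = (D.isMorph_res .pre S).p2 ((D.restrict S).pull σ)
      * (D.isMorph_res .pre T).p2 ((D.restrict T).pull σ') := by
  have key : ∀ (S : Finset ι) (σ : (D.restrict S).Z2),
      (isMorph_pi D).p2 ((D.isMorph_res .nichols S).p2 σ.fn)
        = (D.isMorph_res .pre S).p2 ((isMorph_pi (D.restrict S)).p2 σ.fn) := fun S σ =>
    fn2_ext fun r s => by
      rw [IsMorph.p2_apply, IsMorph.p2_apply, IsMorph.p2_apply, IsMorph.p2_apply, res_pi, res_pi]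
  rw [pull_eq, Z2.prod_fn, map_mul, key, key]
  rfl

/-- The product of the pulled back extensions of `f` and `f'` extends `ρ¹(f, f')`, and its
coboundary is the pullback of the product cocycle. By independence of the extension there is no need
to compare it with the one built from `u`. -/
theorem connecting_prod [Fintype ι] {u : D.R →ₗ[k] D.K}
    {uS : (D.restrict S).R →ₗ[k] (D.restrict S).K} {uT : (D.restrict T).R →ₗ[k] (D.restrict T).K}
    {δ : D.AlgG → D.H2} {δS : (D.restrict S).AlgG → (D.restrict S).H2}
    {δT : (D.restrict T).AlgG → (D.restrict T).H2} (hST : Disjoint S T) (hδ : D.IsConnecting u δ)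
    (hδS : (D.restrict S).IsConnecting uS δS) (hδT : (D.restrict T).IsConnecting uT δT)
    (f : (D.restrict S).AlgG) (f' : (D.restrict T).AlgG) :
    δ (AlgG.comapRes D S f * AlgG.comapRes D T f') = H2.prod hST (δS f, δT f') := by
  obtain ⟨_, v, σ, -, -, h1, h2, h3, h4⟩ := hδS.formula f
  obtain ⟨_, v', σ', -, -, h1', h2', h3', h4'⟩ := hδT.formula f'
  rw [h4, h4']
  refine hδ.independent _ _ _ (Z2.prod hST σ σ') (inv1_mul h1 h1') (p1_mul_p1_K h2 h2') ?_
  rw [pull_prod, h3, h3']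
  exact bdry_mul hST h1 h1'

end Cohomology

end QLS
end

theorem proposition3p6 {k G ι : Type*} [Field k] [CommGroup G] [Fintype ι] [LinearOrder ι]
    (D : QLS k G ι) (S T : Finset ι) (hST : Disjoint S T) (hcover : S ∪ T = Finset.univ)
    (hlink : ∀ i ∈ S, ∀ j ∈ T, ¬ D.Linkable i j) :
    ∃ (u : D.R →ₗ[k] D.K)
      (uS : (D.restrict S).R →ₗ[k] (D.restrict S).K)
      (uT : (D.restrict T).R →ₗ[k] (D.restrict T).K),
      D.IsRetraction u ∧ (D.restrict S).IsRetraction uS ∧ (D.restrict T).IsRetraction uT ∧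
      uS = (D.resK S).toLinearMap ∘ₗ u ∘ₗ (D.incl .pre S).toLinearMap ∧
      uT = (D.resK T).toLinearMap ∘ₗ u ∘ₗ (D.incl .pre T).toLinearMap ∧
      u ∘ₗ D.eR S = D.eK S ∘ₗ u ∧
      u ∘ₗ D.eR T = D.eK T ∘ₗ u ∧
      u = QLS.conv (D.comul .pre) (u ∘ₗ D.eR S) (u ∘ₗ D.eR T) ∧
      ∃ (δ : D.AlgG → D.H2) (δS : (D.restrict S).AlgG → (D.restrict S).H2)
        (δT : (D.restrict T).AlgG → (D.restrict T).H2)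
        (ρ₁ : (D.restrict S).AlgG × (D.restrict T).AlgG ≃* D.AlgG)
        (ρ₂ : (D.restrict S).H2 × (D.restrict T).H2 → D.H2),
        D.IsConnecting u δ ∧ (D.restrict S).IsConnecting uS δS ∧
        (D.restrict T).IsConnecting uT δT ∧
        (∀ f f', (ρ₁ (f, f')).1.toLinearMap =
          QLS.tens f.1.toLinearMap f'.1.toLinearMap ∘ₗ D.rhoK S T) ∧
        (∀ σ σ', ∃ τ : D.Z2, τ.1 = D.rho2 S T σ.1 σ'.1 ∧
          ρ₂ ((D.restrict S).cls σ, (D.restrict T).cls σ') = D.cls τ) ∧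
        Function.Injective ρ₂ ∧
        ∀ f f', δ (ρ₁ (f, f')) = ρ₂ (δS f, δT f') := by
  have hc : ∀ i, i ∈ S ∨ i ∈ T := fun i => by
    rw [← Finset.mem_union, hcover]
    exact Finset.mem_univ i
  obtain ⟨u, hu, hmul⟩ := D.exists_isRetraction
  have hconv : u = QLS.conv (D.comul .pre) (u ∘ₗ D.eR S) (u ∘ₗ D.eR T) := by
    -- On products `ab` with `a ∈ R_S`, `b ∈ R_T`, the left side is `u(a) u(b)` by multiplicativity
    -- in the model, and the convolution is evaluated by `bconv_res_incl_mul`.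
    refine QLS.linearMap_ext_split hST hc hlink fun a b => ?_
    rw [hmul S T hST hcover hlink]
    exact (QLS.bconv_res_incl_mul hST (LinearMap.mul k D.K) (u ∘ₗ (D.incl .pre S).toLinearMap)
      (u ∘ₗ (D.incl .pre T).toLinearMap) a b).symm
  obtain ⟨δ, hδ⟩ := QLS.exists_isConnecting hu
  obtain ⟨δS, hδS⟩ := QLS.exists_isConnecting (hu.restrict S)
  obtain ⟨δT, hδT⟩ := QLS.exists_isConnecting (hu.restrict T)
  exact ⟨u, _, _, hu, hu.restrict S, hu.restrict T, rfl, rfl, hu.comp_eR S, hu.comp_eR T, hconv,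
    δ, δS, δT, QLS.AlgG.split hST hc hlink, QLS.H2.prod hST, hδ, hδS, hδT,
    fun f f' => QLS.AlgG.comapRes_mul_comapRes f f', fun σ σ' => ⟨QLS.Z2.prod hST σ σ', rfl, rfl⟩,
    QLS.H2.prod_injective hST, QLS.connecting_prod hST hδ hδS hδT⟩
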